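/- **Dimensions.** $\dim$ is covering dimension, $\mathrm{ind}$ and $\mathrm{Ind}$ are the small and large inductive dimensions. $\mathrm{Ind}_0$ is the Charalambous–Filippov–Ivanov dimension: $\mathrm{Ind}_0X=-1$ iff $X=\emptyset$, and for $n\ge 0$, $\mathrm{Ind}_0X\le n$ iff between every two disjoint closed sets $A,B\subset X$ there is a partition $L$ which is a $G_\delta$-set and has $\mathrm{Ind}_0L\le n-1$. (A closed set $L$ is a partition between $A$ and $B$ if $X\setminus L=U\cup V$ for some disjoint open $U\supset A$, $V\supset B$.) A continuum is a non-empty connected compact Hausdorff space. It is chainable if every open cover is refined by a closed cover $F_1,\dots,F_k$ such that $F_i\cap F_j\ne\emptyset$ iff $|i-j|\le 1$. A closed continuous map $f\colon X\to Y$ is fully closed if for all disjoint closed $F,G\subset X$ the set $f(F)\cap f(G)$ is a discrete subspace of $Y$. **The continua.** Let $(M,d)$ be a metric space and let $g\colon(0,\infty)\to M$ satisfy $g(2r)=g(r)$. Define spaces $M_n$ with underlying sets $M^n$ as follows. $M_0$ is a point. A basic neighbourhood of $(x,w)\in M\times M_n=M_{n+1}$ is given by $\varepsilon>0$ and an open set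 $W\ni w$ of $M_n$; it consists of $\{x\}\times W$ and of all points $(p_0,\dots,p_n)$ with $0<d(p_0,x)<\varepsilon$ and $(g(d(p_0,x)),p_1,\dots,p_{n-1})\in W$. In particular $M_1=M$. Let $\pi_n\colon M_{n+1}\to M_n$ forget the last coordinate. For $r=2^km$ with $k\in\mathbb Z$ and $1\le m<2$ let $z(r)=|2m-3|\in[0,1]$ and $c(r)=m \bmod 1\in S_1=\mathbb R/\mathbb Z$. Chatyrko's continua are realized as $I_n=M_n$ for $M=[0,1]$, $g=z$, and $(S_1)_n=M_n$ for $M=S_1$ with the arc length metric, $g=c$. **Theorem.** (1) For each $n\ge1$ the maps $\pi_n\colon I_{n+1}\to I_n$ and $\pi_n\colon(S_1)_{n+1}\to(S_1)_n$ are fully closed surjections, whose point-inverses are homeomorphic to $[0,1]$ and to $S_1$ respectively. (2) For every $n\ge1$, $I_n$ and $(S_1)_n$ are separable first countable continua, $I_n$ is chainable, $(S_1)_n$ is homogeneous, $$\dim I_n=\dim(S_1)_n=1,\qquad \mathrm{ind}\,I_n=\mathrm{ind}\,(S_1)_n=n,$$ and also $$\mathrm{Ind}\,I_n=\mathrm{Ind}\,(S_1)_n=\mathrm{Ind}_0\,I_n=\mathrm{Ind}_0\,(S_1)_n=n.$$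 (3) More generally, let $M$ be $[0,1]$ or $S_1$, and let $\cdots\to X_3\to X_2\to X_1\cong M$ be any inverse sequence of first countable compact Hausdorff spaces and fully closed surjections all of whose point-inverses are homeomorphic to $M$. Then $\mathrm{Ind}_0X_n\le n$ for every $n\ge1$; and if $\mathrm{ind}\,X_n=n$, then $\mathrm{Ind}\,X_n=\mathrm{Ind}_0X_n=n$. -/

import Mathlib

open Set TopologicalSpace

universe u v

/-! ### Dimension functions

The small inductive dimension `ind` is Mathlib's `smallInductiveDimension`. All dimensions take
values in `WithBot ℕ∞`, where `⊥` plays the role of `-1`. -/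

/-- The closed set `L` is a partition in `X` between `A` and `B`. -/
def IsPartitionBetween {X : Type u} [TopologicalSpace X] (L A B : Set X) : Prop :=
  IsClosed L ∧ ∃ U V : Set X, IsOpen U ∧ IsOpen V ∧ Disjoint U V ∧ Lᶜ = U ∪ V ∧ A ⊆ U ∧ B ⊆ V

/-- `LargeIndLT n X` says that `Ind X < n`, i.e. `Ind X ≤ n - 1`. -/
def LargeIndLT : ℕ → (X : Type u) → [TopologicalSpace X] → Prop
  | 0, X, _ => IsEmpty X
  | n + 1, X, _ => ∀ A V : Set X, IsClosed A → IsOpen V → A ⊆ V →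
      ∃ U : Set X, IsOpen U ∧ A ⊆ U ∧ U ⊆ V ∧ LargeIndLT n (frontier U)

/-- The large inductive dimension `Ind X`. -/
noncomputable def largeInd (X : Type u) [TopologicalSpace X] : WithBot ℕ∞ :=
  sInf {d | ∀ i : ℕ, d < i → LargeIndLT i X}

/-- `IndZeroLT n X` says that `Ind₀ X < n`, i.e. `Ind₀ X ≤ n - 1`. -/
def IndZeroLT : ℕ → (X : Type u) → [TopologicalSpace X] → Prop
  | 0, X, _ => IsEmpty X
  | n + 1, X, _ => ∀ A B : Set X, IsClosed A → IsClosed B → Disjoint A B →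
      ∃ L : Set X, IsPartitionBetween L A B ∧ IsGδ L ∧ IndZeroLT n L

/-- The Charalambous-Filippov-Ivanov inductive dimension `Ind₀ X`. -/
noncomputable def indZero (X : Type u) [TopologicalSpace X] : WithBot ℕ∞ :=
  sInf {d | ∀ i : ℕ, d < i → IndZeroLT i X}

/-- `CoveringDimLT n X` says that `dim X < n`: every finite open cover has a finite open
refinement (again a cover) such that each point lies in at most `n` of its members. -/
def CoveringDimLT (n : ℕ) (X : Type u) [TopologicalSpace X] : Prop :=
  ∀ 𝒰 : Set (Set X), 𝒰.Finite → (∀ U ∈ 𝒰, IsOpen U) → ⋃₀ 𝒰 = univ →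
    ∃ 𝒱 : Set (Set X), 𝒱.Finite ∧ (∀ V ∈ 𝒱, IsOpen V) ∧ ⋃₀ 𝒱 = univ ∧
      (∀ V ∈ 𝒱, ∃ U ∈ 𝒰, V ⊆ U) ∧ ∀ x : X, {V ∈ 𝒱 | x ∈ V}.encard ≤ n

/-- The covering dimension `dim X`. -/
noncomputable def coveringDim (X : Type u) [TopologicalSpace X] : WithBot ℕ∞ :=
  sInf {d | ∀ i : ℕ, d < i → CoveringDimLT i X}

/-! ### Continua and maps -/

/-- A continuum: a non-empty connected compact (Hausdorff) space. -/
structure IsContinuum (X : Type u) [TopologicalSpace X] : Prop where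
  compact : CompactSpace X
  t2 : T2Space X
  connected : ConnectedSpace X

/-- Chainability: every open cover is refined by a closed cover `F₁, …, F_k` such that
`F_i ∩ F_j ≠ ∅` iff `|i - j| ≤ 1`. -/
def IsChainable (X : Type u) [TopologicalSpace X] : Prop :=
  ∀ 𝒰 : Set (Set X), (∀ U ∈ 𝒰, IsOpen U) → ⋃₀ 𝒰 = univ →
    ∃ (k : ℕ) (F : Fin k → Set X), (∀ i, IsClosed (F i)) ∧ ⋃ i, F i = univ ∧
      (∀ i, ∃ U ∈ 𝒰, F i ⊆ U) ∧
      ∀ i j, (F i ∩ F j).Nonempty ↔ |((i : ℕ) : ℤ) - ((j : ℕ) : ℤ)| ≤ 1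

/-- Topological homogeneity. -/
def IsHomogeneousSpace (X : Type u) [TopologicalSpace X] : Prop :=
  ∀ x y : X, ∃ h : X ≃ₜ X, h x = y

/-- Fully closed maps: closed continuous maps `f` such that `f F ∩ f G` is a discrete subspace of
the range space for every pair of disjoint closed sets `F`, `G`. -/
structure IsFullyClosedMap {X : Type u} {Y : Type v} [TopologicalSpace X] [TopologicalSpace Y]
    (f : X → Y) : Prop where
  continuous : Continuous f
  isClosedMap : IsClosedMap f
  discrete : ∀ F G : Set X, IsClosed F → IsClosed G → Disjoint F G →
    DiscreteTopology ↥(f '' F ∩ f '' G)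

/-- An inverse sequence `⋯ → X 3 → X 2 → X 1 ≅ M` of first countable compact Hausdorff spaces and
fully closed surjections, all of whose point-inverses are homeomorphic to `M`.
(`X 0` and `f 0` play no role.) -/
structure IsFullyClosedSequence (M : Type v) [TopologicalSpace M] (X : ℕ → Type u)
    [∀ n, TopologicalSpace (X n)] (f : ∀ n, X (n + 1) → X n) : Prop where
  compact : ∀ n, 1 ≤ n → CompactSpace (X n)
  t2 : ∀ n, 1 ≤ n → T2Space (X n)
  firstCountable : ∀ n, 1 ≤ n → FirstCountableTopology (X n)
  base : Nonempty (X 1 ≃ₜ M)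
  fullyClosed : ∀ n, 1 ≤ n → IsFullyClosedMap (f n)
  surjective : ∀ n, 1 ≤ n → Function.Surjective (f n)
  fiber : ∀ n, 1 ≤ n → ∀ t : X n, Nonempty (↥(f n ⁻¹' {t}) ≃ₜ M)

/-! ### The iterated resolutions

Let `M` be a metric space and `g : (0, ∞) → M` a map with `g (2 r) = g r`. The space
`ResolutionTower g n` has `M ^ n` as the set of points. Its topology is built by recursion: over each
point `x` of the first factor there sits a copy `{x} × M ^ n` of the preceding space, and a point
`p = (p₀, …, pₙ)` with `p₀ ≠ x` is close to a point `(x, w)` when `p₀` is close to `x` in `M` and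
`(g (dist p₀ x), p₁, …, pₙ₋₁)` is close to `w` in the preceding space. -/

section Tower

variable {M : Type u} [MetricSpace M]

/-- The point `(g (dist p₀ x), p₁, …, pₙ₋₁)` associated with `p = (p₀, …, pₙ)` and `x`. -/
def resolutionPush (g : ℝ → M) {n : ℕ} (x : M) (p : Fin (n + 1) → M) : Fin n → M :=
  fun i => if (i : ℕ) = 0 then g (dist (p 0) x) else p i.castSucc

/-- `O` contains the basic neighbourhood of `q = (x, w)` given by the radius `ε` and the
neighbourhood `W` of `w`; it consists of `{x} × W` and of all points `p` such that
`0 < dist p₀ x < ε` and `(g (dist p₀ x), p₁, …, pₙ₋₁) ∈ W`. -/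
def ContainsBasicNhd (g : ℝ → M) {n : ℕ} (O : Set (Fin (n + 1) → M)) (q : Fin (n + 1) → M)
    (ε : ℝ) (W : Set (Fin n → M)) : Prop :=
  ∀ p : Fin (n + 1) → M,
    (p 0 = q 0 ∧ Fin.tail p ∈ W) ∨
      (0 < dist (p 0) (q 0) ∧ dist (p 0) (q 0) < ε ∧ resolutionPush g (q 0) p ∈ W) → p ∈ O

/-- The topology on `M ^ n` described above: a set is open if it contains a basic neighbourhood of
each of its points. -/
@[reducible]
def resolutionTopology (g : ℝ → M) : (n : ℕ) → TopologicalSpace (Fin n → M)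
  | 0 => ⊤
  | n + 1 =>
    { IsOpen := fun O => ∀ q ∈ O, ∃ ε : ℝ, 0 < ε ∧ ∃ W : Set (Fin n → M),
        (resolutionTopology g n).IsOpen W ∧ Fin.tail q ∈ W ∧ ContainsBasicNhd g O q ε W
      isOpen_univ := fun q _ => ⟨1, one_pos, univ,
        @isOpen_univ _ (resolutionTopology g n), mem_univ _, fun _ _ => mem_univ _⟩
      isOpen_inter := by
        rintro O₁ O₂ h₁ h₂ q ⟨hq₁, hq₂⟩
        obtain ⟨ε₁, hε₁, W₁, hW₁, hqW₁, H₁⟩ := h₁ q hq₁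
        obtain ⟨ε₂, hε₂, W₂, hW₂, hqW₂, H₂⟩ := h₂ q hq₂
        refine ⟨min ε₁ ε₂, lt_min hε₁ hε₂, W₁ ∩ W₂,
          @IsOpen.inter _ (resolutionTopology g n) _ _ hW₁ hW₂, ⟨hqW₁, hqW₂⟩, ?_⟩
        rintro p (⟨h0, hp⟩ | ⟨h0, hd, hp⟩)
        · exact ⟨H₁ p (Or.inl ⟨h0, hp.1⟩), H₂ p (Or.inl ⟨h0, hp.2⟩)⟩
        · exact ⟨H₁ p (Or.inr ⟨h0, lt_of_lt_of_le hd (min_le_left _ _), hp.1⟩),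
            H₂ p (Or.inr ⟨h0, lt_of_lt_of_le hd (min_le_right _ _), hp.2⟩)⟩
      isOpen_sUnion := by
        rintro 𝒪 h q ⟨O, hO, hq⟩
        obtain ⟨ε, hε, W, hW, hqW, H⟩ := h O hO q hq
        exact ⟨ε, hε, W, hW, hqW, fun p hp => ⟨O, hO, H p hp⟩⟩ }

/-- The `n`-th iterated resolution: the set `M ^ n` with `resolutionTopology g n`. -/
def ResolutionTower (_g : ℝ → M) (n : ℕ) : Type u := Fin n → M

instance (g : ℝ → M) (n : ℕ) : TopologicalSpace (ResolutionTower g n) := resolutionTopology g n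

/-- The bonding map `(x₁, …, xₙ₊₁) ↦ (x₁, …, xₙ)`. -/
def ResolutionTower.bonding (g : ℝ → M) (n : ℕ) (p : ResolutionTower g (n + 1)) :
    ResolutionTower g n :=
  fun i => p i.castSucc

end Tower

/-- The dyadic mantissa of `r > 0`: the number `m ∈ [1, 2)` with `r = 2 ^ k * m`, `k ∈ ℤ`. -/
noncomputable def dyadicMantissa (r : ℝ) : ℝ := r / (2 : ℝ) ^ Int.log 2 r

/-- The oscillating map `(0, ∞) → [0, 1]` that sends `r = 2 ^ k * m`, `1 ≤ m < 2`, to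
`|2 m - 3|`. (The projection onto `[0, 1]` is immaterial, as `|2 m - 3| ≤ 1`.) -/
noncomputable def zigzag (r : ℝ) : unitInterval :=
  Set.projIcc (0 : ℝ) 1 zero_le_one |2 * dyadicMantissa r - 3|

/-- The winding map `(0, ∞) → ℝ / ℤ` that sends `r = 2 ^ k * m`, `1 ≤ m < 2`, to `m` modulo `1`. -/
noncomputable def winding (r : ℝ) : UnitAddCircle := (dyadicMantissa r : UnitAddCircle)

/-- The chainable continua `I_n`. -/
abbrev ChatyrkoInterval (n : ℕ) : Type := ResolutionTower zigzag n

/-- The homogeneous continua `(S_1)_n`; `S_1` is the circle `ℝ / ℤ` with its arc length metric. -/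
abbrev ChatyrkoCircle (n : ℕ) : Type := ResolutionTower winding n

/-!
The dimensions `Ind` and `Ind₀` of a compact Hausdorff space dominate `ind`. So the proof consists
of an upper bound for `Ind₀` along every fully closed sequence, a lower bound for `ind` of the
towers, and the topological properties of the towers.

*The upper bound for `Ind₀`.* `SepLT n S` expresses `Ind₀ S < n` for `σ`-compact locally closed
sets `S` in a compact Hausdorff space. In this setting `Ind₀` obeys an addition theorem
(`SepLT.of_inter_of_diff`) and is determined by the compact subsets (`SepLT.of_forall_isCompact`),
which gives a subset theorem (`SepLT.diff_isClosed`). Now let `f : X → Y` be fully closed, and let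
`A` and `B` be disjoint closed sets in `X`. Then `T = f(A) ∩ f(B)` is finite. Over the points of
`T`, the sets `A` and `B` are separated in the fibres, which are arcs or circles, by a finite set
`E`; over `Y \ T` one takes the preimage of a partition in `Y \ T` between suitable enlargements of
`f(A)` and `f(B)`. The union is a partition whose image is contained in a partition of `Y` up to
finitely many points, so that induction applies (`SepLT.of_fullyClosed`).

*The towers.* `IsResolving g` lists what is needed of `z` and `c`. A neighbourhood of `(x, w)` in
`M_{n+1}` is the preimage of a neighbourhood of `w` under a retraction `retr x` of `M_{n+1}` onto
the fibre `{x} × M_n`, intersected with the preimage of a neighbourhood of `x`. The continuity of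
`retr x` (`continuous_retr`) expresses the self-similarity of the construction. Tubes around the
fibres (`exists_tube`) give compactness and, by induction, full closedness of the bonding maps
(`finite_inter_image_bonding`); every non-empty open set contains the preimage of an open subset of
`M` (`exists_preimage_head_subset`), which gives separability.

*The lower bound for `ind`.* By a Baire category argument, two disjoint non-empty open sets in
`M_{n+1}` omit a whole fibre `{x} × M_n` (`exists_fiber_disjoint`). So the boundary of every open
set that is neither empty nor dense contains a copy of `M_n`, and `ind M_{n+1} > ind M_n`.

*Covering dimension.* The composition of `n` retractions maps `M_{n+1}` to `M`, is a homeomorphism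
on a given fibre of the bonding map, and is constant on each of the others. This suffices for `dim
M_{n+1} ≤ max (dim M_n) (dim M)` (`CoveringDimLT.of_fibers`).

*Chainability of `I_n`.* Given an open cover of `I_{n+1}`, a chain of the fibre over `x` is pulled
back by `retr x` to a chain over a small interval around `x`, whose end points can be chosen such
that the fibres over them meet only the end links (`exists_hasChain_around`). Chains over adjacent
intervals can be joined. If the fibre over a point is contained in a member of the cover, then a
single link suffices near this point, and this is the case for all but countably many points
(`countable_nonfree`). As a non-empty countable compact set of reals has an isolated point, the
chains combine to a chain of the whole space (`hasChain_of_countable`).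

*Homogeneity of `(S_1)_n`.* A portrait assigns a permutation of the circle to every finite sequence
of coordinates. Coherent portraits act on the towers by homeomorphisms (`continuous_act`). The
winding map converts the distance to `0`, on a logarithmic scale, into an angle. Therefore every
rotation, and every homeomorphism of the circle of the type `IsRadial`, over the fibre of `0` is
induced by an increasing change of the distance to `0` (`exists_isRadial_rotation`,
`IsRadial.exists_lift`). So each coordinate in turn can be moved to `0`.
-/

/-! ### Inductive dimension of subsets -/

open Topology Filter

theorem IsSigmaCompact.union {X : Type u} [TopologicalSpace X] {s t : Set X}
    (hs : IsSigmaCompact s) (ht : IsSigmaCompact t) : IsSigmaCompact (s ∪ t) := by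
  rw [union_eq_iUnion]
  exact isSigmaCompact_iUnion _ fun b => by cases b <;> assumption

theorem IsSigmaCompact.inter_isClosed {X : Type u} [TopologicalSpace X] {s t : Set X}
    (hs : IsSigmaCompact s) (ht : IsClosed t) : IsSigmaCompact (s ∩ t) := by
  obtain ⟨K, hK, rfl⟩ := hs
  rw [iUnion_inter]
  exact isSigmaCompact_iUnion_of_isCompact _ fun i => (hK i).inter_right ht

theorem IsSigmaCompact.inter {X : Type u} [TopologicalSpace X] [T2Space X] {s t : Set X}
    (hs : IsSigmaCompact s) (ht : IsSigmaCompact t) : IsSigmaCompact (s ∩ t) := by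
  obtain ⟨K, hK, rfl⟩ := ht
  rw [inter_iUnion]
  exact isSigmaCompact_iUnion _ fun i => hs.inter_isClosed (hK i).isClosed

theorem IsSigmaCompact.biInter_finset {X : Type u} [TopologicalSpace X] [T2Space X] {ι : Type*}
    {s : Set X} (hs : IsSigmaCompact s) (J : Finset ι) (t : ι → Set X)
    (ht : ∀ j ∈ J, IsSigmaCompact (s ∩ t j)) : IsSigmaCompact (s ∩ ⋂ j ∈ J, t j) := by
  classical
  induction J using Finset.induction_on with
  | empty => simpa using hs
  | insert a J _ ih =>
    have h1 := (ht a (by simp)).inter (ih fun j hj => ht j (by simp [hj]))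
    convert h1 using 1
    ext x; simp only [Finset.mem_insert, mem_inter_iff, mem_iInter, iInter_iInter_eq_or_left]
    tauto

theorem IsSigmaCompact.preimage {X : Type u} {Y : Type v} [TopologicalSpace X] [TopologicalSpace Y]
    [CompactSpace X] [T2Space Y] {f : X → Y} (hf : Continuous f) {s : Set Y}
    (hs : IsSigmaCompact s) : IsSigmaCompact (f ⁻¹' s) := by
  obtain ⟨K, hK, rfl⟩ := hs
  rw [preimage_iUnion]
  exact isSigmaCompact_iUnion_of_isCompact _ fun i => ((hK i).isClosed.preimage hf).isCompact

/-- A set is *tame* if it is `σ`-compact and locally closed. In a compact Hausdorff space such sets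
are normal subspaces, and a relatively closed subset is a relative `Gδ`-set if and only if its
relative complement is `σ`-compact. -/
def IsTame {X : Type u} [TopologicalSpace X] (S : Set X) : Prop :=
  IsSigmaCompact S ∧ IsLocallyClosed S

theorem IsTame.inter_isClosed {X : Type u} [TopologicalSpace X] {S C : Set X} (hS : IsTame S)
    (hC : IsClosed C) : IsTame (S ∩ C) :=
  ⟨hS.1.inter_isClosed hC, hS.2.inter hC.isLocallyClosed⟩

theorem IsTame.diff_isOpen {X : Type u} [TopologicalSpace X] {S O : Set X} (hS : IsTame S)
    (hO : IsOpen O) : IsTame (S \ O) :=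
  hS.inter_isClosed hO.isClosed_compl

theorem IsClosed.isTame {X : Type u} [TopologicalSpace X] [CompactSpace X] {C : Set X}
    (hC : IsClosed C) : IsTame C :=
  ⟨hC.isCompact.isSigmaCompact, hC.isLocallyClosed⟩

/-- Normality of `σ`-compact subspaces, in terms of the ambient space. -/
theorem IsSigmaCompact.exists_separation {X : Type u} [TopologicalSpace X] [T2Space X]
    [CompactSpace X] {S A B : Set X} (hS : IsSigmaCompact S) (hA : IsClosed A) (hB : IsClosed B)
    (hAB : A ∩ B ∩ S = ∅) :
    ∃ U V : Set X, IsOpen U ∧ IsOpen V ∧ A ∩ S ⊆ U ∧ B ∩ S ⊆ V ∧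
      closure (U ∩ S) ∩ closure (V ∩ S) ∩ S = ∅ := by
  have : SigmaCompactSpace S := isSigmaCompact_iff_sigmaCompactSpace.1 hS
  have hn : NormalSpace S := inferInstance
  have hcl : ∀ W : Set X, closure (W ∩ S) ∩ S =
      Subtype.val '' closure ((Subtype.val : S → X) ⁻¹' W) := by
    intro W
    rw [IsEmbedding.subtypeVal.closure_eq_preimage_closure_image, Subtype.image_preimage_coe,
      Subtype.image_preimage_coe, inter_comm S W, inter_comm]
  obtain ⟨u, hu, hAu, hd⟩ := normal_exists_closure_subset
    (s := (Subtype.val : S → X) ⁻¹' A) (t := (Subtype.val ⁻¹' B)ᶜ)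
    (hA.preimage continuous_subtype_val) (hB.preimage continuous_subtype_val).isOpen_compl
    (fun x hx hx' => by
      have : (x : X) ∈ A ∩ B ∩ S := ⟨⟨hx, hx'⟩, x.2⟩
      simp [hAB] at this)
  obtain ⟨v, hv, hBv, hd'⟩ := normal_exists_closure_subset
    (s := (Subtype.val : S → X) ⁻¹' B) (t := (closure u)ᶜ)
    (hB.preimage continuous_subtype_val) isClosed_closure.isOpen_compl
    (fun x hx hx' => hd hx' hx)
  obtain ⟨U, hU, rfl⟩ := isOpen_induced_iff.1 hu
  obtain ⟨V, hV, rfl⟩ := isOpen_induced_iff.1 hv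
  refine ⟨U, V, hU, hV, fun x hx => hAu (a := ⟨x, hx.2⟩) hx.1,
    fun x hx => hBv (a := ⟨x, hx.2⟩) hx.1, ?_⟩
  rw [inter_inter_distrib_right, hcl, hcl, ← image_inter Subtype.val_injective, image_eq_empty]
  ext x
  simp only [mem_inter_iff, mem_empty_iff_false, iff_false, not_and]
  exact fun h h' => hd' h' h

/-- `SepLT n S` is the set-level form of `Ind₀ S < n` for a tame subset `S` of a compact Hausdorff
space: closed sets that are disjoint on `S` are separated on `S` by a partition
`S \ (U ∪ V)` whose relative complement is `σ`-compact, so that the partition is a relative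
`Gδ`-set. -/
def SepLT {X : Type u} [TopologicalSpace X] : ℕ → Set X → Prop
  | 0, S => S = ∅
  | n + 1, S => ∀ A B : Set X, IsClosed A → IsClosed B → A ∩ B ∩ S = ∅ →
      ∃ U V : Set X, IsOpen U ∧ IsOpen V ∧ U ∩ V ∩ S = ∅ ∧ A ∩ S ⊆ U ∧ B ∩ S ⊆ V ∧
        IsSigmaCompact (S ∩ (U ∪ V)) ∧ SepLT n (S \ (U ∪ V))

section SepLT

variable {X : Type u} [TopologicalSpace X]

theorem SepLT.inter_isClosed {n : ℕ} {S C : Set X} (h : SepLT n S) (hC : IsClosed C) :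
    SepLT n (S ∩ C) := by
  induction n generalizing S with
  | zero => rw [SepLT] at *; simp [h]
  | succ n ih =>
    intro A B hA hB hAB
    obtain ⟨U, V, hU, hV, hUV, hAU, hBV, hs, hL⟩ := h (A ∩ C) B (hA.inter hC) hB (by
      rw [← hAB]; ext x; simp only [mem_inter_iff]; tauto)
    refine ⟨U, V, hU, hV, ?_, fun x hx => hAU ⟨⟨hx.1, hx.2.2⟩, hx.2.1⟩,
      fun x hx => hBV ⟨hx.1, hx.2.1⟩, ?_, ?_⟩
    · rw [← inter_assoc, hUV, empty_inter]
    · rw [inter_right_comm]; exact hs.inter_isClosed hC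
    · have := ih hL
      rwa [sdiff_inter_right_comm] at this

theorem SepLT.subset_isClosed {n : ℕ} {S C : Set X} (h : SepLT n S) (hC : IsClosed C)
    (hCS : C ⊆ S) : SepLT n C := by
  have := h.inter_isClosed hC
  rwa [inter_eq_self_of_subset_right hCS] at this

theorem SepLT.succ {n : ℕ} {S : Set X} (h : SepLT n S) : SepLT (n + 1) S := by
  induction n generalizing S with
  | zero =>
    rw [SepLT] at h
    subst h
    exact fun A B _ _ _ => ⟨∅, ∅, isOpen_empty, isOpen_empty, by simp, by simp, by simp,
      by simp, by simp [SepLT]⟩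
  | succ n ih =>
    intro A B hA hB hAB
    obtain ⟨U, V, hU, hV, hUV, hAU, hBV, hs, hL⟩ := h A B hA hB hAB
    exact ⟨U, V, hU, hV, hUV, hAU, hBV, hs, ih hL⟩

theorem SepLT.mono {m n : ℕ} (hmn : m ≤ n) {S : Set X} (h : SepLT m S) : SepLT n S := by
  induction n, hmn using Nat.le_induction with
  | base => exact h
  | succ n _ ih => exact ih.succ

theorem SepLT.empty (n : ℕ) : SepLT n (∅ : Set X) :=
  SepLT.mono (Nat.zero_le n) rfl

theorem SepLT.of_finite [T1Space X] {E : Set X} (hE : E.Finite) {n : ℕ} (hn : 1 ≤ n) :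
    SepLT n E := by
  refine SepLT.mono hn fun A B hA hB hAB => ⟨(E \ A)ᶜ, Aᶜ, hE.sdiff.isClosed.isOpen_compl,
    hA.isOpen_compl, ?_, ?_, ?_, ?_, ?_⟩
  · ext x; simp; tauto
  · intro x hx; simp [hx.1]
  · intro x hx hxA
    have : x ∈ A ∩ B ∩ E := ⟨⟨hxA, hx.1⟩, hx.2⟩
    simp [hAB] at this
  · exact (hE.subset inter_subset_left).isCompact.isSigmaCompact
  · rw [SepLT]; ext x; simp

end SepLT

/-- An addition theorem of Dowker's type: if `Z = S ∩ C` is relatively closed and `S \ Z` is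
`σ`-compact, then bounds for `Ind₀ Z` and `Ind₀ (S \ Z)` give the same bound for `Ind₀ S`. A
partition in `Z` is extended, off `Z`, by a partition in `S \ Z`, and the union of
both is a partition in `S`, to which the induction hypothesis applies. -/
theorem SepLT.of_inter_of_diff {X : Type u} [TopologicalSpace X] [T2Space X] [CompactSpace X]
    {n : ℕ} {S C : Set X} (hS : IsTame S) (hC : IsClosed C) (hSC : IsSigmaCompact (S \ C))
    (h1 : SepLT n (S ∩ C)) (h2 : SepLT n (S \ C)) : SepLT n S := by
  induction n generalizing S with
  | zero =>
    rw [SepLT] at *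
    rw [← inter_union_sdiff S C, h1, h2, union_empty]
  | succ n ih =>
    intro A B hA hB hAB
    obtain ⟨U₁, V₁, hU₁, hV₁, hUV₁, hAU₁, hBV₁, hs₁, hL₁⟩ := h1 A B hA hB (by
      rw [← inter_assoc, hAB, empty_inter])
    set P₁ := (S ∩ C) \ (U₁ ∪ V₁) with hP₁
    have hP₁cl : closure P₁ ∩ S = P₁ := by
      apply Subset.antisymm
      · rintro x ⟨hx, hxS⟩
        have : closure P₁ ⊆ C ∩ (U₁ ∪ V₁)ᶜ :=
          closure_minimal (fun y hy => ⟨hy.1.2, hy.2⟩) (hC.inter (hU₁.union hV₁).isClosed_compl)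
        exact ⟨⟨hxS, (this hx).1⟩, (this hx).2⟩
      · exact fun x hx => ⟨subset_closure hx, hx.1.1⟩
    -- On `T`, the two sides of the partition `P₁` of `S ∩ C` are closed and disjoint. They have
    -- disjoint neighbourhoods `U'`, `V'`, whose closures are then separated in `S \ C`.
    set T := S \ P₁ with hT
    have hTs : IsSigmaCompact T := by
      have : T = (S \ C) ∪ ((S ∩ C) ∩ (U₁ ∪ V₁)) := by
        ext x; simp only [hT, hP₁, Set.mem_sdiff, mem_inter_iff, mem_union]; tauto
      rw [this]; exact hSC.union hs₁
    have key : ∀ U V : Set X, IsOpen U → IsOpen V → U ∩ V ∩ (S ∩ C) = ∅ →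
        closure (U ∩ (S ∩ C)) ∩ V ∩ (S ∩ C) = ∅ := by
      intro U V _ hV hUV
      rw [eq_empty_iff_forall_notMem]
      rintro x ⟨⟨hx, hxV⟩, -⟩
      obtain ⟨y, hyV, hy⟩ := mem_closure_iff.1 hx V hV hxV
      have : y ∈ U ∩ V ∩ (S ∩ C) := ⟨⟨hy.1, hyV⟩, hy.2⟩
      simp [hUV] at this
    have kU : closure (U₁ ∩ (S ∩ C)) ∩ T ⊆ U₁ ∩ (S ∩ C) := by
      rintro x ⟨hx, hxT⟩
      have hxC : x ∈ C := closure_minimal (fun y hy => hy.2.2) hC hx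
      have hxU : x ∈ U₁ ∪ V₁ := by
        by_contra h; exact hxT.2 ⟨⟨hxT.1, hxC⟩, h⟩
      refine ⟨hxU.resolve_right fun hV => ?_, hxT.1, hxC⟩
      have : x ∈ closure (U₁ ∩ (S ∩ C)) ∩ V₁ ∩ (S ∩ C) := ⟨⟨hx, hV⟩, hxT.1, hxC⟩
      simp [key U₁ V₁ hU₁ hV₁ hUV₁] at this
    have kV : closure (V₁ ∩ (S ∩ C)) ∩ T ⊆ V₁ ∩ (S ∩ C) := by
      rintro x ⟨hx, hxT⟩
      have hxC : x ∈ C := closure_minimal (fun y hy => hy.2.2) hC hx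
      have hxU : x ∈ U₁ ∪ V₁ := by
        by_contra h; exact hxT.2 ⟨⟨hxT.1, hxC⟩, h⟩
      refine ⟨hxU.resolve_left fun hV => ?_, hxT.1, hxC⟩
      have : x ∈ closure (V₁ ∩ (S ∩ C)) ∩ U₁ ∩ (S ∩ C) := ⟨⟨hx, hV⟩, hxT.1, hxC⟩
      simp [key V₁ U₁ hV₁ hU₁ (by rw [inter_comm V₁]; exact hUV₁)] at this
    have hUV₁' : ∀ x, x ∈ S → x ∈ C → x ∈ U₁ → x ∈ V₁ → False := fun x h1 h2 h3 h4 => by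
      have : x ∈ U₁ ∩ V₁ ∩ (S ∩ C) := ⟨⟨h3, h4⟩, h1, h2⟩
      simp [hUV₁] at this
    obtain ⟨U', V', hU', hV', hAU', hBV', hd'⟩ := hTs.exists_separation
      (A := A ∪ closure (U₁ ∩ (S ∩ C))) (B := B ∪ closure (V₁ ∩ (S ∩ C)))
      (hA.union isClosed_closure) (hB.union isClosed_closure) (by
        rw [eq_empty_iff_forall_notMem]
        rintro x ⟨⟨hx | hx, hx' | hx'⟩, hxT⟩
        · have : x ∈ A ∩ B ∩ S := ⟨⟨hx, hx'⟩, hxT.1⟩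
          simp [hAB] at this
        · have h3 := kV ⟨hx', hxT⟩
          exact hUV₁' x h3.2.1 h3.2.2 (hAU₁ ⟨hx, h3.2⟩) h3.1
        · have h3 := kU ⟨hx, hxT⟩
          exact hUV₁' x h3.2.1 h3.2.2 h3.1 (hBV₁ ⟨hx', h3.2⟩)
        · have h3 := kU ⟨hx, hxT⟩
          exact hUV₁' x h3.2.1 h3.2.2 h3.1 (kV ⟨hx', hxT⟩).1)
    have hDT : S \ C ⊆ T := fun x hx => ⟨hx.1, fun h => hx.2 h.1.2⟩
    obtain ⟨U₂, V₂, hU₂, hV₂, hUV₂, hAU₂, hBV₂, hs₂, hL₂⟩ := h2 (closure (U' ∩ T))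
      (closure (V' ∩ T)) isClosed_closure isClosed_closure (by
        rw [← subset_empty_iff, ← hd']
        exact inter_subset_inter_right _ hDT)
    have hUV₂' : ∀ x, x ∈ S → x ∉ C → x ∈ U₂ → x ∈ V₂ → False := fun x h1 h2 h3 h4 => by
      have : x ∈ U₂ ∩ V₂ ∩ (S \ C) := ⟨⟨h3, h4⟩, h1, h2⟩
      simp [hUV₂] at this
    have hUT : ∀ x ∈ S, x ∉ closure P₁ → x ∈ T := fun x hx h => ⟨hx, fun h' => h (subset_closure h')⟩
    have hTU : ∀ x ∈ T, x ∉ closure P₁ := fun x hx h => hx.2 (hP₁cl ▸ ⟨h, hx.1⟩)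
    have hcov : S ∩ ((U' ∩ (closure P₁)ᶜ ∪ U₂ ∩ Cᶜ) ∪ (V' ∩ (closure P₁)ᶜ ∪ V₂ ∩ Cᶜ)) =
        ((S ∩ C) ∩ (U₁ ∪ V₁)) ∪ ((S \ C) ∩ (U₂ ∪ V₂)) := by
      ext x
      constructor
      · rintro ⟨hxS, hx⟩
        by_cases hxC : x ∈ C
        · left
          refine ⟨⟨hxS, hxC⟩, ?_⟩
          by_contra h
          have hxP : x ∈ closure P₁ := subset_closure ⟨⟨hxS, hxC⟩, h⟩
          rcases hx with (hx | hx) | (hx | hx)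
          exacts [hx.2 hxP, hx.2 hxC, hx.2 hxP, hx.2 hxC]
        · right
          refine ⟨⟨hxS, hxC⟩, ?_⟩
          rcases hx with (hx | hx) | (hx | hx)
          · exact Or.inl (hAU₂ ⟨subset_closure ⟨hx.1, hUT x hxS hx.2⟩, hxS, hxC⟩)
          · exact Or.inl hx.1
          · exact Or.inr (hBV₂ ⟨subset_closure ⟨hx.1, hUT x hxS hx.2⟩, hxS, hxC⟩)
          · exact Or.inr hx.1
      · rintro (⟨⟨hxS, hxC⟩, hx⟩ | ⟨⟨hxS, hxC⟩, hx⟩)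
        · refine ⟨hxS, ?_⟩
          have hxT : x ∈ T := ⟨hxS, fun h => h.2 hx⟩
          rcases hx with hx | hx
          · exact Or.inl (Or.inl ⟨hAU' ⟨Or.inr (subset_closure ⟨hx, hxS, hxC⟩), hxT⟩, hTU x hxT⟩)
          · exact Or.inr (Or.inl ⟨hBV' ⟨Or.inr (subset_closure ⟨hx, hxS, hxC⟩), hxT⟩, hTU x hxT⟩)
        · refine ⟨hxS, ?_⟩
          rcases hx with hx | hx
          · exact Or.inl (Or.inr ⟨hx, hxC⟩)
          · exact Or.inr (Or.inr ⟨hx, hxC⟩)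
    have hopen : ∀ {U W : Set X}, IsOpen U → IsOpen W →
        IsOpen (U ∩ (closure P₁)ᶜ ∪ W ∩ Cᶜ) := fun hU hW =>
      (hU.inter isClosed_closure.isOpen_compl).union (hW.inter hC.isOpen_compl)
    have hAT : ∀ x, x ∈ A → x ∈ S → x ∈ T := fun x hx hxS =>
      ⟨hxS, fun h => h.2 (Or.inl (hAU₁ ⟨hx, h.1⟩))⟩
    have hBT : ∀ x, x ∈ B → x ∈ S → x ∈ T := fun x hx hxS =>
      ⟨hxS, fun h => h.2 (Or.inr (hBV₁ ⟨hx, h.1⟩))⟩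
    refine ⟨_, _, hopen hU' hU₂, hopen hV' hV₂, ?_, ?_, ?_, ?_, ?_⟩
    · rw [eq_empty_iff_forall_notMem]
      rintro x ⟨⟨hx | hx, hx' | hx'⟩, hxS⟩
      · have hxT := hUT x hxS hx.2
        have : x ∈ closure (U' ∩ T) ∩ closure (V' ∩ T) ∩ T :=
          ⟨⟨subset_closure ⟨hx.1, hxT⟩, subset_closure ⟨hx'.1, hxT⟩⟩, hxT⟩
        simp [hd'] at this
      · exact hUV₂' x hxS hx'.2 (hAU₂ ⟨subset_closure ⟨hx.1, hUT x hxS hx.2⟩, hxS, hx'.2⟩) hx'.1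
      · exact hUV₂' x hxS hx.2 hx.1 (hBV₂ ⟨subset_closure ⟨hx'.1, hUT x hxS hx'.2⟩, hxS, hx.2⟩)
      · exact hUV₂' x hxS hx.2 hx.1 hx'.1
    · rintro x ⟨hx, hxS⟩
      have hxT := hAT x hx hxS
      exact Or.inl ⟨hAU' ⟨Or.inl hx, hxT⟩, hTU x hxT⟩
    · rintro x ⟨hx, hxS⟩
      have hxT := hBT x hx hxS
      exact Or.inl ⟨hBV' ⟨Or.inl hx, hxT⟩, hTU x hxT⟩
    · rw [hcov]; exact hs₁.union hs₂
    · rw [← sdiff_self_inter, hcov]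
      set W := ((S ∩ C) ∩ (U₁ ∪ V₁)) ∪ ((S \ C) ∩ (U₂ ∪ V₂)) with hW
      have e1 : (S \ W) ∩ C = P₁ := by
        ext x; simp only [hW, hP₁, Set.mem_sdiff, mem_inter_iff, mem_union]; tauto
      have e2 : (S \ W) \ C = (S \ C) \ (U₂ ∪ V₂) := by
        ext x; simp only [hW, Set.mem_sdiff, mem_inter_iff, mem_union]; tauto
      have htame : IsTame (S \ W) := by
        rw [← hcov, sdiff_self_inter]
        exact hS.diff_isOpen ((hopen hU' hU₂).union (hopen hV' hV₂))
      refine ih htame ?_ ?_ ?_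
      · rw [e2]; exact hSC.inter_isClosed (hU₂.union hV₂).isClosed_compl
      · rw [e1]; exact hL₁
      · rw [e2]; exact hL₂

/-! ### Compact exhaustions -/

/-- A compact exhaustion of a tame set `S` by sets `K i`, together with open sets `W i` of the
ambient space that cut out neighbourhoods in `S`: on `S`, `W i ⊆ K i ⊆ W (i + 1)`. -/
theorem IsTame.exists_exhaustion {X : Type u} [TopologicalSpace X] [T2Space X] [CompactSpace X]
    {S : Set X} (hS : IsTame S) :
    ∃ K W : ℕ → Set X, K 0 = ∅ ∧ W 0 = ∅ ∧ (∀ i, IsCompact (K i)) ∧ (∀ i, IsOpen (W i)) ∧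
      (∀ i, K i ⊆ S) ∧ (∀ i, W i ∩ S ⊆ K i) ∧ (∀ i, K i ⊆ W (i + 1)) ∧ S ⊆ ⋃ i, K i := by
  have : SigmaCompactSpace S := isSigmaCompact_iff_sigmaCompactSpace.1 hS.1
  have : LocallyCompactSpace S := hS.2.locallyCompactSpace
  let E : CompactExhaustion S := default
  have hW : ∀ i, ∃ O : Set X, IsOpen O ∧ Subtype.val ⁻¹' O = interior (E i) := fun i =>
    isOpen_induced_iff.1 isOpen_interior
  choose O hO hOE using hW
  refine ⟨fun i => Nat.casesOn i ∅ fun i => Subtype.val '' E i,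
    fun i => Nat.casesOn i ∅ O, rfl, rfl, ?_, ?_, ?_, ?_, ?_, ?_⟩
  · rintro (_ | i)
    · exact isCompact_empty
    · exact (E.isCompact i).image continuous_subtype_val
  · rintro (_ | i)
    · exact isOpen_empty
    · exact hO i
  · rintro (_ | i)
    · exact empty_subset _
    · rintro _ ⟨x, -, rfl⟩; exact x.2
  · rintro (_ | i)
    · rintro x ⟨hx, -⟩; exact hx.elim
    · rintro x ⟨hx, hxS⟩
      have : (⟨x, hxS⟩ : S) ∈ interior (E i) := hOE i ▸ hx
      exact ⟨_, interior_subset this, rfl⟩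
  · rintro (_ | i)
    · exact empty_subset _
    · rintro _ ⟨x, hx, rfl⟩
      have : x ∈ interior (E (i + 1)) := E.subset_interior_succ i hx
      rw [← hOE] at this
      exact this
  · intro x hx
    obtain ⟨i, hi⟩ := E.exists_mem ⟨x, hx⟩
    exact mem_iUnion.2 ⟨i + 1, ⟨_, hi, rfl⟩⟩

/-- Finite sums of closed sets that are `Gδ` in one another. -/
theorem SepLT.biUnion_lt {X : Type u} [TopologicalSpace X] [T2Space X] [CompactSpace X] {n : ℕ}
    (hn : ∀ S : Set X, IsTame S → (∀ K ⊆ S, IsCompact K → SepLT n K) → SepLT n S)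
    {p : ℕ → Set X} (hp : ∀ i, IsCompact (p i)) (hpn : ∀ i, SepLT n (p i))
    (hpp : ∀ i j, IsSigmaCompact (p i \ p j)) (m : ℕ) : SepLT n (⋃ j < m, p j) := by
  induction m with
  | zero => simpa using SepLT.empty n
  | succ m ih =>
    have hc : ∀ m, IsCompact (⋃ j < m, p j) := fun m =>
      (finite_lt_nat m).isCompact_biUnion fun i _ => hp i
    have e : (⋃ j < m + 1, p j) = (⋃ j < m, p j) ∪ p m := biUnion_lt_succ p m
    have e1 : (⋃ j < m + 1, p j) ∩ p m = p m := by
      rw [e]; exact inter_eq_self_of_subset_right subset_union_right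
    have e2 : (⋃ j < m + 1, p j) \ p m = (⋃ j < m, p j) \ p m := by
      rw [e, union_sdiff_right]
    have hs : IsSigmaCompact ((⋃ j < m, p j) \ p m) := by
      simp_rw [iUnion_sdiff]
      exact isSigmaCompact_biUnion (finite_lt_nat m).countable fun i _ => hpp i m
    refine SepLT.of_inter_of_diff (C := p m) (hc _).isClosed.isTame (hp m).isClosed ?_ ?_ ?_
    · rw [e2]; exact hs
    · rw [e1]; exact hpn m
    · rw [e2]
      refine hn _ ⟨hs, (hc m).isClosed.isLocallyClosed.inter
        (hp m).isClosed.isOpen_compl.isLocallyClosed⟩ fun K hK hKc =>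
        ih.subset_isClosed hKc.isClosed (hK.trans sdiff_subset)

/-- For tame sets, `Ind₀` is determined by the compact subsets. A partition of `S` is glued from a
locally finite family of partitions in the members of a compact exhaustion: the `i`-th of them
surrounds the part of `A` between the `i`-th and the `(i + 1)`-st member. -/
theorem SepLT.of_forall_isCompact {X : Type u} [TopologicalSpace X] [T2Space X] [CompactSpace X]
    {n : ℕ} {S : Set X} (hS : IsTame S) (h : ∀ K ⊆ S, IsCompact K → SepLT n K) : SepLT n S := by
  induction n generalizing S with
  | zero =>
    rw [SepLT, eq_empty_iff_forall_notMem]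
    intro x hx
    have := h {x} (by simpa using hx) isCompact_singleton
    simp [SepLT] at this
  | succ n ih =>
    intro A B hA hB hAB
    obtain ⟨K, W, hK0, hW0, hK, hW, hKS, hWK, hKW, hSK⟩ := hS.exists_exhaustion
    have hKm : Monotone K := monotone_nat_of_le_succ fun i x hx => hWK _ ⟨hKW i hx, hKS i hx⟩
    have hsep : ∀ i, ∃ U V : Set X, IsOpen U ∧ IsOpen V ∧ U ∩ V ∩ K (i + 2) = ∅ ∧
        (A ∩ (K (i + 1) \ W i)) ⊆ U ∧
        (B ∪ K (i + 2) \ W (i + 2) ∪ K (i - 1)) ∩ K (i + 2) ⊆ V ∧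
        IsSigmaCompact (K (i + 2) ∩ (U ∪ V)) ∧ SepLT n (K (i + 2) \ (U ∪ V)) := by
      intro i
      obtain ⟨U, V, hU, hV, hUV, hAU, hBV, hs, hL⟩ := h (K (i + 2)) (hKS _) (hK _)
        (A ∩ (K (i + 1) \ W i)) (B ∪ K (i + 2) \ W (i + 2) ∪ K (i - 1))
        (hA.inter ((hK _).diff (hW _)).isClosed)
        ((hB.union ((hK _).diff (hW _)).isClosed).union (hK _).isClosed) (by
          rw [eq_empty_iff_forall_notMem]
          rintro x ⟨⟨⟨hxA, hx1, hx2⟩, (hxB | hx) | hx⟩, -⟩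
          · have : x ∈ A ∩ B ∩ S := ⟨⟨hxA, hxB⟩, hKS _ hx1⟩
            simp [hAB] at this
          · exact hx.2 (hKW _ hx1)
          · rcases i with _ | i
            · simp [hK0] at hx
            · exact hx2 (hKW _ hx))
      exact ⟨U, V, hU, hV, hUV, fun x hx => hAU ⟨hx, hKm (Nat.le_succ _) hx.2.1⟩, hBV, hs, hL⟩
    choose U V hU hV hUV hAU hBV hs hL using hsep
    -- `c i` is the `i`-th partition `p i` together with the side of `A`; these sets are locally
    -- finite in `S`, and the union of the sides of `A` is one side of the partition to be found.
    set c : ℕ → Set X := fun i => K (i + 2) \ V i with hc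
    set p : ℕ → Set X := fun i => K (i + 2) \ (U i ∪ V i) with hp
    have hcc : ∀ i, IsCompact (c i) := fun i => (hK _).diff (hV i)
    have hpc : ∀ i, IsCompact (p i) := fun i => (hK _).diff ((hU i).union (hV i))
    have hpsub : ∀ i, p i ⊆ c i := fun i x hx => ⟨hx.1, fun h => hx.2 (Or.inr h)⟩
    have hcW : ∀ i, c i ⊆ W (i + 2) := fun i x hx => by
      by_contra h
      exact hx.2 (hBV i ⟨Or.inl (Or.inr ⟨hx.1, h⟩), hx.1⟩)
    have hcK : ∀ i j, i < j → ∀ x ∈ c j, x ∉ K i := fun i j hij x hx hxi =>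
      hx.2 (hBV j ⟨Or.inr (hKm (by omega) hxi), hx.1⟩)
    have hcB : ∀ i, ∀ x ∈ c i, x ∉ B := fun i x hx hxB =>
      hx.2 (hBV i ⟨Or.inl (Or.inl hxB), hx.1⟩)
    have hUc : ∀ i, (U i ∩ W (i + 2)) ∩ S ⊆ c i := fun i x hx => by
      have hxK := hWK _ ⟨hx.1.2, hx.2⟩
      refine ⟨hxK, fun hxV => ?_⟩
      have : x ∈ U i ∩ V i ∩ K (i + 2) := ⟨⟨hx.1.1, hxV⟩, hxK⟩
      simp [hUV] at this
    have hUc' : ∀ i x, x ∈ c i → x ∉ p i → x ∈ U i ∩ W (i + 2) := fun i x hx hxp => by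
      refine ⟨?_, hcW i hx⟩
      by_contra h
      exact hxp ⟨hx.1, fun h' => h'.elim h hx.2⟩
    set U' := ⋃ i, U i ∩ W (i + 2) with hU'
    set V' := ⋃ i, W i \ ⋃ j < i + 1, c j with hV'
    have hU'o : IsOpen U' := isOpen_iUnion fun i => (hU i).inter (hW _)
    have hV'o : IsOpen V' := isOpen_iUnion fun i =>
      (hW i).sdiff ((finite_lt_nat _).isCompact_biUnion fun j _ => hcc j).isClosed
    have hV'c : ∀ x ∈ S, x ∈ V' ↔ ∀ j, x ∉ c j := by
      intro x hxS
      rw [hV', mem_iUnion]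
      constructor
      · rintro ⟨i, hxi, hx⟩ j hj
        rcases lt_or_ge j (i + 1) with hij | hij
        · exact hx (mem_iUnion₂.2 ⟨j, hij, hj⟩)
        · exact hcK i j hij x hj (hWK i ⟨hxi, hxS⟩)
      · intro hx
        obtain ⟨i, hi⟩ := mem_iUnion.1 (hSK hxS)
        refine ⟨i + 1, hKW i hi, ?_⟩
        simp only [mem_iUnion, not_exists]
        exact fun j _ => hx j
    have hU'S : ∀ x ∈ S, x ∈ U' → ∃ i, x ∈ c i ∧ x ∈ U i := by
      intro x hxS hx
      obtain ⟨i, hi⟩ := mem_iUnion.1 hx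
      exact ⟨i, hUc i ⟨hi, hxS⟩, hi.1⟩
    have hpp : ∀ i j, IsSigmaCompact (p i \ p j) := by
      intro i j
      have e : p i \ p j = (K (j + 2) ∩ (U j ∪ V j)) ∩ p i ∪ p i \ W (j + 2) := by
        ext x
        simp only [hp, Set.mem_sdiff, mem_inter_iff, mem_union]
        constructor
        · rintro ⟨⟨h1, h2⟩, h3⟩
          by_cases hxW : x ∈ W (j + 2)
          · have := hWK _ ⟨hxW, hKS _ h1⟩
            tauto
          · tauto
        · rintro (⟨⟨h1, h2⟩, h3⟩ | ⟨h1, h2⟩)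
          · tauto
          · refine ⟨h1, fun h3 => h2 (hcW j (hpsub j h3))⟩
      rw [e]
      exact ((hs j).inter_isClosed (hpc i).isClosed).union ((hpc i).diff (hW _)).isSigmaCompact
    have hPp : S \ (U' ∪ V') ⊆ ⋃ i, p i := by
      rintro x ⟨hxS, hx⟩
      have hxV : ¬ ∀ j, x ∉ c j := fun h => hx (Or.inr ((hV'c x hxS).2 h))
      push Not at hxV
      obtain ⟨j, hj⟩ := hxV
      refine mem_iUnion.2 ⟨j, ?_⟩
      by_contra hxp
      exact hx (Or.inl (mem_iUnion.2 ⟨j, hUc' j x hj hxp⟩))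
    -- The first member of the exhaustion that contains a point of `A` tells which partition
    -- surrounds it. The partition thus obtained is contained in the union of the sets `p i`, of
    -- which every compact subset of `S` meets finitely many.
    refine ⟨U', V', hU'o, hV'o, ?_, ?_, ?_, ?_, ?_⟩
    · rw [eq_empty_iff_forall_notMem]
      rintro x ⟨⟨hxU, hxV⟩, hxS⟩
      obtain ⟨i, hi, -⟩ := hU'S x hxS hxU
      exact (hV'c x hxS).1 hxV i hi
    · rintro x ⟨hxA, hxS⟩
      have hex : ∃ i, x ∈ K i := mem_iUnion.1 (hSK hxS)
      classical
      obtain ⟨i, hi⟩ : ∃ i, Nat.find hex = i + 1 := Nat.exists_eq_succ_of_ne_zero fun h0 => by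
        have := Nat.find_spec hex
        rw [h0, hK0] at this
        exact this
      have hx1 : x ∈ K (i + 1) := hi ▸ Nat.find_spec hex
      have hx2 : x ∉ W i := fun h' => Nat.find_min hex (m := i) (by omega) (hWK i ⟨h', hxS⟩)
      exact mem_iUnion.2 ⟨i, hAU i ⟨hxA, hx1, hx2⟩, hKW _ hx1⟩
    · rintro x ⟨hxB, hxS⟩
      exact (hV'c x hxS).2 fun j hj => hcB j x hj hxB
    · rw [inter_union_distrib_left]
      refine IsSigmaCompact.union ?_ ?_
      · have e : S ∩ U' = ⋃ i, (K (i + 2) ∩ (U i ∪ V i)) ∩ (c i) := by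
          ext x
          simp only [mem_inter_iff, mem_iUnion]
          constructor
          · rintro ⟨hxS, hx⟩
            obtain ⟨i, hi, hi'⟩ := hU'S x hxS hx
            exact ⟨i, ⟨hi.1, Or.inl hi'⟩, hi⟩
          · rintro ⟨i, ⟨h1, h2⟩, h3⟩
            exact ⟨hKS _ h1, mem_iUnion.2 ⟨i, h2.resolve_right h3.2, hcW i h3⟩⟩
        rw [e]
        exact isSigmaCompact_iUnion _ fun i => (hs i).inter_isClosed (hcc i).isClosed
      · have e : S ∩ V' = ⋃ i, K i ∩ ⋂ j ∈ Finset.range (i + 1), (c j)ᶜ := by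
          ext x
          simp only [mem_inter_iff, mem_iUnion, mem_iInter, Finset.mem_range, mem_compl_iff]
          constructor
          · rintro ⟨hxS, hx⟩
            obtain ⟨i, hi⟩ := mem_iUnion.1 (hSK hxS)
            exact ⟨i, hi, fun j _ => (hV'c x hxS).1 hx j⟩
          · rintro ⟨i, hi, hx⟩
            refine ⟨hKS i hi, (hV'c x (hKS i hi)).2 fun j hj => ?_⟩
            rcases lt_or_ge j (i + 1) with hij | hij
            · exact hx j hij hj
            · exact hcK i j hij x hj hi
        rw [e]
        refine isSigmaCompact_iUnion _ fun i =>
          (hK i).isSigmaCompact.biInter_finset _ _ fun j _ => ?_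
        have e : K i ∩ (c j)ᶜ =
            ((K (j + 2) ∩ (U j ∪ V j)) ∩ (K i \ U j)) ∪ K i \ W (j + 2) := by
          ext x
          have hd : x ∈ U j → x ∈ V j → x ∈ K (j + 2) → False := fun h1 h2 h3 => by
            have : x ∈ U j ∩ V j ∩ K (j + 2) := ⟨⟨h1, h2⟩, h3⟩
            simp [hUV] at this
          simp only [hc, Set.mem_sdiff, mem_inter_iff, mem_union, mem_compl_iff]
          constructor
          · rintro ⟨h1, h2⟩
            by_cases hxW : x ∈ W (j + 2)
            · have := hWK _ ⟨hxW, hKS _ h1⟩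
              tauto
            · tauto
          · rintro (⟨⟨h1, h2⟩, h3⟩ | ⟨h1, h2⟩)
            · tauto
            · exact ⟨h1, fun h3 => h2 (hcW j h3)⟩
        rw [e]
        exact ((hs j).inter_isClosed ((hK i).diff (hU j)).isClosed).union
          ((hK i).diff (hW _)).isSigmaCompact
    · refine ih (hS.diff_isOpen (hU'o.union hV'o)) fun F hF hFc => ?_
      obtain ⟨m, hm⟩ : ∃ m, F ⊆ K m := by
        have hWm : Monotone fun i => W (i + 1) ∩ S := monotone_nat_of_le_succ fun i x hx =>
          ⟨hKW _ (hWK _ hx), hx.2⟩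
        obtain ⟨t, ht⟩ := hFc.elim_finite_subcover W hW fun x hx => by
          obtain ⟨i, hi⟩ := mem_iUnion.1 (hSK (hF hx).1)
          exact mem_iUnion.2 ⟨i + 1, hKW i hi⟩
        refine ⟨t.sup id, fun x hx => ?_⟩
        obtain ⟨i, hi, hxi⟩ := mem_iUnion₂.1 (ht hx)
        exact hKm (Finset.le_sup (f := id) hi) (hWK i ⟨hxi, (hF hx).1⟩)
      refine (SepLT.biUnion_lt (fun S => ih) hpc hL hpp (m + 1)).subset_isClosed hFc.isClosed ?_
      intro x hx
      obtain ⟨j, hj⟩ := mem_iUnion.1 (hPp (hF hx))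
      refine mem_iUnion₂.2 ⟨j, ?_, hj⟩
      by_contra hjm
      exact hcK m j (by omega) x (hpsub j hj) (hm hx)

/-- The subset theorem for `Ind₀`: it does not increase when a closed set with `σ`-compact relative
complement is removed. -/
theorem SepLT.diff_isClosed {X : Type u} [TopologicalSpace X] [T2Space X] [CompactSpace X]
    {n : ℕ} {S C : Set X} (hS : IsTame S) (hC : IsClosed C) (hSC : IsSigmaCompact (S \ C))
    (h : SepLT n S) : SepLT n (S \ C) :=
  SepLT.of_forall_isCompact ⟨hSC, hS.2.inter hC.isOpen_compl.isLocallyClosed⟩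
    fun _ hK hKc => h.subset_isClosed hKc.isClosed (hK.trans sdiff_subset)

/-! ### Fully closed maps -/

theorem IsGδ.isSigmaCompact_compl {X : Type u} [TopologicalSpace X] [CompactSpace X] {T : Set X}
    (hT : IsGδ T) : IsSigmaCompact Tᶜ := by
  obtain ⟨f, hf, rfl⟩ := isGδ_iff_eq_iInter_nat.1 hT
  rw [compl_iInter]
  exact isSigmaCompact_iUnion_of_isCompact _ fun i => (hf i).isClosed_compl.isCompact

theorem Set.Finite.isTame_compl {X : Type u} [TopologicalSpace X] [CompactSpace X] [T2Space X]
    [FirstCountableTopology X] {T : Set X} (hT : T.Finite) : IsTame Tᶜ :=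
  ⟨hT.isGδ.isSigmaCompact_compl, hT.isClosed.isOpen_compl.isLocallyClosed⟩

/-- The finite set `E` is a partition in the closed set `Z` between `A ∩ Z` and `B ∩ Z`, with sides
`P` and `Q`: these are relatively open in `Z`, since `P ∪ E` and `Q ∪ E` are closed. -/
structure FiniteSplitting {X : Type u} [TopologicalSpace X] (Z A B P Q E : Set X) : Prop where
  union : Z = P ∪ Q ∪ E
  finite : E.Finite
  closed_left : IsClosed (P ∪ E)
  closed_right : IsClosed (Q ∪ E)
  disj : Disjoint P Q
  disj_left : Disjoint P E
  disj_right : Disjoint Q E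
  left : A ∩ Z ⊆ P
  right : B ∩ Z ⊆ Q

theorem exists_finiteSplitting_preimage {X : Type u} {Y : Type v} [TopologicalSpace X] {f : X → Y}
    {A B : Set X} {T : Set Y} (hT : T.Finite)
    (h : ∀ t ∈ T, ∃ P Q E, FiniteSplitting (f ⁻¹' {t}) A B P Q E) :
    ∃ P Q E, FiniteSplitting (f ⁻¹' T) A B P Q E := by
  choose! P Q E h using h
  have hsub : ∀ t ∈ T, ∀ x, x ∈ P t ∪ Q t ∪ E t → f x = t := fun t ht x hx => by
    rw [← (h t ht).union] at hx; exact hx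
  have hPf : ∀ t ∈ T, ∀ x ∈ P t, f x = t := fun t ht x hx => hsub t ht x (Or.inl (Or.inl hx))
  have hQf : ∀ t ∈ T, ∀ x ∈ Q t, f x = t := fun t ht x hx => hsub t ht x (Or.inl (Or.inr hx))
  have hEf : ∀ t ∈ T, ∀ x ∈ E t, f x = t := fun t ht x hx => hsub t ht x (Or.inr hx)
  have hdis : ∀ R R' : Y → Set X, (∀ t ∈ T, ∀ x ∈ R t, f x = t) →
      (∀ t ∈ T, ∀ x ∈ R' t, f x = t) → (∀ t ∈ T, Disjoint (R t) (R' t)) →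
      Disjoint (⋃ t ∈ T, R t) (⋃ t ∈ T, R' t) := by
    intro R R' hR hR' hd
    rw [Set.disjoint_left]
    intro x hx hx'
    obtain ⟨t, ht, hxt⟩ := mem_iUnion₂.1 hx
    obtain ⟨t', ht', hxt'⟩ := mem_iUnion₂.1 hx'
    obtain rfl : t = t' := (hR t ht x hxt).symm.trans (hR' t' ht' x hxt')
    exact Set.disjoint_left.1 (hd t ht) hxt hxt'
  have hU : ∀ R R' : Y → Set X,
      (⋃ t ∈ T, R t) ∪ (⋃ t ∈ T, R' t) = ⋃ t ∈ T, (R t ∪ R' t) := fun R R' => by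
    simp only [iUnion_union_distrib]
  refine ⟨⋃ t ∈ T, P t, ⋃ t ∈ T, Q t, ⋃ t ∈ T, E t, ?_, hT.biUnion fun t ht => (h t ht).finite,
    ?_, ?_, hdis _ _ hPf hQf fun t ht => (h t ht).disj,
    hdis _ _ hPf hEf fun t ht => (h t ht).disj_left,
    hdis _ _ hQf hEf fun t ht => (h t ht).disj_right, ?_, ?_⟩
  · rw [hU, hU]
    ext x
    simp only [mem_preimage, mem_iUnion, exists_prop]
    constructor
    · intro hx
      refine ⟨f x, hx, ?_⟩
      rw [← (h _ hx).union]; rfl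
    · rintro ⟨t, ht, hx⟩
      rw [hsub t ht x hx]; exact ht
  · rw [hU]
    exact hT.isClosed_biUnion fun t ht => (h t ht).closed_left
  · rw [hU]
    exact hT.isClosed_biUnion fun t ht => (h t ht).closed_right
  · rintro x ⟨hxA, hx⟩
    exact mem_iUnion₂.2 ⟨f x, hx, (h _ hx).left ⟨hxA, rfl⟩⟩
  · rintro x ⟨hxA, hx⟩
    exact mem_iUnion₂.2 ⟨f x, hx, (h _ hx).right ⟨hxA, rfl⟩⟩

/-- The union of a closed set and a sequence of closed sets shrinking to a finite set `T` is
closed once `T` is added. -/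
theorem isClosed_union_iUnion_of_shrinking {Y : Type v} [TopologicalSpace Y] {T : Set Y}
    (hT : IsClosed T) {N : ℕ → Set Y} (hN : ∀ i, IsOpen (N i)) (hNT : Tᶜ ⊆ ⋃ i, N i)
    {A : Set Y} (hA : IsClosed A) {R : ℕ → Set Y} (hR : ∀ i, IsClosed (R i))
    (hRN : ∀ i j, i ≤ j → ∀ y ∈ R j, y ∈ N i → y ∈ T) : IsClosed (A ∪ (⋃ i, R i) ∪ T) := by
  rw [← isOpen_compl_iff, isOpen_iff_mem_nhds]
  intro y hy
  simp only [mem_compl_iff, mem_union, mem_iUnion, not_or, not_exists] at hy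
  obtain ⟨⟨hyA, hyR⟩, hyT⟩ := hy
  obtain ⟨m, hm⟩ := mem_iUnion.1 (hNT hyT)
  have hcl : IsClosed (⋃ i < m, R i) := (finite_lt_nat m).isClosed_biUnion fun i _ => hR i
  filter_upwards [(hN m).mem_nhds hm, hA.isOpen_compl.mem_nhds hyA, hT.isOpen_compl.mem_nhds hyT,
    hcl.isOpen_compl.mem_nhds (by simpa using fun i _ => hyR i)] with z h1 h2 h3 h4
  simp only [mem_compl_iff, mem_union, mem_iUnion, not_or, not_exists]
  refine ⟨⟨h2, fun i hi => ?_⟩, h3⟩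
  rcases lt_or_ge i m with him | him
  · exact h4 (mem_iUnion₂.2 ⟨i, him, hi⟩)
  · exact h3 (hRN m i him z hi h1)

/-- The effect of a fully closed map with one-dimensional fibres on `Ind₀`. In the compact case
full closedness means that `f '' F ∩ f '' G` is finite for disjoint closed `F`, `G`. The set `C` is
arbitrary so that the induction can pass to the image of the partition, which is contained in a
partition of `C \ T` together with the finite set `T`. -/
theorem SepLT.of_fullyClosed {X : Type u} {Y : Type v} [TopologicalSpace X] [TopologicalSpace Y]
    [CompactSpace X] [T2Space X] [FirstCountableTopology X]
    [CompactSpace Y] [T2Space Y] [FirstCountableTopology Y] {f : X → Y} (hf : Continuous f)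
    (hfin : ∀ F G : Set X, IsClosed F → IsClosed G → Disjoint F G → (f '' F ∩ f '' G).Finite)
    (hfib : ∀ y, ∀ A B : Set X, IsClosed A → IsClosed B → Disjoint A B →
      ∃ P Q E, FiniteSplitting (f ⁻¹' {y}) A B P Q E)
    {m : ℕ} {D : Set X} {C : Set Y} (hD : IsClosed D) (hC : IsClosed C) (hDC : f '' D ⊆ C)
    (h : SepLT (m + 1) C) : SepLT (m + 2) D := by
  induction m using Nat.strong_induction_on generalizing D C with
  | _ m ih =>
  intro A₀ B₀ hA₀ hB₀ hAB₀
  obtain ⟨A, hAeq⟩ : ∃ A, A = A₀ ∩ D := ⟨_, rfl⟩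
  obtain ⟨B, hBeq⟩ : ∃ B, B = B₀ ∩ D := ⟨_, rfl⟩
  have hA : IsClosed A := hAeq ▸ hA₀.inter hD
  have hB : IsClosed B := hBeq ▸ hB₀.inter hD
  have hAB : Disjoint A B := by
    rw [Set.disjoint_left]
    intro x hx hx'
    rw [hAeq] at hx; rw [hBeq] at hx'
    have : x ∈ A₀ ∩ B₀ ∩ D := ⟨⟨hx.1, hx'.1⟩, hx.2⟩
    simp [hAB₀] at this
  set T := f '' A ∩ f '' B with hT
  have hTfin : T.Finite := hfin A B hA hB hAB
  have hTC : T ⊆ C := fun y hy => hDC (image_mono (hAeq ▸ inter_subset_right) hy.1)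
  obtain ⟨P, Q, E, hPQ⟩ := exists_finiteSplitting_preimage (f := f) (A := A) (B := B) hTfin
    fun t _ => hfib t A B hA hB hAB
  have hTX : ∀ x, f x ∈ T ↔ (x ∈ P ∨ x ∈ Q) ∨ x ∈ E := fun x => by
    have : x ∈ f ⁻¹' T ↔ x ∈ P ∪ Q ∪ E := by rw [hPQ.union]
    exact this
  have hAP : ∀ x ∈ A, f x ∈ T → x ∈ P := fun x hx hxT => hPQ.left ⟨hx, hxT⟩
  have hBQ : ∀ x ∈ B, f x ∈ T → x ∈ Q := fun x hx hxT => hPQ.right ⟨hx, hxT⟩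
  have hdPQ := Set.disjoint_left.1 hPQ.disj
  have hdPE := Set.disjoint_left.1 hPQ.disj_left
  have hdQE := Set.disjoint_left.1 hPQ.disj_right
  -- `K` and `L` exhaust the complements of `E` and `T`. The sets `U₀` and `V₀` extend the
  -- separation over `T` to `X \ E`.
  obtain ⟨K, W, -, -, hK, hW, hKE, hWK, hKW, hEK⟩ := hPQ.finite.isTame_compl.exists_exhaustion
  obtain ⟨L, N, -, -, hL, hN, hLT, hNL, hLN, hTL⟩ := hTfin.isTame_compl.exists_exhaustion
  have hKm : Monotone K := monotone_nat_of_le_succ fun i x hx => hWK _ ⟨hKW i hx, hKE i hx⟩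
  have hLm : Monotone L := monotone_nat_of_le_succ fun i x hx => hNL _ ⟨hLN i hx, hLT i hx⟩
  obtain ⟨U₀, V₀, hU₀, hV₀, hAU₀, hBV₀, hd₀⟩ := hPQ.finite.isTame_compl.1.exists_separation
    (A := A ∪ (P ∪ E)) (B := B ∪ (Q ∪ E)) (hA.union hPQ.closed_left) (hB.union hPQ.closed_right) (by
      rw [eq_empty_iff_forall_notMem]
      rintro x ⟨⟨hx | hx | hx, hx' | hx' | hx'⟩, hxE⟩
      exacts [Set.disjoint_left.1 hAB hx hx',
        hdPQ (hAP x hx ((hTX x).2 (Or.inl (Or.inr hx')))) hx', hxE hx',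
        hdPQ hx (hBQ x hx' ((hTX x).2 (Or.inl (Or.inl hx)))), hdPQ hx hx', hxE hx',
        hxE hx, hxE hx, hxE hx])
  have hUV₀ : ∀ x, x ∉ E → x ∈ U₀ → x ∈ V₀ → False := fun x hxE hx hx' => by
    have : x ∈ closure (U₀ ∩ Eᶜ) ∩ closure (V₀ ∩ Eᶜ) ∩ Eᶜ :=
      ⟨⟨subset_closure ⟨hx, hxE⟩, subset_closure ⟨hx', hxE⟩⟩, hxE⟩
    simp [hd₀] at this
  have hPU₀ : ∀ x ∈ P, x ∈ U₀ := fun x hx => hAU₀ ⟨Or.inr (Or.inl hx), hdPE hx⟩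
  have hQV₀ : ∀ x ∈ Q, x ∈ V₀ := fun x hx => hBV₀ ⟨Or.inr (Or.inl hx), hdQE hx⟩
  have hAE : ∀ x ∈ A, x ∉ E := fun x hx hxE => hdPE (hAP x hx ((hTX x).2 (Or.inr hxE))) hxE
  have hBE : ∀ x ∈ B, x ∉ E := fun x hx hxE => hdQE (hBQ x hx ((hTX x).2 (Or.inr hxE))) hxE
  obtain ⟨i₀, hAK, hBK⟩ : ∃ i₀, A ⊆ K i₀ ∧ B ⊆ K i₀ := by
    obtain ⟨t, ht⟩ := (hA.union hB).isCompact.elim_finite_subcover W hW fun x hx => by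
      have hxE : x ∈ Eᶜ := hx.elim (hAE x) (hBE x)
      obtain ⟨j, hj⟩ := mem_iUnion.1 (hEK hxE)
      exact mem_iUnion.2 ⟨j + 1, hKW j hj⟩
    have hKt : ∀ x ∈ A ∪ B, x ∉ E → x ∈ K (t.sup id) := fun x hx hxE => by
      obtain ⟨j, hj, hxj⟩ := mem_iUnion₂.1 (ht hx)
      exact hKm (Finset.le_sup (f := id) hj) (hWK j ⟨hxj, hxE⟩)
    exact ⟨t.sup id, fun x hx => hKt x (Or.inl hx) (hAE x hx),
      fun x hx => hKt x (Or.inr hx) (hBE x hx)⟩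
  -- The partition in `Y \ T` has to respect `f '' F i` and `f '' G i` near `T`. These two sets meet
  -- in a finite set only, so they are disjoint on a small neighbourhood `O i` of `T`, except on
  -- `T`.
  set F : ℕ → Set X := fun i => closure (U₀ ∩ Eᶜ) ∩ K (i₀ + i) with hF
  set G : ℕ → Set X := fun i => closure (V₀ ∩ Eᶜ) ∩ K (i₀ + i) with hG
  have hFc : ∀ i, IsClosed (F i) := fun i => isClosed_closure.inter (hK _).isClosed
  have hGc : ∀ i, IsClosed (G i) := fun i => isClosed_closure.inter (hK _).isClosed
  have hFm : Monotone F := fun i j hij => inter_subset_inter_right _ (hKm (by omega))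
  have hGm : Monotone G := fun i j hij => inter_subset_inter_right _ (hKm (by omega))
  have hFG : ∀ i, (f '' F i ∩ f '' G i).Finite := fun i => hfin _ _ (hFc i) (hGc i) (by
    rw [Set.disjoint_left]
    rintro x ⟨hx, hxK⟩ ⟨hx', -⟩
    have : x ∈ closure (U₀ ∩ Eᶜ) ∩ closure (V₀ ∩ Eᶜ) ∩ Eᶜ := ⟨⟨hx, hx'⟩, hKE _ hxK⟩
    simp [hd₀] at this)
  -- the neighbourhood `(N k ∩ Tᶜ)ᶜ` of `T` avoids the finitely many points of
  -- `f '' F i ∩ f '' G i` off `T` when `k` is large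
  have hk : ∀ i, ∃ k, i ≤ k ∧ (f '' F i ∩ f '' G i) \ T ⊆ N k := by
    intro i
    have : ∃ t : Finset ℕ, (f '' F i ∩ f '' G i) \ T ⊆ ⋃ j ∈ t, N j :=
      ((hFG i).sdiff).isCompact.elim_finite_subcover N hN fun y hy => by
        obtain ⟨j, hj⟩ := mem_iUnion.1 (hTL hy.2)
        exact mem_iUnion.2 ⟨j + 1, hLN j hj⟩
    obtain ⟨t, ht⟩ := this
    refine ⟨(t.sup id ⊔ i) + 1, by omega, fun y hy => ?_⟩
    obtain ⟨j, hj, hyj⟩ := mem_iUnion₂.1 (ht hy)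
    exact hLN _ (hLm (le_sup_of_le_left (Finset.le_sup (f := id) hj)) (hNL j ⟨hyj, hy.2⟩))
  choose k hik hkN using hk
  set O : ℕ → Set Y := fun i => (N (k i) ∩ Tᶜ)ᶜ with hO
  have hOc : ∀ i, IsClosed (O i) := fun i =>
    ((hN _).inter hTfin.isClosed.isOpen_compl).isClosed_compl
  have hOFG : ∀ i, ∀ y ∈ O i, y ∈ f '' F i → y ∈ f '' G i → y ∈ T := fun i y hy h1 h2 => by
    by_contra hyT
    exact hy ⟨hkN i ⟨⟨h1, h2⟩, hyT⟩, hyT⟩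
  have hON : ∀ i j, i ≤ j → ∀ y ∈ O j, y ∈ N i → y ∈ T := fun i j hij y hy hyN => by
    by_contra hyT
    refine hy ⟨?_, hyT⟩
    rcases (hij.trans (hik j)).eq_or_lt with h | h
    · rw [← h]; exact hyN
    · obtain ⟨l, hl⟩ : ∃ l, k j = l + 1 := ⟨k j - 1, by omega⟩
      rw [hl]
      exact hLN _ (hLm (by omega : i ≤ l) (hNL i ⟨hyN, hyT⟩))
  have hTN : Tᶜ ⊆ ⋃ i, N i := fun y hy => by
    obtain ⟨j, hj⟩ := mem_iUnion.1 (hTL hy)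
    exact mem_iUnion.2 ⟨j + 1, hLN j hj⟩
  have hfcl : ∀ Z : Set X, IsClosed Z → IsClosed (f '' Z) := hf.isClosedMap
  have hFc' : IsClosed (f '' A ∪ (⋃ i, f '' F i ∩ O i) ∪ T) :=
    isClosed_union_iUnion_of_shrinking hTfin.isClosed hN hTN (hfcl A hA)
      (fun i => (hfcl _ (hFc i)).inter (hOc i)) fun i j hij y hy => hON i j hij y hy.2
  have hGc' : IsClosed (f '' B ∪ (⋃ i, f '' G i ∩ O i) ∪ T) :=
    isClosed_union_iUnion_of_shrinking hTfin.isClosed hN hTN (hfcl B hB)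
      (fun i => (hfcl _ (hGc i)).inter (hOc i)) fun i j hij y hy => hON i j hij y hy.2
  have hAF : ∀ i, A ⊆ F i := fun i x hx =>
    ⟨subset_closure ⟨hAU₀ ⟨Or.inl hx, hAE x hx⟩, hAE x hx⟩, hKm (by omega) (hAK hx)⟩
  have hBG : ∀ i, B ⊆ G i := fun i x hx =>
    ⟨subset_closure ⟨hBV₀ ⟨Or.inl hx, hBE x hx⟩, hBE x hx⟩, hKm (by omega) (hBK hx)⟩
  have hsC : IsSigmaCompact (C \ T) := by
    have := hTfin.isTame_compl.1.inter_isClosed hC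
    rwa [inter_comm] at this
  obtain ⟨U₁, V₁, hU₁, hV₁, hUV₁, hAU₁, hBV₁, hs₁, hL₁⟩ :=
    h.diff_isClosed hC.isTame hTfin.isClosed hsC _ _ hFc' hGc' (by
      rw [eq_empty_iff_forall_notMem]
      rintro y ⟨⟨(hy | hy) | hy, (hy' | hy') | hy'⟩, -, hyT⟩
      · exact hyT ⟨hy, hy'⟩
      · obtain ⟨j, hj⟩ := mem_iUnion.1 hy'
        exact hyT (hOFG j y hj.2 (image_mono (hAF j) hy) hj.1)
      · exact hyT hy'
      · obtain ⟨j, hj⟩ := mem_iUnion.1 hy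
        exact hyT (hOFG j y hj.2 hj.1 (image_mono (hBG j) hy'))
      · obtain ⟨i, hi⟩ := mem_iUnion.1 hy
        obtain ⟨j, hj⟩ := mem_iUnion.1 hy'
        rcases le_total i j with hij | hij
        · exact hyT (hOFG j y hj.2 (image_mono (hFm hij) hi.1) hj.1)
        · exact hyT (hOFG i y hi.2 hi.1 (image_mono (hGm hij) hj.1))
      · exact hyT hy'
      all_goals exact hyT hy)
  -- On the neighbourhood `W'` of `f ⁻¹' T \ E`, the separation `U₀`, `V₀` is compatible with the
  -- preimage of the partition in `C \ T`, so the two can be glued.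
  set W' : Set X := ⋃ i, (W (i₀ + i) ∩ Eᶜ) ∩ f ⁻¹' (L (k i))ᶜ with hW'
  have hW'o : IsOpen W' := isOpen_iUnion fun i =>
    ((hW _).inter hPQ.finite.isClosed.isOpen_compl).inter ((hL _).isClosed.isOpen_compl.preimage hf)
  have hmW' : ∀ x, f x ∈ T → x ∉ E → x ∈ W' := fun x hxT hxE => by
    obtain ⟨j, hj⟩ := mem_iUnion.1 (hEK hxE)
    have : x ∈ W (i₀ + (j + 1)) := hKW _ (hKm (by omega : j ≤ i₀ + j) hj)
    exact mem_iUnion.2 ⟨j + 1, ⟨this, hxE⟩, fun h' => hLT _ h' hxT⟩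
  have hW'E : ∀ x ∈ W', x ∉ E := fun x hx => by
    obtain ⟨i, hi⟩ := mem_iUnion.1 hx
    exact hi.1.2
  have hW'O : ∀ x ∈ W', ∃ i, x ∈ K (i₀ + i) ∧ f x ∈ O i := fun x hx => by
    obtain ⟨i, hi⟩ := mem_iUnion.1 hx
    exact ⟨i, hWK _ hi.1, fun h' => hi.2 (hNL _ h')⟩
  have hUx : ∀ x ∈ D, x ∈ (f ⁻¹' (U₁ ∩ Tᶜ) ∪ U₀ ∩ W') ↔ (f x ∈ U₁ ∧ f x ∉ T) ∨ x ∈ P := by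
    intro x hxD
    constructor
    · rintro (hx | ⟨hx, hxW⟩)
      · exact Or.inl hx
      · by_cases hxT : f x ∈ T
        · right
          rcases (hTX x).1 hxT with (hxP | hxQ) | hxE
          · exact hxP
          · exact (hUV₀ x (hW'E x hxW) hx (hQV₀ x hxQ)).elim
          · exact (hW'E x hxW hxE).elim
        · obtain ⟨i, hxK, hxO⟩ := hW'O x hxW
          exact Or.inl ⟨hAU₁ ⟨Or.inl (Or.inr (mem_iUnion.2
            ⟨i, ⟨x, ⟨subset_closure ⟨hx, hW'E x hxW⟩, hxK⟩, rfl⟩, hxO⟩)),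
            hDC ⟨x, hxD, rfl⟩, hxT⟩, hxT⟩
    · rintro (hx | hx)
      · exact Or.inl hx
      · exact Or.inr ⟨hPU₀ x hx, hmW' x ((hTX x).2 (Or.inl (Or.inl hx))) (hdPE hx)⟩
  have hVx : ∀ x ∈ D, x ∈ (f ⁻¹' (V₁ ∩ Tᶜ) ∪ V₀ ∩ W') ↔ (f x ∈ V₁ ∧ f x ∉ T) ∨ x ∈ Q := by
    intro x hxD
    constructor
    · rintro (hx | ⟨hx, hxW⟩)
      · exact Or.inl hx
      · by_cases hxT : f x ∈ T
        · right
          rcases (hTX x).1 hxT with (hxP | hxQ) | hxE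
          · exact (hUV₀ x (hW'E x hxW) (hPU₀ x hxP) hx).elim
          · exact hxQ
          · exact (hW'E x hxW hxE).elim
        · obtain ⟨i, hxK, hxO⟩ := hW'O x hxW
          exact Or.inl ⟨hBV₁ ⟨Or.inl (Or.inr (mem_iUnion.2
            ⟨i, ⟨x, ⟨subset_closure ⟨hx, hW'E x hxW⟩, hxK⟩, rfl⟩, hxO⟩)),
            hDC ⟨x, hxD, rfl⟩, hxT⟩, hxT⟩
    · rintro (hx | hx)
      · exact Or.inl hx
      · exact Or.inr ⟨hQV₀ x hx, hmW' x ((hTX x).2 (Or.inl (Or.inr hx))) (hdQE hx)⟩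
  have hUo : IsOpen (f ⁻¹' (U₁ ∩ Tᶜ) ∪ U₀ ∩ W') :=
    ((hU₁.inter hTfin.isClosed.isOpen_compl).preimage hf).union (hU₀.inter hW'o)
  have hVo : IsOpen (f ⁻¹' (V₁ ∩ Tᶜ) ∪ V₀ ∩ W') :=
    ((hV₁.inter hTfin.isClosed.isOpen_compl).preimage hf).union (hV₀.inter hW'o)
  have hPT : ∀ x ∈ P, f x ∈ T := fun x hx => (hTX x).2 (Or.inl (Or.inl hx))
  have hQT : ∀ x ∈ Q, f x ∈ T := fun x hx => (hTX x).2 (Or.inl (Or.inr hx))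
  refine ⟨_, _, hUo, hVo, ?_, ?_, ?_, ?_, ?_⟩
  · rw [eq_empty_iff_forall_notMem]
    rintro x ⟨⟨hx, hx'⟩, hxD⟩
    rcases (hUx x hxD).1 hx with hx | hx <;> rcases (hVx x hxD).1 hx' with hx' | hx'
    · have : f x ∈ U₁ ∩ V₁ ∩ (C \ T) := ⟨⟨hx.1, hx'.1⟩, hDC ⟨x, hxD, rfl⟩, hx.2⟩
      simp [hUV₁] at this
    · exact hx.2 (hQT x hx')
    · exact hx'.2 (hPT x hx)
    · exact hdPQ hx hx'
  · rintro x ⟨hxA, hxD⟩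
    have hxA' : x ∈ A := hAeq ▸ ⟨hxA, hxD⟩
    refine (hUx x hxD).2 ?_
    by_cases hxT : f x ∈ T
    · exact Or.inr (hAP x hxA' hxT)
    · exact Or.inl ⟨hAU₁ ⟨Or.inl (Or.inl ⟨x, hxA', rfl⟩), hDC ⟨x, hxD, rfl⟩, hxT⟩, hxT⟩
  · rintro x ⟨hxB, hxD⟩
    have hxB' : x ∈ B := hBeq ▸ ⟨hxB, hxD⟩
    refine (hVx x hxD).2 ?_
    by_cases hxT : f x ∈ T
    · exact Or.inr (hBQ x hxB' hxT)
    · exact Or.inl ⟨hBV₁ ⟨Or.inl (Or.inl ⟨x, hxB', rfl⟩), hDC ⟨x, hxD, rfl⟩, hxT⟩, hxT⟩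
  · have e : D ∩ ((f ⁻¹' (U₁ ∩ Tᶜ) ∪ U₀ ∩ W') ∪ (f ⁻¹' (V₁ ∩ Tᶜ) ∪ V₀ ∩ W')) =
        (f ⁻¹' ((C \ T) ∩ (U₁ ∪ V₁)) ∩ D) ∪ (Eᶜ ∩ (D ∩ f ⁻¹' T)) := by
      ext x
      constructor
      · rintro ⟨hxD, hx | hx⟩
        · rcases (hUx x hxD).1 hx with hx | hx
          · exact Or.inl ⟨⟨⟨hDC ⟨x, hxD, rfl⟩, hx.2⟩, Or.inl hx.1⟩, hxD⟩
          · exact Or.inr ⟨hdPE hx, hxD, hPT x hx⟩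
        · rcases (hVx x hxD).1 hx with hx | hx
          · exact Or.inl ⟨⟨⟨hDC ⟨x, hxD, rfl⟩, hx.2⟩, Or.inr hx.1⟩, hxD⟩
          · exact Or.inr ⟨hdQE hx, hxD, hQT x hx⟩
      · rintro (⟨⟨hx, hx' | hx'⟩, hxD⟩ | ⟨hxE, hxD, hxT⟩)
        · exact ⟨hxD, Or.inl ((hUx x hxD).2 (Or.inl ⟨hx', hx.2⟩))⟩
        · exact ⟨hxD, Or.inr ((hVx x hxD).2 (Or.inl ⟨hx', hx.2⟩))⟩
        · rcases (hTX x).1 hxT with (hx | hx) | hx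
          · exact ⟨hxD, Or.inl ((hUx x hxD).2 (Or.inr hx))⟩
          · exact ⟨hxD, Or.inr ((hVx x hxD).2 (Or.inr hx))⟩
          · exact (hxE hx).elim
    rw [e]
    exact ((hs₁.preimage hf).inter_isClosed hD).union
      (hPQ.finite.isTame_compl.1.inter_isClosed (hD.inter (hTfin.isClosed.preimage hf)))
  · have hcl := hD.sdiff (hUo.union hVo)
    have hmem : ∀ x ∈ D \ ((f ⁻¹' (U₁ ∩ Tᶜ) ∪ U₀ ∩ W') ∪ (f ⁻¹' (V₁ ∩ Tᶜ) ∪ V₀ ∩ W')),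
        (f x ∈ T ∧ x ∈ E) ∨ (f x ∈ (C \ T) \ (U₁ ∪ V₁)) := by
      rintro x ⟨hxD, hx⟩
      have h1 := fun h' => hx (Or.inl ((hUx x hxD).2 h'))
      have h2 := fun h' => hx (Or.inr ((hVx x hxD).2 h'))
      by_cases hxT : f x ∈ T
      · left
        refine ⟨hxT, ?_⟩
        rcases (hTX x).1 hxT with (h' | h') | h'
        exacts [(h1 (Or.inr h')).elim, (h2 (Or.inr h')).elim, h']
      · right
        refine ⟨⟨hDC ⟨x, hxD, rfl⟩, hxT⟩, ?_⟩
        rintro (h' | h')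
        exacts [h1 (Or.inl ⟨h', hxT⟩), h2 (Or.inl ⟨h', hxT⟩)]
    -- If `m = 0`, the partition of `C \ T` is empty and only points of `E` remain.
    rcases m with _ | m
    · refine (SepLT.of_finite hPQ.finite le_rfl).subset_isClosed hcl fun x hx => ?_
      rcases hmem x hx with h' | h'
      · exact h'.2
      · rw [show (C \ T) \ (U₁ ∪ V₁) = ∅ from hL₁] at h'
        exact h'.elim
    · have hC'cl : IsClosed (C \ ((U₁ ∪ V₁) ∩ Tᶜ)) :=
        hC.sdiff ((hU₁.union hV₁).inter hTfin.isClosed.isOpen_compl)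
      have e1 : (C \ ((U₁ ∪ V₁) ∩ Tᶜ)) \ T = (C \ T) \ (U₁ ∪ V₁) := by
        ext y; simp only [Set.mem_sdiff, mem_inter_iff, mem_compl_iff]; tauto
      refine ih m (Nat.lt_succ_self m) hcl hC'cl ?_ (SepLT.of_inter_of_diff (C := T) hC'cl.isTame
        hTfin.isClosed ?_ (SepLT.of_finite (hTfin.subset inter_subset_right) (by omega)) ?_)
      · rintro _ ⟨x, hx, rfl⟩
        rcases hmem x hx with h' | h'
        · exact ⟨hTC h'.1, fun h3 => h3.2 h'.1⟩
        · exact ⟨h'.1.1, fun h3 => h'.2 h3.1⟩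
      · rw [e1]; exact hsC.inter_isClosed (hU₁.union hV₁).isClosed_compl
      · rw [e1]; exact hL₁

/-! ### Comparison of the inductive dimensions -/

theorem SepLT.indZeroLT {Z : Type u} {X : Type v} [TopologicalSpace Z] [TopologicalSpace X]
    [T2Space X] {n : ℕ} {S : Set X} (h : SepLT n S) {e : Z → X} (he : IsClosedEmbedding e)
    (hS : range e ⊆ S) : IndZeroLT n Z := by
  induction n generalizing Z S with
  | zero =>
    rw [SepLT] at h
    subst h
    exact ⟨fun z => hS ⟨z, rfl⟩⟩
  | succ n ih =>
    intro A B hA hB hAB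
    obtain ⟨U, V, hU, hV, hUV, hAU, hBV, hs, hL⟩ := h (e '' A) (e '' B) (he.isClosedMap A hA)
      (he.isClosedMap B hB) (by
        rw [← image_inter he.injective, hAB.inter_eq, image_empty, empty_inter])
    have hLcl : IsClosed (e ⁻¹' (U ∪ V))ᶜ := ((hU.union hV).preimage he.continuous).isClosed_compl
    refine ⟨(e ⁻¹' (U ∪ V))ᶜ, ⟨hLcl, e ⁻¹' U, e ⁻¹' V, hU.preimage he.continuous,
      hV.preimage he.continuous, ?_, by rw [compl_compl, preimage_union], ?_, ?_⟩, ?_, ?_⟩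
    · rw [Set.disjoint_left]
      intro z hz hz'
      have : e z ∈ U ∩ V ∩ S := ⟨⟨hz, hz'⟩, hS ⟨z, rfl⟩⟩
      simp [hUV] at this
    · exact fun z hz => hAU ⟨⟨z, hz, rfl⟩, hS ⟨z, rfl⟩⟩
    · exact fun z hz => hBV ⟨⟨z, hz, rfl⟩, hS ⟨z, rfl⟩⟩
    · obtain ⟨K, hK, hKe⟩ := hs
      have e1 : (e ⁻¹' (U ∪ V))ᶜ = ⋂ i, (e ⁻¹' K i)ᶜ := by
        rw [← compl_iUnion, ← preimage_iUnion, hKe]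
        congr 1
        ext z
        exact ⟨fun hz => ⟨hS ⟨z, rfl⟩, hz⟩, fun hz => hz.2⟩
      rw [e1]
      exact IsGδ.iInter_of_isOpen fun i =>
        ((hK i).isClosed.preimage he.continuous).isOpen_compl
    · refine ih hL (he.comp hLcl.isClosedEmbedding_subtypeVal) ?_
      rintro _ ⟨z, rfl⟩
      exact ⟨hS ⟨z, rfl⟩, z.2⟩

theorem SepLT.largeIndLT {Z : Type u} {X : Type v} [TopologicalSpace Z] [TopologicalSpace X]
    {n : ℕ} {S : Set X} (h : SepLT n S) {e : Z → X} (he : IsClosedEmbedding e)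
    (hS : range e ⊆ S) : LargeIndLT n Z := by
  induction n generalizing Z S with
  | zero =>
    rw [SepLT] at h
    subst h
    exact ⟨fun z => hS ⟨z, rfl⟩⟩
  | succ n ih =>
    intro A O hA hO hAO
    obtain ⟨U, V, hU, hV, hUV, hAU, hBV, -, hL⟩ := h (e '' A) (e '' Oᶜ) (he.isClosedMap A hA)
      (he.isClosedMap _ hO.isClosed_compl) (by
        rw [← image_inter he.injective, (disjoint_compl_right_iff_subset.2 hAO).inter_eq,
          image_empty, empty_inter])
    have hUV' : ∀ z, e z ∈ U → e z ∈ V → False := fun z hz hz' => by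
      have : e z ∈ U ∩ V ∩ S := ⟨⟨hz, hz'⟩, hS ⟨z, rfl⟩⟩
      simp [hUV] at this
    refine ⟨e ⁻¹' U, hU.preimage he.continuous, fun z hz => hAU ⟨⟨z, hz, rfl⟩, hS ⟨z, rfl⟩⟩, ?_,
      ih hL (he.comp isClosed_frontier.isClosedEmbedding_subtypeVal) ?_⟩
    · intro z hz
      by_contra hzO
      exact hUV' z hz (hBV ⟨⟨z, hzO, rfl⟩, hS ⟨z, rfl⟩⟩)
    · rintro _ ⟨⟨z, hz⟩, rfl⟩
      rw [(hU.preimage he.continuous).frontier_eq] at hz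
      refine ⟨hS ⟨z, rfl⟩, fun h' => ?_⟩
      rcases h' with h' | h'
      · exact hz.2 h'
      · obtain ⟨w, hw, hw'⟩ := mem_closure_iff.1 hz.1 _ (hV.preimage he.continuous) h'
        exact hUV' w hw' hw

theorem HasSmallInductiveDimensionLT.of_isEmbedding {n : ℕ} {Z X : Type u} [TopologicalSpace Z]
    [TopologicalSpace X] (h : HasSmallInductiveDimensionLT X n) {e : Z → X} (he : IsEmbedding e) :
    HasSmallInductiveDimensionLT Z n := by
  induction n generalizing Z X with
  | zero =>
    rw [hasSmallInductiveDimensionLT_zero_iff] at *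
    exact Function.isEmpty e
  | succ n ih =>
    obtain _ | ⟨_, s, hs, h⟩ := h
    refine .succ _ (preimage e '' s) (hs.isInducing he.isInducing) ?_
    rintro _ ⟨U, hU, rfl⟩
    have hsub : frontier (e ⁻¹' U) ⊆ e ⁻¹' frontier U := he.continuous.frontier_preimage_subset U
    exact ih (h U hU) (e := fun z => (⟨e z, hsub z.2⟩ : frontier U))
      ((he.comp IsEmbedding.subtypeVal).codRestrict _ _)

theorem HasSmallInductiveDimensionLT.succ_of_nhds {n : ℕ} {X : Type u} [TopologicalSpace X]
    (h : ∀ (x : X) (O : Set X), IsOpen O → x ∈ O →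
      ∃ U : Set X, IsOpen U ∧ x ∈ U ∧ U ⊆ O ∧ HasSmallInductiveDimensionLT (frontier U) n) :
    HasSmallInductiveDimensionLT X (n + 1) := by
  refine .succ _ {U | IsOpen U ∧ HasSmallInductiveDimensionLT (frontier U) n}
    (isTopologicalBasis_of_isOpen_of_nhds (fun U hU => hU.1) fun x O hx hO => ?_) fun U hU => hU.2
  obtain ⟨U, hU, hxU, hUO, hd⟩ := h x O hO hx
  exact ⟨U, ⟨hU, hd⟩, hxU, hUO⟩

theorem LargeIndLT.hasSmallInductiveDimensionLT {n : ℕ} {X : Type u} [TopologicalSpace X]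
    [T1Space X] (h : LargeIndLT n X) : HasSmallInductiveDimensionLT X n := by
  induction n generalizing X with
  | zero => exact hasSmallInductiveDimensionLT_zero_iff.2 h
  | succ n ih =>
    refine .succ_of_nhds fun x O hO hx => ?_
    obtain ⟨U, hU, hxU, hUO, hd⟩ := h {x} O isClosed_singleton hO (by simpa using hx)
    exact ⟨U, hU, hxU rfl, hUO, ih hd⟩

theorem IndZeroLT.hasSmallInductiveDimensionLT {n : ℕ} {X : Type u} [TopologicalSpace X]
    [T1Space X] (h : IndZeroLT n X) : HasSmallInductiveDimensionLT X n := by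
  induction n generalizing X with
  | zero => exact hasSmallInductiveDimensionLT_zero_iff.2 h
  | succ n ih =>
    refine .succ_of_nhds fun x O hO hx => ?_
    obtain ⟨L, ⟨-, U, V, hU, hV, hUV, hLUV, hxU, hOV⟩, -, hd⟩ := h {x} Oᶜ isClosed_singleton
      hO.isClosed_compl (by simpa using hx)
    have hUO : U ⊆ O := fun y hy => by
      by_contra hyO
      exact Set.disjoint_left.1 hUV hy (hOV hyO)
    have hsub : frontier U ⊆ L := by
      rw [hU.frontier_eq]
      rintro y ⟨hy, hyU⟩
      by_contra hyL
      have hyL' : y ∈ U ∪ V := hLUV ▸ hyL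
      obtain ⟨z, hz, hz'⟩ := mem_closure_iff.1 hy V hV (hyL'.resolve_left hyU)
      exact Set.disjoint_left.1 hUV hz' hz
    exact ⟨U, hU, hxU rfl, hUO, (ih hd).of_isEmbedding (IsEmbedding.inclusion hsub)⟩

theorem indZero_le_of_sepLT {X : Type u} [TopologicalSpace X] [T2Space X] {n : ℕ}
    (h : SepLT (n + 1) (univ : Set X)) : indZero X ≤ n := by
  refine sInf_le fun i hi => ?_
  have hi' : n < i := by exact_mod_cast hi
  exact (h.mono hi').indZeroLT .id (subset_univ _)

theorem largeInd_le_of_sepLT {X : Type u} [TopologicalSpace X] {n : ℕ}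
    (h : SepLT (n + 1) (univ : Set X)) : largeInd X ≤ n := by
  refine sInf_le fun i hi => ?_
  have hi' : n < i := by exact_mod_cast hi
  exact (h.mono hi').largeIndLT .id (subset_univ _)

theorem le_indZero {X : Type u} [TopologicalSpace X] [T1Space X] {n : ℕ}
    (h : ¬ HasSmallInductiveDimensionLT X n) : (n : WithBot ℕ∞) ≤ indZero X := by
  refine le_sInf fun d hd => ?_
  by_contra hdn
  exact h (hd n (not_le.1 hdn)).hasSmallInductiveDimensionLT

theorem le_largeInd {X : Type u} [TopologicalSpace X] [T1Space X] {n : ℕ}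
    (h : ¬ HasSmallInductiveDimensionLT X n) : (n : WithBot ℕ∞) ≤ largeInd X := by
  refine le_sInf fun d hd => ?_
  by_contra hdn
  exact h (hd n (not_le.1 hdn)).hasSmallInductiveDimensionLT

/-! ### Spaces with finite spheres and fully closed sequences -/

/-- A metric space all of whose spheres of positive radius are finite. For compact spaces this is
a convenient way to ensure that disjoint closed sets are separated by finite sets. -/
def HasFiniteSpheres (M : Type u) [MetricSpace M] : Prop :=
  ∀ (x : M) (r : ℝ), 0 < r → {y | dist y x = r}.Finite

theorem HasFiniteSpheres.exists_separation {M : Type u} [MetricSpace M] [CompactSpace M]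
    (hM : HasFiniteSpheres M) {A B : Set M} (hA : IsClosed A) (hB : IsClosed B)
    (hAB : Disjoint A B) :
    ∃ P Q : Set M, IsOpen P ∧ IsOpen Q ∧ Disjoint P Q ∧ A ⊆ P ∧ B ⊆ Q ∧ (P ∪ Q)ᶜ.Finite := by
  have hr : ∀ a ∈ A, ∃ r > 0, Disjoint (Metric.closedBall a r) B := fun a ha => by
    obtain ⟨r, hr, h⟩ := Metric.nhds_basis_closedBall.mem_iff.1
      (hB.isOpen_compl.mem_nhds (Set.disjoint_left.1 hAB ha))
    exact ⟨r, hr, Set.disjoint_left.2 fun x hx => h hx⟩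
  choose! r hr hrB using hr
  obtain ⟨t, htA, ht⟩ := hA.isCompact.elim_nhds_subcover (fun a => Metric.ball a (r a))
    fun a ha => Metric.ball_mem_nhds a (hr a ha)
  refine ⟨⋃ a ∈ t, Metric.ball a (r a), (⋃ a ∈ t, Metric.closedBall a (r a))ᶜ,
    isOpen_biUnion fun a _ => Metric.isOpen_ball,
    (t.finite_toSet.isClosed_biUnion fun a _ => Metric.isClosed_closedBall).isOpen_compl, ?_, ht,
    ?_, ?_⟩
  · rw [Set.disjoint_left]
    intro x hx hx'
    obtain ⟨a, ha, hxa⟩ := mem_iUnion₂.1 hx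
    exact hx' (mem_iUnion₂.2 ⟨a, ha, Metric.ball_subset_closedBall hxa⟩)
  · intro x hx hx'
    obtain ⟨a, ha, hxa⟩ := mem_iUnion₂.1 hx'
    exact Set.disjoint_left.1 (hrB a (htA a ha)) hxa hx
  · refine (t.finite_toSet.biUnion fun a ha => hM a (r a) (hr a (htA a ha))).subset fun x hx => ?_
    rw [compl_union, compl_compl] at hx
    obtain ⟨a, ha, hxa⟩ := mem_iUnion₂.1 hx.2
    refine mem_iUnion₂.2 ⟨a, ha, le_antisymm hxa ?_⟩
    by_contra h
    exact hx.1 (mem_iUnion₂.2 ⟨a, ha, not_le.1 h⟩)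

theorem HasFiniteSpheres.exists_finiteSplitting {M : Type u} [MetricSpace M] [CompactSpace M]
    (hM : HasFiniteSpheres M) {X : Type v} [TopologicalSpace X] {Z : Set X} (hZ : IsClosed Z)
    (e : Z ≃ₜ M) {A B : Set X} (hA : IsClosed A) (hB : IsClosed B) (hAB : Disjoint A B) :
    ∃ P Q E, FiniteSplitting Z A B P Q E := by
  have hcl : ∀ {C : Set X}, IsClosed C → IsClosed (e '' (Subtype.val ⁻¹' C)) := fun hC =>
    e.isClosedMap _ (hC.preimage continuous_subtype_val)
  obtain ⟨P, Q, hP, hQ, hPQ, hAP, hBQ, hE⟩ := hM.exists_separation (hcl hA) (hcl hB)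
    ((hAB.preimage _).image e.injective.injOn (subset_univ _) (subset_univ _))
  set j : M → X := fun a => (e.symm a : X) with hj
  have hji : Function.Injective j := Subtype.val_injective.comp e.symm.injective
  have hjc : IsClosedMap j := hZ.isClosedEmbedding_subtypeVal.isClosedMap.comp e.symm.isClosedMap
  have hjZ : ∀ x (hx : x ∈ Z), j (e ⟨x, hx⟩) = x := fun x hx => by simp [hj]
  have hPE : P ∪ (P ∪ Q)ᶜ = Qᶜ := by
    ext x
    have : x ∈ P → x ∈ Q → False := fun h1 h2 => Set.disjoint_left.1 hPQ h1 h2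
    simp only [mem_union, mem_compl_iff]; tauto
  have hQE : Q ∪ (P ∪ Q)ᶜ = Pᶜ := by
    ext x
    have : x ∈ P → x ∈ Q → False := fun h1 h2 => Set.disjoint_left.1 hPQ h1 h2
    simp only [mem_union, mem_compl_iff]; tauto
  have hdis : ∀ {R R' : Set M}, Disjoint R R' → Disjoint (j '' R) (j '' R') := fun h =>
    (disjoint_image_iff hji).2 h
  refine ⟨j '' P, j '' Q, j '' (P ∪ Q)ᶜ, ?_, hE.image j, ?_, ?_, hdis hPQ,
    hdis (disjoint_compl_right.mono_left subset_union_left),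
    hdis (disjoint_compl_right.mono_left subset_union_right), ?_, ?_⟩
  · rw [← image_union, ← image_union, union_compl_self]
    ext x
    constructor
    · exact fun hx => ⟨_, mem_univ _, hjZ x hx⟩
    · rintro ⟨a, -, rfl⟩; exact (e.symm a).2
  · rw [← image_union, hPE]; exact hjc _ hQ.isClosed_compl
  · rw [← image_union, hQE]; exact hjc _ hP.isClosed_compl
  · rintro x ⟨hxA, hxZ⟩
    exact ⟨_, hAP ⟨⟨x, hxZ⟩, hxA, rfl⟩, hjZ x hxZ⟩
  · rintro x ⟨hxA, hxZ⟩
    exact ⟨_, hBQ ⟨⟨x, hxZ⟩, hxA, rfl⟩, hjZ x hxZ⟩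

theorem IsFullyClosedMap.finite_inter_image {X : Type u} {Y : Type v} [TopologicalSpace X]
    [TopologicalSpace Y] [CompactSpace Y] {f : X → Y} (hf : IsFullyClosedMap f) {F G : Set X}
    (hF : IsClosed F) (hG : IsClosed G) (hFG : Disjoint F G) : (f '' F ∩ f '' G).Finite := by
  have hc : IsCompact (f '' F ∩ f '' G) :=
    ((hf.isClosedMap F hF).inter (hf.isClosedMap G hG)).isCompact
  have := hf.discrete F G hF hG hFG
  exact hc.finite ⟨this⟩

theorem IsFullyClosedMap.of_finite {X : Type u} {Y : Type v} [TopologicalSpace X]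
    [CompactSpace X] [TopologicalSpace Y] [T2Space Y] {f : X → Y} (hf : Continuous f)
    (hfin : ∀ F G : Set X, IsClosed F → IsClosed G → Disjoint F G → (f '' F ∩ f '' G).Finite) :
    IsFullyClosedMap f where
  continuous := hf
  isClosedMap := hf.isClosedMap
  discrete F G hF hG hFG := by
    have : Finite ↥(f '' F ∩ f '' G) := hfin F G hF hG hFG
    infer_instance

/-- `Ind₀ X n ≤ n` along a fully closed sequence whose fibres have finite spheres. -/
theorem IsFullyClosedSequence.sepLT {M : Type v} [MetricSpace M] [CompactSpace M]
    (hM : HasFiniteSpheres M) {X : ℕ → Type u} [∀ n, TopologicalSpace (X n)]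
    {f : ∀ n, X (n + 1) → X n} (h : IsFullyClosedSequence M X f) {n : ℕ} (hn : 1 ≤ n) :
    SepLT (n + 1) (univ : Set (X n)) := by
  induction n, hn using Nat.le_induction with
  | base =>
    have := h.compact 1 le_rfl
    have := h.t2 1 le_rfl
    have := h.firstCountable 1 le_rfl
    obtain ⟨e⟩ := h.base
    -- the first space is treated as the domain of a fully closed map onto a point
    have := SepLT.of_fullyClosed (f := fun _ : X 1 => PUnit.unit.{1}) continuous_const
      (fun F G _ _ _ => toFinite _) (fun y A B hA hB hAB =>
        hM.exists_finiteSplitting (isClosed_singleton.preimage continuous_const)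
          ((Homeomorph.setCongr (by ext; simp)).trans ((Homeomorph.Set.univ (X 1)).trans e))
          hA hB hAB) (m := 0) isClosed_univ isClosed_univ (subset_univ _)
      (SepLT.of_finite (toFinite _) le_rfl)
    exact this
  | succ n hn ih =>
    have := h.compact n hn
    have := h.t2 n hn
    have := h.firstCountable n hn
    have := h.compact (n + 1) (by omega)
    have := h.t2 (n + 1) (by omega)
    have := h.firstCountable (n + 1) (by omega)
    have hf := h.fullyClosed n hn
    exact SepLT.of_fullyClosed hf.continuous (fun F G => hf.finite_inter_image)
      (fun y A B hA hB hAB => by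
        obtain ⟨e⟩ := h.fiber n hn y
        exact hM.exists_finiteSplitting (isClosed_singleton.preimage hf.continuous) e hA hB hAB)
      isClosed_univ isClosed_univ (subset_univ _) ih

theorem IsFullyClosedSequence.dimensions {M : Type v} [MetricSpace M] [CompactSpace M]
    (hM : HasFiniteSpheres M) {X : ℕ → Type u} [∀ n, TopologicalSpace (X n)]
    {f : ∀ n, X (n + 1) → X n} (h : IsFullyClosedSequence M X f) {n : ℕ} (hn : 1 ≤ n) :
    indZero (X n) ≤ n ∧
      (smallInductiveDimension (X n) = n → largeInd (X n) = n ∧ indZero (X n) = n) := by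
  have := h.t2 n hn
  have hs := h.sepLT hM hn
  refine ⟨indZero_le_of_sepLT hs, fun hi => ?_⟩
  have hn' : ¬ HasSmallInductiveDimensionLT (X n) n := by
    rw [← smallInductiveDimension_lt_iff, hi]
    exact lt_irrefl _
  exact ⟨le_antisymm (largeInd_le_of_sepLT hs) (le_largeInd hn'),
    le_antisymm (indZero_le_of_sepLT hs) (le_indZero hn')⟩

/-- A lower bound for `ind` determines the three inductive dimensions. -/
theorem IsFullyClosedSequence.dimensions_eq {M : Type v} [MetricSpace M] [CompactSpace M]
    (hM : HasFiniteSpheres M) {X : ℕ → Type u} [∀ n, TopologicalSpace (X n)]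
    {f : ∀ n, X (n + 1) → X n} (h : IsFullyClosedSequence M X f) {n : ℕ} (hn : 1 ≤ n)
    (hi : ¬ HasSmallInductiveDimensionLT (X n) n) :
    smallInductiveDimension (X n) = n ∧ largeInd (X n) = n ∧ indZero (X n) = n := by
  have := h.t2 n hn
  have hs := h.sepLT hM hn
  have hd : smallInductiveDimension (X n) = n := smallInductiveDimension_eq n
    (hs.indZeroLT .id (subset_univ _)).hasSmallInductiveDimensionLT hi
  exact ⟨hd, (h.dimensions hM hn).2 hd⟩

/-! ### Resolving maps -/

/-- The properties of the metric space `M` and of the map `g : (0, ∞) → M` on which the study of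
`ResolutionTower g n` rests: `g` is surjective, invariant under doubling, and near each `r > 0` it
multiplies the distance to `r` by powers of two; `M` is geodesic with finite spheres, and distance
functions are locally isometric away from their base points. -/
structure IsResolving {M : Type u} [MetricSpace M] (g : ℝ → M) : Prop where
  mul_two : ∀ r, 0 < r → g (2 * r) = g r
  surj : ∀ a, ∃ r, 0 < r ∧ g r = a
  similar : ∀ r, 0 < r → ∃ K : ℤ, ∀ᶠ s in 𝓝 r, s ≠ r →
    ∃ k ≤ K, dist (g s) (g r) = (2 : ℝ) ^ k * |s - r|
  geodesic : ∀ (x y : M) (r : ℝ), 0 ≤ r → r ≤ dist x y →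
    ∃ z, dist z x = r ∧ dist z y = dist x y - r
  fold : ∀ x s : M, s ≠ x → ∀ᶠ t in 𝓝 s, |dist t x - dist s x| = dist t s
  finiteSpheres : HasFiniteSpheres M

namespace IsResolving

variable {M : Type u} [MetricSpace M] {g : ℝ → M}

theorem zpow_mul (hg : IsResolving g) (k : ℤ) {r : ℝ} (hr : 0 < r) : g (2 ^ k * r) = g r := by
  induction k using Int.induction_on with
  | zero => simp
  | succ k ih =>
    rw [zpow_add_one₀ two_ne_zero, mul_comm _ (2 : ℝ), mul_assoc, hg.mul_two _ (by positivity), ih]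
  | pred k ih =>
    rw [← ih, ← hg.mul_two (2 ^ (-(k : ℤ) - 1) * r) (by positivity), ← mul_assoc,
      ← zpow_one_add₀ two_ne_zero]
    congr 3
    ring

theorem tendsto (hg : IsResolving g) {r : ℝ} (hr : 0 < r) : Tendsto g (𝓝 r) (𝓝 (g r)) := by
  obtain ⟨K, hK⟩ := hg.similar r hr
  rw [tendsto_iff_dist_tendsto_zero]
  have h1 : Tendsto (fun s => (2 : ℝ) ^ K * |s - r|) (𝓝 r) (𝓝 0) := by
    have : Continuous fun s : ℝ => (2 : ℝ) ^ K * |s - r| := by fun_prop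
    simpa using this.tendsto r
  refine squeeze_zero' (Eventually.of_forall fun _ => dist_nonneg) ?_ h1
  filter_upwards [hK] with s hs
  by_cases h : s = r
  · simp [h]
  · obtain ⟨k, hk, hd⟩ := hs h
    rw [hd]
    gcongr
    norm_num

theorem tendsto_dist (hg : IsResolving g) {x s : M} (hs : s ≠ x) :
    Tendsto (fun t => g (dist t x)) (𝓝 s) (𝓝 (g (dist s x))) :=
  (hg.tendsto (dist_pos.2 hs)).comp ((continuous_id.dist continuous_const).tendsto s)

theorem eventually_similar (hg : IsResolving g) {x s : M} (hs : s ≠ x) :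
    ∀ᶠ t in 𝓝 s, t ≠ s → ∃ k : ℤ, dist (g (dist t x)) (g (dist s x)) = 2 ^ k * dist t s := by
  obtain ⟨K, hK⟩ := hg.similar _ (dist_pos.2 hs)
  have hc : Tendsto (fun t => dist t x) (𝓝 s) (𝓝 (dist s x)) :=
    (continuous_id.dist continuous_const).tendsto s
  filter_upwards [hc.eventually hK, hg.fold x s hs] with t h1 h2 hts
  obtain ⟨k, -, hk⟩ := h1 (fun h => by
    rw [h, sub_self, abs_zero] at h2
    exact hts (dist_eq_zero.1 h2.symm))
  exact ⟨k, by rw [hk, h2]⟩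

/-- Self-similarity: looking at `s` from `x` through `g` does not change what is seen near `s`. -/
theorem eventually_dist (hg : IsResolving g) {x s : M} (hs : s ≠ x) :
    ∀ᶠ t in 𝓝 s, t ≠ s → g (dist t x) ≠ g (dist s x) ∧
      g (dist (g (dist t x)) (g (dist s x))) = g (dist t s) := by
  filter_upwards [hg.eventually_similar hs] with t ht hts
  obtain ⟨k, hk⟩ := ht hts
  have hd : 0 < dist t s := dist_pos.2 hts
  refine ⟨fun h => ?_, by rw [hk, hg.zpow_mul k hd]⟩
  rw [h, dist_self] at hk
  have : (0 : ℝ) < 2 ^ k * dist t s := by positivity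
  linarith

end IsResolving

/-! ### The topology of the iterated resolutions -/

namespace ResolutionTower

variable {M : Type u} {g : ℝ → M} {n : ℕ}

/-- The first coordinate. -/
def head (p : ResolutionTower g (n + 1)) : M := p 0

/-- All coordinates but the first. -/
def tail (p : ResolutionTower g (n + 1)) : ResolutionTower g n := fun i => p i.succ

/-- The point `(x, w)`. -/
def cons (x : M) (w : ResolutionTower g n) : ResolutionTower g (n + 1) := Fin.cons x w

@[simp] theorem head_cons (x : M) (w : ResolutionTower g n) : (cons x w).head = x := rfl

@[simp] theorem tail_cons (x : M) (w : ResolutionTower g n) : (cons x w).tail = w := rfl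

@[simp] theorem cons_head_tail (p : ResolutionTower g (n + 1)) : cons p.head p.tail = p :=
  Fin.cons_self_tail p

theorem ext_head_tail {p q : ResolutionTower g (n + 1)} (h : p.head = q.head)
    (h' : p.tail = q.tail) : p = q := by
  rw [← cons_head_tail p, h, h', cons_head_tail]

instance : Subsingleton (ResolutionTower g 0) := inferInstanceAs (Subsingleton (Fin 0 → M))

theorem bonding_cons (x : M) (w : ResolutionTower g (n + 1)) :
    bonding g (n + 1) (cons x w) = cons x (bonding g n w) :=
  ext_head_tail rfl rfl

theorem nonempty [Nonempty M] (n : ℕ) : Nonempty (ResolutionTower g n) :=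
  inferInstanceAs (Nonempty (Fin n → M))

variable [MetricSpace M]

/-- The point `(g (dist p₀ x), p₁, …, pₙ₋₁)`. -/
def push (x : M) (p : ResolutionTower g (n + 1)) : ResolutionTower g n := resolutionPush g x p

open Classical in
/-- The retraction of the tower onto its fibre `{x} × Mⁿ` (identified with `Mⁿ`). A basic
neighbourhood of `(x, w)` consists of the points with first coordinate close to `x` that this
retraction sends close to `w`. -/
noncomputable def retr (x : M) (p : ResolutionTower g (n + 1)) : ResolutionTower g n :=
  if p.head = x then p.tail else p.push x

theorem retr_of_head_eq {x : M} {p : ResolutionTower g (n + 1)} (h : p.head = x) :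
    p.retr x = p.tail := if_pos h

theorem retr_of_head_ne {x : M} {p : ResolutionTower g (n + 1)} (h : p.head ≠ x) :
    p.retr x = p.push x := if_neg h

@[simp] theorem retr_cons (x : M) (w : ResolutionTower g n) : (cons x w).retr x = w :=
  retr_of_head_eq rfl

@[simp] theorem head_push (x : M) (p : ResolutionTower g (n + 2)) :
    (p.push x).head = g (dist p.head x) := rfl

theorem tail_push (x : M) (p : ResolutionTower g (n + 2)) :
    (p.push x).tail = bonding g n p.tail := by
  funext i
  simp only [tail, push, resolutionPush, bonding]
  rw [if_neg (by simp)]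
  rfl

theorem bonding_push (x : M) (p : ResolutionTower g (n + 2)) :
    bonding g n (p.push x) = (bonding g (n + 1) p).push x := by
  funext i
  rcases n with _ | n
  · exact i.elim0
  · rfl

theorem push_congr {x : M} {p q : ResolutionTower g (n + 1)} (h : bonding g n p = bonding g n q) :
    p.push x = q.push x := by
  rcases n with _ | n
  · exact Subsingleton.elim _ _
  · funext i
    have h0 : p 0 = q 0 := congr_fun h 0
    have hi : p i.castSucc = q i.castSucc := congr_fun h i
    simp only [push, resolutionPush, h0, hi]

theorem isOpen_succ_iff {O : Set (ResolutionTower g (n + 1))} :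
    IsOpen O ↔ ∀ q ∈ O, ∃ ε > 0, ∃ W : Set (ResolutionTower g n), IsOpen W ∧ q.tail ∈ W ∧
      ∀ p : ResolutionTower g (n + 1), dist p.head q.head < ε → p.retr q.head ∈ W → p ∈ O := by
  have key : IsOpen O ↔ ∀ q ∈ O, ∃ ε > 0, ∃ W : Set (ResolutionTower g n), IsOpen W ∧ q.tail ∈ W ∧
      ∀ p : ResolutionTower g (n + 1), (p.head = q.head ∧ p.tail ∈ W) ∨
        (0 < dist p.head q.head ∧ dist p.head q.head < ε ∧ p.push q.head ∈ W) → p ∈ O := Iff.rfl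
  rw [key]
  refine forall₂_congr fun q _ => exists_congr fun ε => and_congr_right fun hε =>
    exists_congr fun W => and_congr_right fun _ => and_congr_right fun _ => ?_
  constructor
  · intro h p hp hpW
    by_cases hpq : p.head = q.head
    · rw [retr_of_head_eq hpq] at hpW
      exact h p (Or.inl ⟨hpq, hpW⟩)
    · rw [retr_of_head_ne hpq] at hpW
      exact h p (Or.inr ⟨dist_pos.2 hpq, hp, hpW⟩)
  · rintro h p (⟨hpq, hpW⟩ | ⟨hpq, hp, hpW⟩)
    · refine h p ?_ ?_
      · rw [hpq, dist_self]; exact hε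
      · rw [retr_of_head_eq hpq]; exact hpW
    · refine h p hp ?_
      rw [retr_of_head_ne (dist_pos.1 hpq)]; exact hpW

theorem continuous_head : Continuous (head : ResolutionTower g (n + 1) → M) := by
  rw [continuous_def]
  intro V hV
  rw [isOpen_succ_iff]
  intro q hq
  obtain ⟨ε, hε, h⟩ := Metric.isOpen_iff.1 hV _ hq
  exact ⟨ε, hε, univ, isOpen_univ, mem_univ _, fun p hp _ => h hp⟩

theorem continuous_bonding : Continuous (bonding g n) := by
  induction n with
  | zero => exact continuous_of_const fun _ _ => Subsingleton.elim _ _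
  | succ n ih =>
    rw [continuous_def]
    intro O hO
    rw [isOpen_succ_iff] at hO ⊢
    intro q hq
    obtain ⟨ε, hε, W, hW, hqW, h⟩ := hO _ hq
    refine ⟨ε, hε, bonding g n ⁻¹' W, hW.preimage ih, hqW, fun p hp hpW => h _ hp ?_⟩
    by_cases hpq : p.head = q.head
    · rw [retr_of_head_eq hpq] at hpW
      rw [retr_of_head_eq (by exact hpq)]
      exact hpW
    · rw [retr_of_head_ne hpq, mem_preimage, bonding_push] at hpW
      rwa [retr_of_head_ne (by exact hpq)]

/-- The retractions onto the fibres of the first coordinate are continuous; this is where the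
self-similarity of `g` is used. -/
theorem continuous_retr (hg : IsResolving g) (x : M) :
    Continuous (retr x : ResolutionTower g (n + 1) → ResolutionTower g n) := by
  rw [continuous_def]
  intro W hW
  rw [isOpen_succ_iff]
  intro q hq
  by_cases hqx : q.head = x
  · subst hqx
    refine ⟨1, one_pos, W, hW, ?_, fun p _ hp => hp⟩
    rw [mem_preimage, retr_of_head_eq rfl] at hq
    exact hq
  rcases n with _ | n
  · exact ⟨1, one_pos, univ, isOpen_univ, mem_univ _, fun p _ _ => by
      rw [mem_preimage, Subsingleton.elim (p.retr x) (q.retr x)]; exact hq⟩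
  rw [mem_preimage, retr_of_head_ne hqx] at hq
  obtain ⟨ε, hε, W', hW', hqW', h⟩ := isOpen_succ_iff.1 hW _ hq
  obtain ⟨δ, hδ, hd⟩ := Metric.eventually_nhds_iff.1 ((((hg.tendsto_dist hqx).eventually
    (Metric.ball_mem_nhds _ hε)).and (hg.eventually_dist hqx)).and (isOpen_ne.mem_nhds hqx))
  refine ⟨δ, hδ, bonding g n ⁻¹' W', hW'.preimage continuous_bonding, ?_, fun p hp hpW => ?_⟩
  · rwa [tail_push] at hqW'
  · obtain ⟨⟨h1, h2⟩, h3⟩ := hd hp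
    rw [mem_preimage, retr_of_head_ne h3]
    refine h _ h1 ?_
    by_cases hpq : p.head = q.head
    · rw [retr_of_head_eq hpq] at hpW
      rw [retr_of_head_eq (by rw [head_push, head_push, hpq]), tail_push]
      exact hpW
    · obtain ⟨h4, h5⟩ := h2 hpq
      rw [retr_of_head_ne hpq, mem_preimage, bonding_push] at hpW
      rw [retr_of_head_ne (by exact h4)]
      convert hpW using 1
      rcases n with _ | n
      · exact Subsingleton.elim _ _
      · refine ext_head_tail ?_ ?_
        · rw [head_push, head_push, head_push, head_push, h5]; rfl
        · rw [tail_push, tail_push, tail_push]; rfl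

theorem nhds_eq (hg : IsResolving g) (q : ResolutionTower g (n + 1)) :
    𝓝 q = comap head (𝓝 q.head) ⊓ comap (retr q.head) (𝓝 q.tail) := by
  apply le_antisymm
  · refine le_inf (continuous_head.tendsto q).le_comap ?_
    have := (continuous_retr hg q.head).tendsto q
    rw [retr_of_head_eq rfl] at this
    exact this.le_comap
  · rw [le_nhds_iff]
    intro O hq hO
    obtain ⟨ε, hε, W, hW, hqW, h⟩ := isOpen_succ_iff.1 hO q hq
    refine mem_of_superset (inter_mem_inf (preimage_mem_comap (Metric.ball_mem_nhds _ hε))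
      (preimage_mem_comap (hW.mem_nhds hqW))) fun p hp => h p hp.1 hp.2

theorem tendsto_nhds_iff (hg : IsResolving g) {α : Type*} {l : Filter α}
    {F : α → ResolutionTower g (n + 1)} {q : ResolutionTower g (n + 1)} :
    Tendsto F l (𝓝 q) ↔ Tendsto (fun a => (F a).head) l (𝓝 q.head) ∧
      Tendsto (fun a => (F a).retr q.head) l (𝓝 q.tail) := by
  rw [nhds_eq hg, tendsto_inf, tendsto_comap_iff, tendsto_comap_iff]
  rfl

theorem continuous_cons (hg : IsResolving g) (x : M) :
    Continuous (cons x : ResolutionTower g n → ResolutionTower g (n + 1)) := by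
  rw [continuous_iff_continuousAt]
  intro w
  rw [ContinuousAt, tendsto_nhds_iff hg]
  simp only [head_cons, tail_cons, retr_cons]
  exact ⟨tendsto_const_nhds, tendsto_id⟩

theorem firstCountableTopology (hg : IsResolving g) (n : ℕ) :
    FirstCountableTopology (ResolutionTower g n) := by
  induction n with
  | zero => infer_instance
  | succ n ih =>
    refine ⟨fun q => ?_⟩
    rw [nhds_eq hg]
    infer_instance

theorem t2Space (hg : IsResolving g) (n : ℕ) : T2Space (ResolutionTower g n) := by
  induction n with
  | zero => infer_instance
  | succ n ih =>
    refine T2Space.of_injective_continuous (Y := M × ∀ _ : M, ResolutionTower g n)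
      (f := fun p => (p.head, fun x => p.retr x)) ?_
      (continuous_head.prodMk (continuous_pi fun x => continuous_retr hg x))
    intro p q hpq
    have h0 : p.head = q.head := congr_arg Prod.fst hpq
    have h1 : p.retr q.head = q.retr q.head := congr_fun (congr_arg Prod.snd hpq) q.head
    rw [retr_of_head_eq h0, retr_of_head_eq rfl] at h1
    exact ext_head_tail h0 h1

theorem compactSpace [CompactSpace M] (hg : IsResolving g) (n : ℕ) :
    CompactSpace (ResolutionTower g n) := by
  induction n with
  | zero => infer_instance
  | succ n ih =>
    refine ⟨isCompact_iff_ultrafilter_le_nhds.2 fun 𝒰 _ => ?_⟩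
    obtain ⟨x, -, hx⟩ := isCompact_iff_ultrafilter_le_nhds.1 (isCompact_univ (X := M))
      (𝒰.map head) (by simp)
    obtain ⟨w, -, hw⟩ := isCompact_iff_ultrafilter_le_nhds.1
      (isCompact_univ (X := ResolutionTower g n)) (𝒰.map (retr x)) (by simp)
    exact ⟨cons x w, mem_univ _, (tendsto_nhds_iff hg (F := id)).2 ⟨hx, hw⟩⟩

theorem connectedSpace [CompactSpace M] [ConnectedSpace M] (hg : IsResolving g) (n : ℕ) :
    ConnectedSpace (ResolutionTower g n) := by
  induction n with
  | zero =>
    have := nonempty (g := g) 0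
    exact { toPreconnectedSpace := inferInstance, toNonempty := this }
  | succ n ih =>
    have := compactSpace hg (n + 1)
    have hcl : IsClosedMap (head : ResolutionTower g (n + 1) → M) := continuous_head.isClosedMap
    have hfib : ∀ x : M, (head : ResolutionTower g (n + 1) → M) ⁻¹' {x} = range (cons x) := by
      intro x
      ext p
      constructor
      · intro hp
        exact ⟨p.tail, by rw [← show p.head = x from hp, cons_head_tail]⟩
      · rintro ⟨w, rfl⟩; rfl
    have hq : IsQuotientMap (head : ResolutionTower g (n + 1) → M) :=
      hcl.isQuotientMap continuous_head fun x => by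
        obtain ⟨w⟩ := ih.toNonempty
        exact ⟨cons x w, rfl⟩
    have h := hq.preimage_connectedComponent (fun x => by
      rw [hfib]; exact isConnected_range (continuous_cons hg x))
    have := nonempty (g := g) (n + 1)
    obtain ⟨p⟩ := this
    refine { toPreconnectedSpace := ?_, toNonempty := ⟨p⟩ }
    rw [preconnectedSpace_iff_connectedComponent]
    intro q
    rw [← h, PreconnectedSpace.connectedComponent_eq_univ, preimage_univ]

theorem isContinuum [CompactSpace M] [ConnectedSpace M] (hg : IsResolving g) (n : ℕ) :
    IsContinuum (ResolutionTower g n) :=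
  ⟨compactSpace hg n, t2Space hg n, connectedSpace hg n⟩

end ResolutionTower

/-! ### The bonding maps -/

namespace IsResolving

variable {M : Type u} [MetricSpace M] {g : ℝ → M}

theorem exists_small_radius (hg : IsResolving g) (a : M) {ε : ℝ} (hε : 0 < ε) :
    ∃ r, 0 < r ∧ r < ε ∧ g r = a := by
  obtain ⟨r, hr, rfl⟩ := hg.surj a
  obtain ⟨k, hk⟩ := exists_pow_lt_of_lt_one (div_pos hε hr) (by norm_num : (2 : ℝ)⁻¹ < 1)
  refine ⟨2 ^ (-k : ℤ) * r, by positivity, ?_, hg.zpow_mul _ hr⟩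
  rw [zpow_neg, zpow_natCast, ← inv_pow]
  exact (lt_div_iff₀ hr).1 hk

theorem exists_dist_eq [ConnectedSpace M] [Nontrivial M] (hg : IsResolving g) (x : M) :
    ∃ δ > 0, ∀ r, 0 ≤ r → r < δ → ∃ y, dist y x = r := by
  obtain ⟨y, hy⟩ := exists_ne x
  refine ⟨dist x y, dist_pos.2 hy.symm, fun r hr hrd => ?_⟩
  obtain ⟨z, hz, -⟩ := hg.geodesic x y r hr hrd.le
  exact ⟨z, hz⟩

theorem exists_near [ConnectedSpace M] [Nontrivial M] (hg : IsResolving g) (x a : M) {ε : ℝ}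
    (hε : 0 < ε) : ∃ y, y ≠ x ∧ dist y x < ε ∧ g (dist y x) = a := by
  obtain ⟨δ, hδ, h⟩ := hg.exists_dist_eq x
  obtain ⟨r, hr, hrd, hra⟩ := hg.exists_small_radius a (lt_min hε hδ)
  obtain ⟨y, hy⟩ := h r hr.le (hrd.trans_le (min_le_right _ _))
  exact ⟨y, dist_pos.1 (hy ▸ hr), hy ▸ hrd.trans_le (min_le_left _ _), hy ▸ hra⟩

end IsResolving

namespace ResolutionTower

variable {M : Type u} {g : ℝ → M} {n : ℕ}

/-- The point `(t, a)` of the fibre of the bonding map over `t`. -/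
def snoc : {n : ℕ} → ResolutionTower g n → M → ResolutionTower g (n + 1)
  | 0, t, a => cons a t
  | _ + 1, t, a => cons t.head (snoc t.tail a)

theorem bonding_snoc (t : ResolutionTower g n) (a : M) : bonding g n (snoc t a) = t := by
  induction n with
  | zero => exact Subsingleton.elim _ _
  | succ n ih =>
    rw [snoc, bonding_cons, ih, cons_head_tail]

theorem snoc_injective (t : ResolutionTower g n) :
    Function.Injective (snoc t : M → ResolutionTower g (n + 1)) := by
  induction n with
  | zero => exact fun a b h => congr_arg head h
  | succ n ih => exact fun a b h => ih t.tail (congr_arg tail h)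

theorem exists_eq_snoc (p : ResolutionTower g (n + 1)) : ∃ a, p = snoc (bonding g n p) a := by
  induction n with
  | zero => exact ⟨p.head, ext_head_tail rfl (Subsingleton.elim _ _)⟩
  | succ n ih =>
    obtain ⟨a, ha⟩ := ih p.tail
    exact ⟨a, ext_head_tail rfl ha⟩

theorem range_snoc (t : ResolutionTower g n) : range (snoc t) = bonding g n ⁻¹' {t} := by
  ext p
  constructor
  · rintro ⟨a, rfl⟩; exact bonding_snoc t a
  · intro hp
    obtain ⟨a, ha⟩ := exists_eq_snoc p
    rw [show bonding g n p = t from hp] at ha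
    exact ⟨a, ha.symm⟩

variable [MetricSpace M]

/-- A neighbourhood of a fibre `{x} × Mⁿ` is controlled by the retraction onto this fibre. -/
theorem exists_tube [CompactSpace M] (hg : IsResolving g) (x : M)
    (𝒰 : Set (Set (ResolutionTower g (n + 1)))) (ho : ∀ U ∈ 𝒰, IsOpen U) (hc : ⋃₀ 𝒰 = univ) :
    ∃ ε > 0, ∃ 𝒲 : Set (Set (ResolutionTower g n)), 𝒲.Finite ∧ (∀ W ∈ 𝒲, IsOpen W) ∧
      ⋃₀ 𝒲 = univ ∧ ∀ W ∈ 𝒲, ∃ U ∈ 𝒰, ∀ p : ResolutionTower g (n + 1),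
        dist p.head x < ε → p.retr x ∈ W → p ∈ U := by
  have h : ∀ w : ResolutionTower g n, ∃ U ∈ 𝒰, ∃ ε > 0, ∃ W : Set (ResolutionTower g n),
      IsOpen W ∧ w ∈ W ∧ ∀ p : ResolutionTower g (n + 1), dist p.head x < ε → p.retr x ∈ W →
        p ∈ U := by
    intro w
    obtain ⟨U, hU, hw⟩ : cons x w ∈ ⋃₀ 𝒰 := hc ▸ mem_univ _
    exact ⟨U, hU, isOpen_succ_iff.1 (ho U hU) _ hw⟩
  choose U hU ε hε W hW hwW h using h
  have := compactSpace hg n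
  obtain ⟨t, ht⟩ := isCompact_univ.elim_finite_subcover W hW fun w _ => mem_iUnion.2 ⟨w, hwW w⟩
  obtain ⟨δ, hδ, hδt⟩ : ∃ δ > 0, ∀ w ∈ t, δ ≤ ε w := by
    rcases t.eq_empty_or_nonempty with rfl | hne
    · exact ⟨1, one_pos, by simp⟩
    · exact ⟨t.inf' hne ε, by simpa [Finset.lt_inf'_iff] using fun w _ => hε w,
        fun w hw => Finset.inf'_le _ hw⟩
  refine ⟨δ, hδ, W '' t, t.finite_toSet.image W, ?_, ?_, ?_⟩
  · rintro _ ⟨w, -, rfl⟩; exact hW w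
  · rw [sUnion_image]; exact univ_subset_iff.1 ht
  · rintro _ ⟨w, hw, rfl⟩
    exact ⟨U w, hU w, fun p hp hpW => h w p (hp.trans_le (hδt w hw)) hpW⟩

/-- Disjoint closed sets have images with finite intersection under the bonding maps: near the
fibre over `x`, points with the same image under the bonding map have the same retraction. -/
theorem finite_inter_image_bonding [CompactSpace M] (hg : IsResolving g)
    {F G : Set (ResolutionTower g (n + 1))} (hF : IsClosed F) (hG : IsClosed G)
    (hFG : Disjoint F G) : (bonding g n '' F ∩ bonding g n '' G).Finite := by
  induction n with
  | zero => exact toFinite _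
  | succ n ih =>
    have h : ∀ x : M, ∃ ε > 0, ∀ p ∈ F, ∀ q ∈ G, bonding g (n + 1) p = bonding g (n + 1) q →
        p.head ≠ x → ¬ dist p.head x < ε := by
      intro x
      obtain ⟨ε, hε, 𝒲, -, -, hc, h⟩ := exists_tube hg x {Fᶜ, Gᶜ}
        (by rintro _ (rfl | rfl); exacts [hF.isOpen_compl, hG.isOpen_compl])
        (by rw [sUnion_pair, ← compl_inter, hFG.inter_eq, compl_empty])
      refine ⟨ε, hε, fun p hp q hq hpq hpx hd => ?_⟩
      have hh : p.head = q.head := congr_fun hpq 0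
      obtain ⟨W, hW, hpW⟩ : p.retr x ∈ ⋃₀ 𝒲 := hc ▸ mem_univ _
      have hqW : q.retr x ∈ W := by
        rw [retr_of_head_ne hpx, push_congr hpq] at hpW
        rwa [retr_of_head_ne (hh ▸ hpx)]
      obtain ⟨U, rfl | rfl, hU⟩ := h W hW
      · exact hU p hd hpW hp
      · exact hU q (hh ▸ hd) hqW hq
    choose ε hε h using h
    obtain ⟨t, ht⟩ := isCompact_univ.elim_finite_subcover (fun x => Metric.ball x (ε x))
      (fun x => Metric.isOpen_ball) fun x _ => mem_iUnion.2 ⟨x, Metric.mem_ball_self (hε x)⟩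
    refine (t.finite_toSet.biUnion fun x _ => (ih (hF.preimage (continuous_cons hg x))
      (hG.preimage (continuous_cons hg x)) (hFG.preimage _)).image (cons x)).subset ?_
    rintro y ⟨⟨p, hp, rfl⟩, q, hq, hqp⟩
    obtain ⟨x, hx, hpx⟩ := mem_iUnion₂.1 (ht (mem_univ p.head))
    have hxp : p.head = x := by
      by_contra hne
      exact h x p hp q hq hqp.symm hne hpx
    have hxq : q.head = x := hxp ▸ congr_fun hqp 0
    refine mem_iUnion₂.2 ⟨x, hx, bonding g n p.tail, ⟨⟨p.tail, ?_, rfl⟩, q.tail, ?_, ?_⟩, ?_⟩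
    · rwa [mem_preimage, ← hxp, cons_head_tail]
    · rwa [mem_preimage, ← hxq, cons_head_tail]
    · exact congr_arg tail hqp
    · exact ext_head_tail hxp.symm rfl

theorem continuous_snoc (hg : IsResolving g) (t : ResolutionTower g n) :
    Continuous (snoc t : M → ResolutionTower g (n + 1)) := by
  induction n with
  | zero =>
    rw [continuous_iff_continuousAt]
    intro a
    rw [ContinuousAt, tendsto_nhds_iff hg]
    exact ⟨tendsto_id, tendsto_const_nhds.congr fun _ => Subsingleton.elim _ _⟩
  | succ n ih => exact (continuous_cons hg _).comp (ih t.tail)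

theorem nonempty_fiber_homeomorph [CompactSpace M] (hg : IsResolving g) (t : ResolutionTower g n) :
    Nonempty (↥(bonding g n ⁻¹' {t}) ≃ₜ M) := by
  have := t2Space hg (n + 1)
  have he := ((continuous_snoc hg t).isClosedEmbedding (snoc_injective t)).isEmbedding
  exact ⟨((he.toHomeomorph).trans (Homeomorph.setCongr (range_snoc t))).symm⟩

/-- The towers satisfy the hypotheses of the bound for `Ind₀`. -/
theorem isFullyClosedSequence [CompactSpace M] [Nonempty M] (hg : IsResolving g) :
    IsFullyClosedSequence M (ResolutionTower g) (bonding g) where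
  compact n _ := compactSpace hg n
  t2 n _ := t2Space hg n
  firstCountable n _ := firstCountableTopology hg n
  base := by
    obtain ⟨t⟩ := nonempty (g := g) 0
    obtain ⟨e⟩ := nonempty_fiber_homeomorph hg t
    exact ⟨((Homeomorph.Set.univ _).symm.trans
      (Homeomorph.setCongr (by ext; simp [Subsingleton.elim _ t]))).trans e⟩
  fullyClosed n _ := by
    have := compactSpace hg (n + 1)
    have := t2Space hg n
    exact .of_finite continuous_bonding fun F G => finite_inter_image_bonding hg
  surjective n _ t := by
    obtain ⟨a⟩ := ‹Nonempty M›
    exact ⟨snoc t a, bonding_snoc t a⟩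
  fiber n _ t := nonempty_fiber_homeomorph hg t

/-! ### Full fibres in open sets -/

/-- A non-empty open set of the tower contains all points whose first coordinate lies in some
non-empty open subset of `M`. -/
theorem exists_preimage_head_subset [ConnectedSpace M] [Nontrivial M] (hg : IsResolving g)
    {O : Set (ResolutionTower g (n + 1))} (hO : IsOpen O) (hne : O.Nonempty) :
    ∃ V : Set M, IsOpen V ∧ V.Nonempty ∧ head ⁻¹' V ⊆ O := by
  induction n with
  | zero =>
    obtain ⟨q, hq⟩ := hne
    obtain ⟨ε, hε, W, -, hqW, h⟩ := isOpen_succ_iff.1 hO q hq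
    exact ⟨Metric.ball q.head ε, Metric.isOpen_ball, ⟨_, Metric.mem_ball_self hε⟩, fun p hp =>
      h p hp (by rwa [Subsingleton.elim (p.retr q.head) q.tail])⟩
  | succ n ih =>
    obtain ⟨q, hq⟩ := hne
    obtain ⟨ε, hε, W, hW, hqW, h⟩ := isOpen_succ_iff.1 hO q hq
    obtain ⟨V, hV, ⟨a, ha⟩, hVW⟩ := ih hW ⟨_, hqW⟩
    obtain ⟨y, hyq, hyd, hya⟩ := hg.exists_near q.head a hε
    have hev : ∀ᶠ t in 𝓝 y, t ≠ q.head ∧ dist t q.head < ε ∧ g (dist t q.head) ∈ V := by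
      have h1 : ∀ᶠ t in 𝓝 y, t ≠ q.head := isOpen_ne.mem_nhds hyq
      have h2 : ∀ᶠ t in 𝓝 y, dist t q.head < ε := Metric.isOpen_ball.mem_nhds hyd
      filter_upwards [h1, h2, (hg.tendsto_dist hyq).eventually (hV.mem_nhds (hya ▸ ha))] with t
        h1 h2 h3 using ⟨h1, h2, h3⟩
    obtain ⟨V', hV'sub, hV', hyV'⟩ := mem_nhds_iff.1 hev
    refine ⟨V', hV', ⟨y, hyV'⟩, fun p hp => ?_⟩
    obtain ⟨h1, h2, h3⟩ := hV'sub hp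
    refine h p h2 ?_
    rw [retr_of_head_ne h1]
    exact hVW h3

/-- Near a point `(x, w)` of an open set `U`, the full fibres over all points at certain distances
from `x` are contained in `U`. -/
theorem exists_fibers_subset [ConnectedSpace M] [Nontrivial M] (hg : IsResolving g)
    {U : Set (ResolutionTower g (n + 1))} (hU : IsOpen U) {q : ResolutionTower g (n + 1)}
    (hq : q ∈ U) :
    ∃ ε > 0, ∃ V : Set M, IsOpen V ∧ V.Nonempty ∧ ∀ p : ResolutionTower g (n + 1),
      p.head ≠ q.head → dist p.head q.head < ε → g (dist p.head q.head) ∈ V → p ∈ U := by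
  obtain ⟨ε, hε, W, hW, hqW, h⟩ := isOpen_succ_iff.1 hU q hq
  rcases n with _ | n
  · exact ⟨ε, hε, univ, isOpen_univ, univ_nonempty, fun p _ hp _ =>
      h p hp (by rwa [Subsingleton.elim (p.retr q.head) q.tail])⟩
  · obtain ⟨V, hV, hne, hVW⟩ := exists_preimage_head_subset hg hW ⟨_, hqW⟩
    refine ⟨ε, hε, V, hV, hne, fun p hpq hpd hpV => h p hpd ?_⟩
    rw [retr_of_head_ne hpq]
    exact hVW hpV

/-- Constant sequences with values in a dense subset of `M` are dense in the tower. -/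
theorem separableSpace [CompactSpace M] [ConnectedSpace M] [Nontrivial M] (hg : IsResolving g)
    (n : ℕ) : SeparableSpace (ResolutionTower g n) := by
  rcases n with _ | n
  · infer_instance
  · obtain ⟨D, hDc, hD⟩ := exists_countable_dense M
    refine ⟨(fun a : M => (fun _ => a : ResolutionTower g (n + 1))) '' D, hDc.image _, ?_⟩
    rw [dense_iff_inter_open]
    intro O hO hne
    obtain ⟨V, hV, hVne, hVO⟩ := exists_preimage_head_subset hg hO hne
    obtain ⟨a, haV, haD⟩ := hD.inter_open_nonempty V hV hVne
    exact ⟨_, hVO (show head (fun _ => a : ResolutionTower g (n + 1)) ∈ V from haV), a, haD, rfl⟩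

/-! ### The small inductive dimension of the towers -/

/-- Two disjoint non-empty open sets omit a full fibre of the first coordinate. If every fibre met
one of them, Baire's theorem, applied to the common boundary of the sets of those `x` whose fibres
lie entirely in the first and in the second of them, would give a portion of this boundary that is
surrounded, at uniform distances, by points of one of these sets only. -/
theorem exists_fiber_disjoint [CompactSpace M] [ConnectedSpace M] [Nontrivial M]
    (hg : IsResolving g) {U V : Set (ResolutionTower g (n + 1))} (hU : IsOpen U) (hV : IsOpen V)
    (hUne : U.Nonempty) (hVne : V.Nonempty) (hUV : Disjoint U V) :
    ∃ x : M, ∀ p : ResolutionTower g (n + 1), p.head = x → p ∉ U ∧ p ∉ V := by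
  by_contra hcon
  push Not at hcon
  set U' : Set M := {x | ∀ p : ResolutionTower g (n + 1), p.head = x → p ∈ U} with hU'
  set V' : Set M := {x | ∀ p : ResolutionTower g (n + 1), p.head = x → p ∈ V} with hV'
  have hne : Nonempty (ResolutionTower g n) := nonempty n
  obtain ⟨w₀⟩ := hne
  have hcs := compactSpace hg (n + 1)
  have hopen : ∀ {O : Set (ResolutionTower g (n + 1))}, IsOpen O →
      IsOpen {x | ∀ p : ResolutionTower g (n + 1), p.head = x → p ∈ O} := by
    intro O hO
    have : {x | ∀ p : ResolutionTower g (n + 1), p.head = x → p ∈ O} = (head '' Oᶜ)ᶜ := by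
      ext x
      simp only [mem_ofPred_eq, mem_compl_iff, mem_image, not_exists, not_and]
      exact forall_congr' fun p =>
        ⟨fun h h1 h2 => h1 (h h2), fun h h2 => by_contra fun h1 => h h1 h2⟩
    rw [this]
    exact (continuous_head.isClosedMap _ hO.isClosed_compl).isOpen_compl
  have hU'o : IsOpen U' := hopen hU
  have hV'o : IsOpen V' := hopen hV
  have hU'V' : Disjoint U' V' := Set.disjoint_left.2 fun x hx hx' =>
    Set.disjoint_left.1 hUV (hx (cons x w₀) rfl) (hx' (cons x w₀) rfl)
  have hcl : ∀ {O : Set (ResolutionTower g (n + 1))}, IsOpen O → ∀ q ∈ O,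
      q.head ∈ closure {x | ∀ p : ResolutionTower g (n + 1), p.head = x → p ∈ O} := by
    intro O hO q hq
    obtain ⟨ε, hε, R, hR, ⟨a, ha⟩, h⟩ := exists_fibers_subset hg hO hq
    rw [Metric.mem_closure_iff]
    intro δ hδ
    obtain ⟨y, hyq, hyd, hya⟩ := hg.exists_near q.head a (lt_min hε hδ)
    refine ⟨y, fun p hp => h p (hp ▸ hyq) (hp ▸ hyd.trans_le (min_le_left _ _))
      (by rw [hp, hya]; exact ha), ?_⟩
    rw [dist_comm]; exact hyd.trans_le (min_le_right _ _)
  have hcover : ∀ x, x ∈ closure U' ∪ closure V' := by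
    intro x
    obtain ⟨p, rfl, hp⟩ := hcon x
    by_cases hpU : p ∈ U
    · exact Or.inl (hcl hU p hpU)
    · exact Or.inr (hcl hV p (hp hpU))
  obtain ⟨c₀, -, hc₀⟩ : (univ ∩ (closure U' ∩ closure V')).Nonempty := by
    refine isPreconnected_closed_iff.1 isPreconnected_univ _ _ isClosed_closure isClosed_closure
      (fun x _ => hcover x) ?_ ?_
    · obtain ⟨q, hq⟩ := hUne; exact ⟨_, mem_univ _, hcl hU q hq⟩
    · obtain ⟨q, hq⟩ := hVne; exact ⟨_, mem_univ _, hcl hV q hq⟩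
  obtain ⟨b, hbc, hbne, hb⟩ := exists_countable_basis M
  -- the points around which the distances below `1 / (i + 1)` that `g` sends to `J` lead into `A`
  set ring : Set M → Set M → ℕ → Set M := fun A J i =>
    {c | ∀ y, dist y c < 1 / ((i : ℝ) + 1) → y ≠ c → g (dist y c) ∈ J → y ∈ A} with hring
  have hringcl : ∀ A J i, IsClosed A → IsOpen J → IsClosed (ring A J i) := by
    intro A J i hA hJ
    have : ring A J i = ⋂ y ∈ Aᶜ, {c | dist y c < 1 / ((i : ℝ) + 1) ∧ y ≠ c ∧ g (dist y c) ∈ J}ᶜ := by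
      ext c
      simp only [hring, mem_ofPred_eq, mem_iInter, mem_compl_iff]
      exact forall_congr' fun y => by tauto
    rw [this]
    refine isClosed_biInter fun y _ => IsOpen.isClosed_compl ?_
    rw [isOpen_iff_mem_nhds]
    rintro c ⟨h1, h2, h3⟩
    have e : ∀ c, dist y c = dist c y := fun c => dist_comm _ _
    simp only [e] at h1 h3 ⊢
    have h1' : ∀ᶠ z in 𝓝 c, dist z y < 1 / ((i : ℝ) + 1) := Metric.isOpen_ball.mem_nhds h1
    have h2' : ∀ᶠ z in 𝓝 c, z ≠ y := isOpen_ne.mem_nhds h2.symm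
    filter_upwards [h1', h2', (hg.tendsto_dist h2.symm).eventually (hJ.mem_nhds h3)] with z
      h1 h2 h3 using ⟨h1, h2.symm, h3⟩
  -- no portion of the boundary can have uniform rings in one of the two sets
  have hno : ∀ A B : Set M, IsClosed A → IsClosed B → (∀ x, x ∈ A ∨ x ∈ B) → ∀ J i, J.Nonempty →
      ∀ I : Set M, IsOpen I → ∀ c ∈ I, c ∈ A → c ∈ closure Aᶜ →
      (∀ x ∈ I, x ∈ A → x ∈ B → x ∈ ring A J i) → False := by
    rintro A B hA hB hAB J i ⟨j, hj⟩ I hI c hcI hcA hcB hIr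
    -- For a point `v` outside `A` near `c`, let `a` be a nearest point of `A`. The geodesic from
    -- `a` to `v` leaves `A` at once, so `a` lies in `B`, and the ring around `a` meets this
    -- geodesic outside `A`.
    obtain ⟨δ, hδ, hδI⟩ := Metric.isOpen_iff.1 hI c hcI
    obtain ⟨v, hv, hvc⟩ := Metric.mem_closure_iff.1 hcB (δ / 2) (half_pos hδ)
    obtain ⟨a, haA, hav⟩ := hA.isCompact.exists_infDist_eq_dist ⟨c, hcA⟩ v
    have hball : ∀ y, dist y v < dist v a → y ∉ A := fun y hy hyA => by
      have := Metric.infDist_le_dist_of_mem (x := v) hyA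
      rw [hav, dist_comm v y] at this
      linarith
    have hvac : dist v a ≤ dist v c := hav ▸ Metric.infDist_le_dist_of_mem hcA
    have haI : a ∈ I := hδI (by
      rw [Metric.mem_ball]
      have := dist_triangle a v c
      rw [dist_comm a v, dist_comm v c] at *
      linarith)
    have hva : 0 < dist a v := dist_pos.2 fun h => hv (h ▸ haA)
    have hpt : ∀ r, 0 < r → r ≤ dist a v → ∃ z, dist z a = r ∧ z ∉ A := by
      intro r hr hrd
      obtain ⟨z, hz, hzv⟩ := hg.geodesic a v r hr.le hrd
      exact ⟨z, hz, hball z (by rw [hzv, dist_comm v a]; linarith)⟩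
    have haB : a ∈ B := by
      rw [← hB.closure_eq, Metric.mem_closure_iff]
      intro ε hε
      obtain ⟨z, hz, hzA⟩ := hpt (min (ε / 2) (dist a v)) (lt_min (half_pos hε) hva)
        (min_le_right _ _)
      refine ⟨z, (hAB z).resolve_left hzA, ?_⟩
      rw [dist_comm, hz]
      exact (min_le_left _ _).trans_lt (half_lt_self hε)
    obtain ⟨r, hr, hrd, hrj⟩ := hg.exists_small_radius j
      (lt_min hva (by positivity : (0 : ℝ) < 1 / ((i : ℝ) + 1)))
    obtain ⟨z, hz, hzA⟩ := hpt r hr (hrd.le.trans (min_le_left _ _))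
    exact hzA (hIr a haI haA haB z (hz ▸ hrd.trans_le (min_le_right _ _))
      (dist_pos.1 (hz ▸ hr)) (by rw [hz, hrj]; exact hj))
  set C : Set M := closure U' ∩ closure V' with hC
  have hCc : IsClosed C := isClosed_closure.inter isClosed_closure
  have : CompactSpace C := isCompact_iff_compactSpace.1 hCc.isCompact
  have : Nonempty C := ⟨⟨c₀, hc₀⟩⟩
  have hpos : ∀ {O : Set (ResolutionTower g (n + 1))}, IsOpen O → ∀ q ∈ O, ∃ J ∈ b, ∃ i,
      q.head ∈ ring (closure {x | ∀ p : ResolutionTower g (n + 1), p.head = x → p ∈ O}) J i := by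
    intro O hO q hq
    obtain ⟨ε, hε, R, hR, ⟨a, ha⟩, h⟩ := exists_fibers_subset hg hO hq
    obtain ⟨J, hJ, haJ, hJR⟩ := hb.exists_subset_of_mem_open ha hR
    obtain ⟨i, hi⟩ := exists_nat_one_div_lt hε
    exact ⟨J, hJ, i, fun y hy hyq hyJ => subset_closure fun p hp =>
      h p (hp ▸ hyq) (hp ▸ hy.trans hi) (hp ▸ hJR hyJ)⟩
  have : Countable b := hbc
  -- every point of the boundary lies in one of countably many closed sets, by
  -- `exists_fibers_subset`
  obtain ⟨⟨s, J, i⟩, z, hz⟩ := nonempty_interior_of_iUnion_of_closed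
    (f := fun k : Bool × b × ℕ => (Subtype.val : C → M) ⁻¹'
      ring (closure (if k.1 then U' else V')) k.2.1 k.2.2)
    (fun k => (hringcl _ _ _ isClosed_closure (hb.isOpen k.2.1.2)).preimage continuous_subtype_val)
    (by
      rw [eq_univ_iff_forall]
      intro c
      obtain ⟨p, hpc, hp⟩ := hcon c
      rw [mem_iUnion]
      by_cases hpU : p ∈ U
      · obtain ⟨J, hJ, i, h⟩ := hpos hU p hpU
        exact ⟨(true, ⟨J, hJ⟩, i), by simpa [← hpc] using h⟩
      · obtain ⟨J, hJ, i, h⟩ := hpos hV p (hp hpU)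
        exact ⟨(false, ⟨J, hJ⟩, i), by simpa [← hpc] using h⟩)
  obtain ⟨I₀, hI₀, hI₀o, hzI₀⟩ := mem_interior.1 hz
  obtain ⟨I, hI, rfl⟩ := isOpen_induced_iff.1 hI₀o
  have hJne : (J : Set M).Nonempty := nonempty_iff_ne_empty.2 fun h => hbne (h ▸ J.2)
  have hdU : closure V' ⊆ closure (closure U')ᶜ := closure_mono fun x hx hx' =>
    Set.disjoint_left.1 (hU'V'.closure_left hV'o) hx' hx
  have hdV : closure U' ⊆ closure (closure V')ᶜ := closure_mono fun x hx hx' =>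
    Set.disjoint_left.1 (hU'V'.closure_right hU'o) hx hx'
  cases s
  · exact hno (closure V') (closure U') isClosed_closure isClosed_closure
      (fun x => (hcover x).symm) J i hJne I hI z hzI₀ z.2.2 (hdV z.2.1)
      fun x hxI hxV hxU => hI₀ (a := ⟨x, hxU, hxV⟩) hxI
  · exact hno (closure U') (closure V') isClosed_closure isClosed_closure
      hcover J i hJne I hI z hzI₀ z.2.1 (hdU z.2.2)
      fun x hxI hxU hxV => hI₀ (a := ⟨x, hxU, hxV⟩) hxI

/-- `ind M_n ≥ n`: a small open set and the complement of its closure omit a fibre of the first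
coordinate, so the boundary contains a copy of the preceding space. -/
theorem not_hasSmallInductiveDimensionLT [CompactSpace M] [ConnectedSpace M] [Nontrivial M]
    (hg : IsResolving g) (n : ℕ) : ¬ HasSmallInductiveDimensionLT (ResolutionTower g n) n := by
  induction n with
  | zero =>
    rw [hasSmallInductiveDimensionLT_zero_iff, not_isEmpty_iff]
    exact nonempty 0
  | succ n ih =>
    intro h
    obtain _ | ⟨_, s, hs, h⟩ := h
    have := t2Space hg (n + 1)
    obtain ⟨x, y, hxy⟩ := exists_pair_ne M
    obtain ⟨w⟩ : Nonempty (ResolutionTower g n) := nonempty n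
    have hne : cons x w ≠ cons y w := fun h => hxy (congr_arg head h)
    have := compactSpace hg (n + 1)
    obtain ⟨O, hO, hxO, hyO⟩ : ∃ O : Set (ResolutionTower g (n + 1)), IsOpen O ∧ cons x w ∈ O ∧
        cons y w ∉ closure O := by
      obtain ⟨O, O', hO, hO', hxO, hyO', hd⟩ := t2_separation hne
      exact ⟨O, hO, hxO, fun h => Set.disjoint_left.1 (hd.closure_left hO') h hyO'⟩
    obtain ⟨U, hU, hxU, hUO⟩ := hs.exists_subset_of_mem_open hxO hO
    have hUo := hs.isOpen hU
    obtain ⟨z, hz⟩ := exists_fiber_disjoint hg hUo isClosed_closure.isOpen_compl ⟨_, hxU⟩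
      ⟨cons y w, fun h => hyO (closure_mono hUO h)⟩ (disjoint_compl_right_iff_subset.2 subset_closure)
    have hmem : ∀ v : ResolutionTower g n, cons z v ∈ frontier U := fun v => by
      rw [hUo.frontier_eq]
      have := hz (cons z v) rfl
      exact ⟨not_not.1 this.2, this.1⟩
    have he : IsEmbedding (cons z : ResolutionTower g n → ResolutionTower g (n + 1)) := by
      have := compactSpace hg n
      exact ((continuous_cons hg z).isClosedEmbedding fun a b h => congr_arg tail h).isEmbedding
    exact ih ((h U hU).of_isEmbedding (he.codRestrict _ hmem))

end ResolutionTower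

/-! ### Covering dimension -/

/-- The covering dimension in terms of indexed covers: the refinement can be chosen with the same
index set. -/
theorem CoveringDimLT.exists_refinement {k : ℕ} {X : Type u} [TopologicalSpace X]
    (h : CoveringDimLT k X) {ι : Type*} [Finite ι] {A : ι → Set X} (hA : ∀ i, IsOpen (A i))
    (hc : ∀ x, ∃ i, x ∈ A i) :
    ∃ V : ι → Set X, (∀ i, IsOpen (V i)) ∧ (∀ i, V i ⊆ A i) ∧ (∀ x, ∃ i, x ∈ V i) ∧
      ∀ x, {i | x ∈ V i}.encard ≤ k := by
  obtain ⟨𝒱, -, ho, hcov, hr, hk⟩ := h (range A) (finite_range A) (by rintro _ ⟨i, rfl⟩; exact hA i)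
    (by rw [sUnion_range]; exact iUnion_eq_univ_iff.2 hc)
  have hr' : ∀ V : 𝒱, ∃ i, (V : Set X) ⊆ A i := fun V => by
    obtain ⟨_, ⟨i, rfl⟩, hi⟩ := hr V V.2
    exact ⟨i, hi⟩
  choose φ hφ using hr'
  refine ⟨fun i => ⋃ V : {V : 𝒱 // φ V = i}, V, fun i => isOpen_iUnion fun V => ho _ V.1.2,
    fun i => iUnion_subset ?_, fun x => ?_, fun x => ?_⟩
  · rintro ⟨V, rfl⟩; exact hφ V
  · obtain ⟨V, hV, hx⟩ : x ∈ ⋃₀ 𝒱 := hcov ▸ mem_univ x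
    exact ⟨φ ⟨V, hV⟩, mem_iUnion.2 ⟨⟨⟨V, hV⟩, rfl⟩, hx⟩⟩
  · have h1 : {i | x ∈ ⋃ V : {V : 𝒱 // φ V = i}, (V : Set X)} ⊆ φ '' {V : 𝒱 | x ∈ (V : Set X)} := by
      intro i hi
      obtain ⟨⟨V, rfl⟩, hV⟩ := mem_iUnion.1 hi
      exact ⟨V, hV, rfl⟩
    have h2 : (Subtype.val '' {V : 𝒱 | x ∈ (V : Set X)}) = {V ∈ 𝒱 | x ∈ V} := by
      ext V
      simp [and_comm]
    calc _ ≤ _ := encard_le_encard h1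
      _ ≤ _ := encard_image_le _ _
      _ = _ := by rw [← h2, Subtype.val_injective.encard_image]
      _ ≤ _ := hk x

theorem CoveringDimLT.of_forall {k : ℕ} {X : Type u} [TopologicalSpace X]
    (h : ∀ 𝒰 : Set (Set X), 𝒰.Finite → (∀ U ∈ 𝒰, IsOpen U) → ⋃₀ 𝒰 = univ →
      ∃ (ι : Type v) (_ : Finite ι) (V : ι → Set X), (∀ i, IsOpen (V i)) ∧
        (∀ i, ∃ U ∈ 𝒰, V i ⊆ U) ∧ (∀ x, ∃ i, x ∈ V i) ∧ ∀ x, {i | x ∈ V i}.encard ≤ k) :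
    CoveringDimLT k X := by
  intro 𝒰 hf ho hc
  obtain ⟨ι, _, V, hV, hr, hcov, hk⟩ := h 𝒰 hf ho hc
  refine ⟨range V, finite_range V, ?_, ?_, ?_, fun x => ?_⟩
  · rintro _ ⟨i, rfl⟩; exact hV i
  · rw [sUnion_range]; exact iUnion_eq_univ_iff.2 hcov
  · rintro _ ⟨i, rfl⟩; exact hr i
  · have : {W ∈ range V | x ∈ W} ⊆ V '' {i | x ∈ V i} := by
      rintro _ ⟨⟨i, rfl⟩, hi⟩
      exact ⟨i, hi, rfl⟩
    exact (encard_le_encard this).trans ((encard_image_le _ _).trans (hk x))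

theorem encard_sum_le {α β : Type*} {s : Set (α ⊕ β)} {m k : ℕ∞}
    (hm : (Sum.inl ⁻¹' s).encard ≤ m) (hk : (Sum.inr ⁻¹' s).encard ≤ k) : s.encard ≤ m + k := by
  rw [← image_preimage_inl_union_image_preimage_inr s]
  exact (encard_union_le _ _).trans (add_le_add ((encard_image_le _ _).trans hm)
    ((encard_image_le _ _).trans hk))

theorem HasFiniteSpheres.coveringDimLT {M : Type u} [MetricSpace M] [CompactSpace M]
    (hM : HasFiniteSpheres M) : CoveringDimLT 2 M := by
  refine .of_forall fun 𝒰 _ ho hc => ?_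
  have h1 : ∀ a : M, ∃ r > 0, ∃ U ∈ 𝒰, Metric.ball a r ⊆ U := fun a => by
    obtain ⟨U, hU, ha⟩ : a ∈ ⋃₀ 𝒰 := hc ▸ mem_univ a
    obtain ⟨r, hr, h⟩ := Metric.isOpen_iff.1 (ho U hU) a ha
    exact ⟨r, hr, U, hU, h⟩
  choose r hr U hU hrU using h1
  obtain ⟨t, ht⟩ := isCompact_univ.elim_finite_subcover (fun a => Metric.ball a (r a))
    (fun a => Metric.isOpen_ball) fun a _ => mem_iUnion.2 ⟨a, Metric.mem_ball_self (hr a)⟩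
  set E : Set M := ⋃ a ∈ t, {y | dist y a = r a} with hE
  have hEf : E.Finite := t.finite_toSet.biUnion fun a _ => hM a (r a) (hr a)
  obtain ⟨D, hD, hdis⟩ := hEf.t2_separation
  have : Finite E := hEf
  -- the balls cut the complement of `E` into disjoint open pieces
  refine ⟨{J : Set t // J.Nonempty} ⊕ E, inferInstance, Sum.elim
    (fun J => {x | ∀ a : t, (a ∈ J.1 → dist x a < r a) ∧ (a ∉ J.1 → r a < dist x a)})
    (fun e => D e ∩ U e), ?_, ?_, ?_, ?_⟩
  · rintro (J | e)
    · simp only [Sum.elim_inl, ofPred_forall]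
      refine isOpen_iInter_of_finite fun a => ?_
      by_cases ha : a ∈ J.1
      · simpa [ha] using isOpen_lt (continuous_id.dist continuous_const) continuous_const
      · simpa [ha] using isOpen_lt continuous_const (continuous_id.dist continuous_const)
    · exact (hD e).2.inter (ho _ (hU e))
  · rintro (⟨J, a, ha⟩ | e)
    · exact ⟨U a, hU a, fun x hx => hrU a ((hx a).1 ha)⟩
    · exact ⟨U e, hU e, inter_subset_right⟩
  · intro x
    by_cases hx : x ∈ E
    · exact ⟨Sum.inr ⟨x, hx⟩, (hD x).1, hrU x (Metric.mem_ball_self (hr x))⟩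
    · obtain ⟨a, ha, hxa⟩ := mem_iUnion₂.1 (ht (mem_univ x))
      refine ⟨Sum.inl ⟨{a : t | dist x a < r a}, ⟨a, ha⟩, hxa⟩, fun b => ⟨id, fun hb => ?_⟩⟩
      refine lt_of_le_of_ne (not_lt.1 hb) fun h => hx (mem_iUnion₂.2 ⟨b, b.2, h.symm⟩)
  · intro x
    refine encard_sum_le (m := 1) (k := 1) ?_ ?_
    · rw [encard_le_one_iff]
      rintro ⟨J, hJ⟩ ⟨J', hJ'⟩ h h'
      refine Subtype.ext (Set.ext fun a => ⟨fun ha => ?_, fun ha => ?_⟩)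
      · exact by_contra fun hn => lt_asymm ((h a).1 ha) ((h' a).2 hn)
      · exact by_contra fun hn => lt_asymm ((h' a).1 ha) ((h a).2 hn)
    · rw [encard_le_one_iff]
      rintro ⟨e, he⟩ ⟨e', he'⟩ h h'
      by_contra hne
      exact Set.disjoint_left.1 (hdis he he' fun h => hne (Subtype.ext h)) h.1 h'.1

/-- Let the fibres of `f : X → Y` be embedded in `M` by maps `r y : X → M` that are constant on all
other fibres. Then `dim X ≤ max (dim Y) (dim M)`: a cover of `X` is refined near finitely many
fibres by pulling back covers of `M`, elsewhere by pulling back a cover of `Y`. Where the two meet,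
the maps `r y` are constant on the fibres of `f`, and the cover of `Y` can be chosen to be
compatible with the covers of `M`. -/
theorem CoveringDimLT.of_fibers {k : ℕ} {M : Type*} {X : Type u} {Y : Type v}
    [TopologicalSpace M] [TopologicalSpace X] [TopologicalSpace Y] [CompactSpace M] [T2Space M]
    [CompactSpace X] [CompactSpace Y] [T2Space Y] (hM : CoveringDimLT k M)
    (hY : CoveringDimLT k Y) {f : X → Y} (hf : Continuous f) (hfs : Function.Surjective f)
    {r : Y → X → M} (hr : ∀ y, Continuous (r y)) (hinj : ∀ y, InjOn (r y) (f ⁻¹' {y}))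
    (hconst : ∀ y p q, f p = f q → f p ≠ y → r y p = r y q) : CoveringDimLT k X := by
  classical
  refine .of_forall fun 𝒰 _ ho hc => ?_
  rcases 𝒰.eq_empty_or_nonempty with rfl | ⟨U₀, hU₀⟩
  · have : IsEmpty X := ⟨fun x => by simpa [← hc] using mem_univ x⟩
    exact ⟨PEmpty, inferInstance, fun _ => ∅, by simp, by simp, fun x => isEmptyElim x,
      fun x => isEmptyElim x⟩
  have htube : ∀ y, ∃ N : Set Y, IsOpen N ∧ y ∈ N ∧ ∃ 𝒢 : Set (Set M), 𝒢.Finite ∧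
      (∀ G ∈ 𝒢, IsOpen G) ∧ ⋃₀ 𝒢 = univ ∧ (∀ a, {G ∈ 𝒢 | a ∈ G}.encard ≤ k) ∧
      ∀ G ∈ 𝒢, ∃ U ∈ 𝒰, f ⁻¹' N ∩ r y ⁻¹' G ⊆ U := by
    intro y
    have h1 : ∀ a : M, ∃ U ∈ 𝒰, ∃ N : Set Y, IsOpen N ∧ y ∈ N ∧ ∃ G : Set M, IsOpen G ∧ a ∈ G ∧
        f ⁻¹' N ∩ r y ⁻¹' G ⊆ U := by
      intro a
      obtain ⟨U, hU, hUa⟩ : ∃ U ∈ 𝒰, ∀ p, f p = y → r y p = a → p ∈ U := by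
        by_cases h : ∃ p, f p = y ∧ r y p = a
        · obtain ⟨p, hp, hpa⟩ := h
          obtain ⟨U, hU, hpU⟩ : p ∈ ⋃₀ 𝒰 := hc ▸ mem_univ p
          exact ⟨U, hU, fun q hq hqa => hinj y hp hq (hpa.trans hqa.symm) ▸ hpU⟩
        · exact ⟨U₀, hU₀, fun p hp hpa => (h ⟨p, hp, hpa⟩).elim⟩
      have hcl : IsClosed ((fun p => (f p, r y p)) '' Uᶜ) :=
        (hf.prodMk (hr y)).isClosedMap _ (ho U hU).isClosed_compl
      have hmem : (y, a) ∉ (fun p => (f p, r y p)) '' Uᶜ := by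
        rintro ⟨p, hp, hpa⟩
        exact hp (hUa p (congr_arg Prod.fst hpa) (congr_arg Prod.snd hpa))
      obtain ⟨N, G, hN, hG, hy, ha, hNG⟩ :=
        isOpen_prod_iff.1 hcl.isOpen_compl y a hmem
      exact ⟨U, hU, N, hN, hy, G, hG, ha, fun p hp => by_contra fun hpU =>
        hNG (mk_mem_prod hp.1 hp.2) ⟨p, hpU, rfl⟩⟩
    choose U hU N hN hy G hG ha hNG using h1
    obtain ⟨t, ht⟩ := isCompact_univ.elim_finite_subcover G hG fun a _ => mem_iUnion.2 ⟨a, ha a⟩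
    obtain ⟨𝒢, h𝒢f, h𝒢o, h𝒢c, h𝒢r, h𝒢k⟩ := hM (G '' t) (t.finite_toSet.image G)
      (by rintro _ ⟨a, -, rfl⟩; exact hG a) (by rw [sUnion_image]; exact univ_subset_iff.1 ht)
    refine ⟨⋂ a ∈ t, N a, isOpen_biInter_finset fun a _ => hN a, mem_iInter₂.2 fun a _ => hy a,
      𝒢, h𝒢f, h𝒢o, h𝒢c, h𝒢k, fun G' hG' => ?_⟩
    obtain ⟨_, ⟨a, hat, rfl⟩, hGa⟩ := h𝒢r G' hG'
    exact ⟨U a, hU a, fun p hp => hNG a ⟨mem_iInter₂.1 hp.1 a hat, hGa hp.2⟩⟩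
  choose N hN hyN 𝒢 h𝒢f h𝒢o h𝒢c h𝒢k h𝒢U using htube
  obtain ⟨S, hS⟩ := isCompact_univ.elim_finite_subcover N hN fun y _ => mem_iUnion.2 ⟨y, hyN y⟩
  obtain ⟨D, hD, hdis⟩ := S.finite_toSet.t2_separation
  have hK : ∀ y, ∃ K ∈ 𝓝 y, IsClosed K ∧ K ⊆ D y ∩ N y := fun y =>
    exists_mem_nhds_isClosed_subset (((hD y).2.inter (hN y)).mem_nhds ⟨(hD y).1, hyN y⟩)
  choose K hKn hKc hKD using hK
  have hKdis : ∀ s ∈ S, ∀ t ∈ S, ∀ y, y ∈ K s → y ∈ K t → s = t := fun s hs t ht y hys hyt => by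
    by_contra hne
    exact Set.disjoint_left.1 (hdis hs ht hne) (hKD s hys).1 (hKD t hyt).1
  have hfib : ∀ {O : Set X}, IsOpen O → IsOpen {y | ∀ p, f p = y → p ∈ O} := by
    intro O hO
    have : {y | ∀ p, f p = y → p ∈ O} = (f '' Oᶜ)ᶜ := by
      ext y
      simp only [mem_ofPred_eq, mem_compl_iff, mem_image, not_exists, not_and]
      exact forall_congr' fun p =>
        ⟨fun h h1 h2 => h1 (h h2), fun h h2 => by_contra fun h1 => h h1 h2⟩
    rw [this]
    exact (hf.isClosedMap _ hO.isClosed_compl).isOpen_compl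
  have (s : Y) : Finite (𝒢 s) := h𝒢f s
  -- The neighbourhoods `K s` of the points of `S` are disjoint. The cover `A` of `Y` consists of
  -- their interiors, to be replaced by preimages of members of `𝒢 s`, and of sets off `s` over
  -- which `r s` maps into a given member of `𝒢 s`.
  set A : (Σ s : S, 𝒢 s) ⊕ S → Set Y := Sum.elim
    (fun i => ((N i.1 ∩ {(i.1 : Y)}ᶜ) ∩ {y | ∀ p, f p = y → p ∈ r i.1 ⁻¹' i.2}) ∩
      (⋃ t ∈ S.erase i.1, K t)ᶜ)
    (fun s => interior (K s)) with hA
  obtain ⟨V, hVo, hVA, hVc, hVk⟩ := hY.exists_refinement (A := A) (by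
    rintro (i | s)
    · refine (((hN _).inter isOpen_compl_singleton).inter (hfib ((h𝒢o _ _ i.2.2).preimage
        (hr _)))).inter ?_
      exact (isClosed_biUnion_finset fun t _ => hKc t).isOpen_compl
    · exact isOpen_interior) (by
    intro y
    by_cases hy : ∃ s ∈ S, y ∈ interior (K s)
    · obtain ⟨s, hs, hy⟩ := hy
      exact ⟨Sum.inr ⟨s, hs⟩, hy⟩
    · push Not at hy
      obtain ⟨s, hs, hys, hyK⟩ : ∃ s ∈ S, y ∈ N s ∧ ∀ t ∈ S, t ≠ s → y ∉ K t := by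
        by_cases h : ∃ s ∈ S, y ∈ K s
        · obtain ⟨s, hs, hys⟩ := h
          exact ⟨s, hs, (hKD s hys).2, fun t ht hts hyt => hts (hKdis t ht s hs y hyt hys)⟩
        · push Not at h
          obtain ⟨s, hs, hys⟩ := mem_iUnion₂.1 (hS (mem_univ y))
          exact ⟨s, hs, hys, fun t ht _ => h t ht⟩
      have hne : y ≠ s := fun h => hy s hs (by
        rw [h]; exact mem_interior_iff_mem_nhds.2 (hKn s))
      obtain ⟨p, rfl⟩ := hfs y
      obtain ⟨G, hG, hpG⟩ : r s p ∈ ⋃₀ 𝒢 s := h𝒢c s ▸ mem_univ _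
      refine ⟨Sum.inl ⟨⟨s, hs⟩, G, hG⟩, ⟨⟨hys, hne⟩, fun q hq => ?_⟩, ?_⟩
      · rw [mem_preimage, hconst s q p hq (hq ▸ hne)]; exact hpG
      · simp only [mem_compl_iff, mem_iUnion, Finset.mem_erase, not_exists]
        exact fun t ht => hyK t ht.2 ht.1)
  have hVr : ∀ (i : Σ s : S, 𝒢 s) p, f p ∈ V (Sum.inl i) → r i.1 p ∈ (i.2 : Set M) := fun i p hp =>
    (hVA _ hp).1.2 p rfl
  refine ⟨Σ s : S, 𝒢 s, inferInstance, fun i => f ⁻¹' V (Sum.inl i) ∪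
    (r i.1 ⁻¹' i.2 ∩ f ⁻¹' interior (K i.1)), fun i => ?_, fun i => ?_, fun p => ?_, fun p => ?_⟩
  · exact ((hVo _).preimage hf).union
      (((h𝒢o _ _ i.2.2).preimage (hr _)).inter (isOpen_interior.preimage hf))
  · obtain ⟨U, hU, h⟩ := h𝒢U _ _ i.2.2
    refine ⟨U, hU, union_subset (fun p hp => h ⟨(hVA _ hp).1.1.1, hVr i p hp⟩) fun p hp => ?_⟩
    exact h ⟨(hKD _ (interior_subset hp.2)).2, hp.1⟩
  · obtain ⟨i | s, hi⟩ := hVc (f p)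
    · exact ⟨i, Or.inl hi⟩
    · obtain ⟨G, hG, hpG⟩ : r s p ∈ ⋃₀ 𝒢 s := h𝒢c s ▸ mem_univ _
      exact ⟨⟨s, G, hG⟩, Or.inr ⟨hpG, hVA _ hi⟩⟩
  · by_cases hp : ∃ s : S, f p ∈ interior (K s)
    · -- only the sets belonging to `s` are present, and they reflect the position of `r s p`
      obtain ⟨s, hs⟩ := hp
      have hsub : {i : Σ s : S, 𝒢 s | p ∈ f ⁻¹' V (Sum.inl i) ∪
          (r i.1 ⁻¹' i.2 ∩ f ⁻¹' interior (K i.1))} ⊆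
          (fun G => ⟨s, G⟩ : 𝒢 s → Σ s : S, 𝒢 s) '' {G : 𝒢 s | r s p ∈ (G : Set M)} := by
        rintro ⟨t, G⟩ h
        have hst : t = s := by
          rcases h with h | h
          · by_contra hne
            refine (hVA _ h).2 (mem_iUnion₂.2 ⟨s, ?_, interior_subset hs⟩)
            exact Finset.mem_erase.2 ⟨fun h => hne (Subtype.ext h.symm), s.2⟩
          · exact Subtype.ext (hKdis t t.2 s s.2 _ (interior_subset h.2) (interior_subset hs))
        subst hst
        exact ⟨G, h.elim (fun h => hVr ⟨t, G⟩ p h) fun h => h.1, rfl⟩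
      have h2 : (Subtype.val '' {G : 𝒢 s | r s p ∈ (G : Set M)}) = {G ∈ 𝒢 s | r s p ∈ G} := by
        ext G
        simp [and_comm]
      calc _ ≤ _ := encard_le_encard hsub
        _ ≤ _ := encard_image_le _ _
        _ = _ := by rw [← h2, Subtype.val_injective.encard_image]
        _ ≤ _ := h𝒢k s _
    · have hsub : Sum.inl '' {i : Σ s : S, 𝒢 s | p ∈ f ⁻¹' V (Sum.inl i) ∪
          (r i.1 ⁻¹' i.2 ∩ f ⁻¹' interior (K i.1))} ⊆ {i | f p ∈ V i} := by
        rintro _ ⟨i, h, rfl⟩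
        exact h.elim id fun h => (hp ⟨_, h.2⟩).elim
      rw [← Sum.inl_injective.encard_image]
      exact (encard_le_encard hsub).trans (hVk _)

/-- A connected space with at least two points does not have covering dimension `0`. -/
theorem not_coveringDimLT_one {X : Type u} [TopologicalSpace X] [T1Space X] [ConnectedSpace X]
    [Nontrivial X] : ¬ CoveringDimLT 1 X := by
  intro h
  obtain ⟨x, y, hxy⟩ := exists_pair_ne X
  obtain ⟨V, hVo, hVA, hVc, hVk⟩ := h.exists_refinement (A := fun b : Bool => cond b {x}ᶜ {y}ᶜ)
    (by rintro (_ | _) <;> exact isOpen_compl_singleton)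
    (fun z => by
      by_cases hz : z = x
      · exact ⟨false, by simpa [hz] using hxy⟩
      · exact ⟨true, hz⟩)
  obtain ⟨z, -, h1, h2⟩ := isPreconnected_univ (α := X) _ _ (hVo true) (hVo false)
    (fun z _ => by
      obtain ⟨_ | _, hz⟩ := hVc z
      exacts [Or.inr hz, Or.inl hz])
    ⟨y, mem_univ _, by
      obtain ⟨_ | _, hz⟩ := hVc y
      exacts [(hVA false hz rfl).elim, hz]⟩
    ⟨x, mem_univ _, by
      obtain ⟨_ | _, hz⟩ := hVc x
      exacts [hz, (hVA true hz rfl).elim]⟩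
  have := encard_le_one_iff.1 (hVk z) true false h1 h2
  simp at this

theorem coveringDim_eq_one {X : Type u} [TopologicalSpace X] [T1Space X] [ConnectedSpace X]
    [Nontrivial X] (h : CoveringDimLT 2 X) : coveringDim X = 1 := by
  refine le_antisymm (sInf_le fun i hi => ?_) (le_sInf fun d hd => ?_)
  · have hi' : 2 ≤ i := by
      have : (1 : WithBot ℕ∞) < (i : ℕ) := hi
      have : 1 < i := by exact_mod_cast this
      exact this
    intro 𝒰 hf ho hc
    obtain ⟨𝒱, h1, h2, h3, h4, h5⟩ := h 𝒰 hf ho hc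
    exact ⟨𝒱, h1, h2, h3, h4, fun x => (h5 x).trans (by exact_mod_cast hi')⟩
  · by_contra hlt
    exact not_coveringDimLT_one (hd 1 (by simpa using not_le.1 hlt))

namespace ResolutionTower

variable {M : Type u} [MetricSpace M] {g : ℝ → M} {n : ℕ}

/-- The composition of the retractions along the coordinates of `t`. It restricts to the
homeomorphism `snoc t a ↦ a` on the fibre of the bonding map over `t`. -/
noncomputable def coord : {n : ℕ} → ResolutionTower g n → ResolutionTower g (n + 1) → M
  | 0, _, p => p.head
  | _ + 1, t, p => coord t.tail (p.retr t.head)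

theorem continuous_coord (hg : IsResolving g) (t : ResolutionTower g n) :
    Continuous (coord t) := by
  induction n with
  | zero => exact continuous_head
  | succ n ih => exact (ih t.tail).comp (continuous_retr hg t.head)

theorem coord_snoc (t : ResolutionTower g n) (a : M) : coord t (snoc t a) = a := by
  induction n with
  | zero => rfl
  | succ n ih => rw [snoc, coord, retr_cons, ih]

theorem coord_congr {t : ResolutionTower g n} {p q : ResolutionTower g (n + 1)}
    (h : bonding g n p = bonding g n q) (ht : bonding g n p ≠ t) : coord t p = coord t q := by
  induction n with
  | zero => exact (ht (Subsingleton.elim _ _)).elim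
  | succ n ih =>
    have hh : p.head = q.head := congr_fun h 0
    rw [coord, coord]
    by_cases hp : p.head = t.head
    · rw [retr_of_head_eq hp, retr_of_head_eq (hh ▸ hp)]
      exact ih (congr_arg tail h) fun h' => ht (ext_head_tail hp h')
    · rw [retr_of_head_ne hp, retr_of_head_ne (hh ▸ hp), push_congr h]

theorem coveringDimLT [CompactSpace M] [Nonempty M] (hg : IsResolving g) (n : ℕ) :
    CoveringDimLT 2 (ResolutionTower g n) := by
  induction n with
  | zero =>
    refine fun 𝒰 hf ho hc => ⟨𝒰, hf, ho, hc, fun V hV => ⟨V, hV, Subset.rfl⟩, fun x => ?_⟩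
    refine le_trans (encard_le_one_iff.2 ?_) (by norm_num)
    rintro V W ⟨-, hV⟩ ⟨-, hW⟩
    rw [Subsingleton.eq_univ_of_nonempty ⟨x, hV⟩, Subsingleton.eq_univ_of_nonempty ⟨x, hW⟩]
  | succ n ih =>
    have := compactSpace hg n
    have := compactSpace hg (n + 1)
    have := t2Space hg n
    refine CoveringDimLT.of_fibers hg.finiteSpheres.coveringDimLT ih continuous_bonding
      (fun t => ?_) (continuous_coord hg) (fun t p hp q hq h => ?_) fun t p q => coord_congr
    · obtain ⟨a⟩ := ‹Nonempty M›
      exact ⟨snoc t a, bonding_snoc t a⟩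
    · rw [← range_snoc] at hp hq
      obtain ⟨a, rfl⟩ := hp
      obtain ⟨b, rfl⟩ := hq
      rw [coord_snoc, coord_snoc] at h
      rw [h]

theorem coveringDim_eq_one [CompactSpace M] [ConnectedSpace M] [Nontrivial M]
    (hg : IsResolving g) {n : ℕ} (hn : 1 ≤ n) : coveringDim (ResolutionTower g n) = 1 := by
  obtain ⟨n, rfl⟩ := Nat.exists_eq_add_of_le' hn
  have := t2Space hg (n + 1)
  have := connectedSpace hg (n + 1)
  have : Nontrivial (ResolutionTower g (n + 1)) :=
    inferInstanceAs (Nontrivial (Fin (n + 1) → M))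
  exact _root_.coveringDim_eq_one (coveringDimLT hg _)

end ResolutionTower

/-! ### The zigzag and the winding map -/

theorem exists_eq_zpow_mul {r : ℝ} (hr : 0 < r) :
    ∃ (k : ℤ) (m : ℝ), 1 ≤ m ∧ m < 2 ∧ r = 2 ^ k * m := by
  refine ⟨Int.log 2 r, r / 2 ^ Int.log 2 r, ?_, ?_, by field_simp⟩
  · rw [one_le_div₀ (by positivity)]
    exact_mod_cast Int.zpow_log_le_self (b := 2) (by norm_num) hr
  · rw [div_lt_iff₀ (by positivity), mul_comm, ← zpow_add_one₀ two_ne_zero]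
    exact_mod_cast Int.lt_zpow_succ_log_self (b := 2) (by norm_num) r

theorem dyadicMantissa_zpow_mul (k : ℤ) {m : ℝ} (hm : 1 ≤ m) (hm' : m < 2) :
    dyadicMantissa (2 ^ k * m) = m := by
  have hr : 0 < 2 ^ k * m := by positivity
  have hlog : Int.log 2 (2 ^ k * m) = k := by
    apply le_antisymm
    · rw [← Int.lt_add_one_iff, ← Int.lt_zpow_iff_log_lt (by norm_num) hr]
      push_cast
      rw [zpow_add_one₀ two_ne_zero]
      gcongr
    · rw [← Int.zpow_le_iff_le_log (by norm_num) hr]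
      push_cast
      exact le_mul_of_one_le_right (by positivity) hm
  rw [dyadicMantissa, hlog]
  field_simp

theorem dyadicMantissa_mem {r : ℝ} (hr : 0 < r) : 1 ≤ dyadicMantissa r ∧ dyadicMantissa r < 2 := by
  obtain ⟨k, m, h1, h2, rfl⟩ := exists_eq_zpow_mul hr
  rw [dyadicMantissa_zpow_mul k h1 h2]
  exact ⟨h1, h2⟩

theorem dyadicMantissa_two_mul {r : ℝ} (hr : 0 < r) :
    dyadicMantissa (2 * r) = dyadicMantissa r := by
  obtain ⟨k, m, h1, h2, rfl⟩ := exists_eq_zpow_mul hr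
  rw [← mul_assoc, ← zpow_one_add₀ two_ne_zero, dyadicMantissa_zpow_mul _ h1 h2,
    dyadicMantissa_zpow_mul _ h1 h2]

/-- A map that depends on the dyadic mantissa, and does so continuously if `1` and `2` are
identified, can be computed near `r` at one fixed scale on each side of `r`. -/
theorem eventually_exists_mantissa {α : Type*} {φ : ℝ → α} (hφ : φ 2 = φ 1) {P : ℝ → ℝ → Prop}
    (hP : ∀ m₀, ∀ᶠ m in 𝓝 m₀, 1 ≤ m₀ → m₀ ≤ 2 → 1 ≤ m → m ≤ 2 → P m₀ m) {r : ℝ} (hr : 0 < r) :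
    ∃ K : ℤ, ∀ᶠ s in 𝓝 r, ∃ k ≤ K, ∃ m₀ m, r = 2 ^ (-k) * m₀ ∧ s = 2 ^ (-k) * m ∧
      φ (dyadicMantissa r) = φ m₀ ∧ φ (dyadicMantissa s) = φ m ∧ P m₀ m := by
  obtain ⟨k, m₀, h1, h2, rfl⟩ := exists_eq_zpow_mul hr
  have hsc : ∀ k : ℤ, ∀ m₀ : ℝ, 2 ^ k * m₀ = 2 ^ (-(-k)) * m₀ := by simp
  have hc : ∀ k : ℤ, ∀ m₀ : ℝ, Tendsto (fun s : ℝ => 2 ^ (-k) * s) (𝓝 (2 ^ k * m₀)) (𝓝 m₀) := by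
    intro k m₀
    have : Continuous fun s : ℝ => (2 : ℝ) ^ (-k) * s := by fun_prop
    have := this.tendsto (2 ^ k * m₀)
    rwa [← mul_assoc, ← zpow_add₀ two_ne_zero, neg_add_cancel, zpow_zero, one_mul] at this
  have hinv : ∀ k : ℤ, ∀ s : ℝ, s = 2 ^ k * (2 ^ (-k) * s) := by
    intro k s
    rw [← mul_assoc, ← zpow_add₀ two_ne_zero, add_neg_cancel, zpow_zero, one_mul]
  refine ⟨-k + 1, ?_⟩
  rcases h1.eq_or_lt with rfl | h1'
  · have h12 : (2 : ℝ) ^ k * 1 = 2 ^ (k - 1) * 2 := by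
      rw [← zpow_add_one₀ two_ne_zero]; simp
    have hc' := hc (k - 1) 2
    rw [← h12] at hc'
    filter_upwards [(hc k 1).eventually (hP 1), (hc k 1).eventually (gt_mem_nhds h2),
      hc'.eventually (hP 2), hc'.eventually (lt_mem_nhds one_lt_two)] with s p1 p2 p3 p4
    by_cases hs : 1 ≤ 2 ^ (-k) * s
    · refine ⟨-k, by omega, 1, 2 ^ (-k) * s, by simp, by rw [neg_neg]; exact hinv k s, ?_, ?_,
        p1 le_rfl h2.le hs p2.le⟩
      · rw [dyadicMantissa_zpow_mul k le_rfl h2]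
      · conv_lhs => rw [hinv k s]
        rw [dyadicMantissa_zpow_mul k hs p2]
    · have hs' : 2 ^ (-(k - 1)) * s < 2 := by
        rw [neg_sub, sub_eq_add_neg, add_comm, zpow_add_one₀ two_ne_zero]
        linarith
      refine ⟨-k + 1, le_rfl, 2, 2 ^ (-(k - 1)) * s, ?_, ?_, ?_, ?_,
        p3 one_le_two le_rfl p4.le hs'.le⟩
      · rw [h12]; congr 2; ring
      · conv_lhs => rw [hinv (k - 1) s]
        congr 2; ring
      · rw [dyadicMantissa_zpow_mul k le_rfl h2, hφ]
      · conv_lhs => rw [hinv (k - 1) s]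
        rw [dyadicMantissa_zpow_mul _ p4.le hs']
  · filter_upwards [(hc k m₀).eventually (hP m₀), (hc k m₀).eventually (gt_mem_nhds h2),
      (hc k m₀).eventually (lt_mem_nhds h1')] with s p1 p2 p3
    refine ⟨-k, by omega, m₀, 2 ^ (-k) * s, by simp, by rw [neg_neg]; exact hinv k s, ?_, ?_,
      p1 h1 h2.le p3.le p2.le⟩
    · rw [dyadicMantissa_zpow_mul k h1 h2]
    · conv_lhs => rw [hinv k s]
      rw [dyadicMantissa_zpow_mul k p3.le p2]

theorem exists_dist_eq_zpow_mul {M : Type*} [MetricSpace M] {φ : ℝ → M} (hφ : φ 2 = φ 1) (j : ℤ)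
    (hd : ∀ m₀, ∀ᶠ m in 𝓝 m₀, 1 ≤ m₀ → m₀ ≤ 2 → 1 ≤ m → m ≤ 2 →
      dist (φ m) (φ m₀) = 2 ^ j * |m - m₀|) {r : ℝ} (hr : 0 < r) :
    ∃ K : ℤ, ∀ᶠ s in 𝓝 r, s ≠ r →
      ∃ k ≤ K, dist (φ (dyadicMantissa s)) (φ (dyadicMantissa r)) = (2 : ℝ) ^ k * |s - r| := by
  obtain ⟨K, hK⟩ := eventually_exists_mantissa hφ hd hr
  refine ⟨K + j, hK.mono fun s hs _ => ?_⟩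
  obtain ⟨k, hk, m₀, m, hr', hs', h1, h2, h3⟩ := hs
  refine ⟨k + j, by omega, ?_⟩
  rw [h1, h2, h3, hs', hr', ← mul_sub, abs_mul, abs_of_pos (by positivity : (0 : ℝ) < 2 ^ (-k)),
    ← mul_assoc, ← zpow_add₀ two_ne_zero]
  congr 2
  ring

theorem coe_zigzag {r : ℝ} (hr : 0 < r) : (zigzag r : ℝ) = |2 * dyadicMantissa r - 3| := by
  obtain ⟨h1, h2⟩ := dyadicMantissa_mem hr
  rw [zigzag, coe_projIcc, min_eq_right (abs_le.2 ⟨by linarith, by linarith⟩),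
    max_eq_right (abs_nonneg _)]

theorem abs_sub_eq_of_abs_lt {a b : ℝ} (h : |b - a| < |a|) : |(|b| - |a|)| = |b - a| := by
  rcases abs_cases a with ⟨h1, h2⟩ | ⟨h1, h2⟩ <;> rw [h1] at h ⊢ <;> rw [abs_lt] at h
  · rw [abs_of_pos (by linarith : 0 < b)]
  · rw [abs_of_neg (by linarith : b < 0), show -b - -a = -(b - a) by ring, abs_neg]

theorem eventually_abs_sub_eq (a : ℝ) : ∀ᶠ b in 𝓝 a, |(|b| - |a|)| = |b - a| := by
  by_cases ha : a = 0
  · simp [ha]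
  · filter_upwards [Metric.ball_mem_nhds a (abs_pos.2 ha)] with b hb
    exact abs_sub_eq_of_abs_lt hb

theorem unitInterval.hasFiniteSpheres : HasFiniteSpheres unitInterval := by
  intro x r _
  refine Set.Finite.of_injOn (f := Subtype.val) (t := {(x : ℝ) + r, (x : ℝ) - r}) (fun y hy => ?_)
    Subtype.val_injective.injOn (by simp)
  have hy : |(y : ℝ) - x| = r := hy
  rcases abs_cases ((y : ℝ) - x) with h | h
  · left; linarith
  · right; rw [mem_singleton_iff]; linarith

theorem isResolving_zigzag : IsResolving zigzag where
  mul_two r hr := by rw [zigzag, zigzag, dyadicMantissa_two_mul hr]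
  surj a := by
    obtain ⟨h0, h1⟩ := a.2
    refine ⟨(3 - a) / 2, by linarith, Subtype.ext ?_⟩
    rw [coe_zigzag (by linarith), ← one_mul ((3 - (a : ℝ)) / 2), ← zpow_zero (2 : ℝ),
      dyadicMantissa_zpow_mul _ (by linarith) (by linarith)]
    rw [show 2 * ((3 - (a : ℝ)) / 2) - 3 = -a by ring, abs_neg, abs_of_nonneg h0]
  similar r hr := by
    refine exists_dist_eq_zpow_mul (φ := fun m => projIcc (0 : ℝ) 1 zero_le_one |2 * m - 3|)
      (by norm_num) 1 (fun m₀ => ?_) hr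
    have hc : Tendsto (fun m : ℝ => 2 * m - 3) (𝓝 m₀) (𝓝 (2 * m₀ - 3)) :=
      (by fun_prop : Continuous fun m : ℝ => 2 * m - 3).tendsto m₀
    filter_upwards [hc.eventually (eventually_abs_sub_eq _)] with m hm h1 h2 h3 h4
    have hle : ∀ m : ℝ, 1 ≤ m → m ≤ 2 → |2 * m - 3| ≤ 1 := fun m h h' =>
      abs_le.2 ⟨by linarith, by linarith⟩
    rw [Subtype.dist_eq, Real.dist_eq, projIcc_of_mem _ ⟨abs_nonneg _, hle m h3 h4⟩,
      projIcc_of_mem _ ⟨abs_nonneg _, hle m₀ h1 h2⟩, hm, zpow_one,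
      show 2 * m - 3 - (2 * m₀ - 3) = 2 * (m - m₀) by ring, abs_mul, abs_two]
  geodesic x y r hr hxy := by
    rw [Subtype.dist_eq, Real.dist_eq] at hxy
    obtain ⟨hx0, hx1⟩ := x.2
    obtain ⟨hy0, hy1⟩ := y.2
    rcases abs_cases ((x : ℝ) - y) with ⟨h, h'⟩ | ⟨h, h'⟩ <;> rw [h] at hxy
    · refine ⟨⟨x - r, by linarith, by linarith⟩, ?_, ?_⟩
      · simp [Subtype.dist_eq, abs_of_nonneg hr]
      · change |(x : ℝ) - r - y| = |(x : ℝ) - y| - r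
        rw [h, abs_of_nonneg (by linarith)]
        ring
    · refine ⟨⟨x + r, by linarith, by linarith⟩, ?_, ?_⟩
      · simp [Subtype.dist_eq, abs_of_nonneg hr]
      · change |(x : ℝ) + r - y| = |(x : ℝ) - y| - r
        rw [h, abs_of_nonpos (by linarith)]
        ring
  fold x s hs := by
    have hc : Tendsto (fun t : unitInterval => (t : ℝ) - x) (𝓝 s) (𝓝 ((s : ℝ) - x)) :=
      (by fun_prop : Continuous fun t : unitInterval => (t : ℝ) - x).tendsto s
    filter_upwards [hc.eventually (eventually_abs_sub_eq _)] with t ht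
    rw [Subtype.dist_eq, Subtype.dist_eq, Subtype.dist_eq, Real.dist_eq, Real.dist_eq,
      Real.dist_eq, ht]
    congr 1
    ring
  finiteSpheres := unitInterval.hasFiniteSpheres

namespace UnitAddCircle

theorem norm_coe {d : ℝ} (hd : |d| ≤ 1 / 2) : ‖(d : UnitAddCircle)‖ = |d| := by
  rw [AddCircle.norm_coe_eq_abs_iff 1 one_ne_zero]
  simpa using hd

theorem exists_coe_eq (a : UnitAddCircle) : ∃ d : ℝ, |d| ≤ 1 / 2 ∧ (d : UnitAddCircle) = a := by
  obtain ⟨x, rfl⟩ := QuotientAddGroup.mk_surjective a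
  refine ⟨x - round x, abs_sub_round x, ?_⟩
  have h : ((round x : ℝ) : UnitAddCircle) = 0 := by
    rw [AddCircle.coe_eq_zero_iff]
    exact ⟨round x, by simp⟩
  rw [AddCircle.coe_sub, h, sub_zero]

theorem exists_eq_add_coe (x y : UnitAddCircle) :
    ∃ d : ℝ, |d| ≤ 1 / 2 ∧ y = x + d ∧ dist y x = |d| := by
  obtain ⟨d, hd, h⟩ := exists_coe_eq (y - x)
  exact ⟨d, hd, by rw [h]; abel, by rw [dist_eq_norm, ← h, norm_coe hd]⟩

theorem coe_one : ((1 : ℝ) : UnitAddCircle) = 0 := AddCircle.coe_period 1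

theorem norm_coe_add_of_abs_eq {d e : ℝ} (hd : |d| = 1 / 2) (he : |e| ≤ 1 / 2) :
    ‖((d + e : ℝ) : UnitAddCircle)‖ = 1 / 2 - |e| := by
  have h1 : ((d + e - 1 : ℝ) : UnitAddCircle) = ((d + e : ℝ) : UnitAddCircle) := by
    rw [AddCircle.coe_sub, coe_one, sub_zero]
  have h2 : ((d + e + 1 : ℝ) : UnitAddCircle) = ((d + e : ℝ) : UnitAddCircle) := by
    rw [AddCircle.coe_add _ (d + e), coe_one, add_zero]
  rcases abs_cases d with ⟨hd', -⟩ | ⟨hd', -⟩ <;> rcases abs_cases e with ⟨he', he0⟩ | ⟨he', he0⟩ <;>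
    rw [he'] at he ⊢ <;> rw [hd'] at hd
  · rw [← h1, norm_coe (abs_le.2 ⟨by linarith, by linarith⟩), abs_of_nonpos (by linarith)]
    linarith
  · rw [norm_coe (abs_le.2 ⟨by linarith, by linarith⟩), abs_of_nonneg (by linarith)]
    linarith
  · rw [norm_coe (abs_le.2 ⟨by linarith, by linarith⟩), abs_of_nonpos (by linarith)]
    linarith
  · rw [← h2, norm_coe (abs_le.2 ⟨by linarith, by linarith⟩), abs_of_nonneg (by linarith)]
    linarith

theorem hasFiniteSpheres : HasFiniteSpheres UnitAddCircle := by
  intro x r _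
  refine Set.Finite.subset (s := {x + (r : ℝ), x + ((-r : ℝ) : UnitAddCircle)}) (by simp)
    fun y hy => ?_
  obtain ⟨d, -, h, h'⟩ := exists_eq_add_coe x y
  have hd : |d| = r := h' ▸ hy
  rcases abs_cases d with h0 | h0
  · left; rw [h, ← hd, h0.1]
  · right; rw [mem_singleton_iff, h, ← hd, h0.1, neg_neg]

instance : Nontrivial UnitAddCircle := by
  refine ⟨((1 / 2 : ℝ) : UnitAddCircle), 0, fun h => ?_⟩
  have := norm_coe (d := 1 / 2) (by norm_num)
  rw [h, norm_zero] at this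
  norm_num at this

end UnitAddCircle

theorem coe_dyadicMantissa_sub_one (r : ℝ) :
    winding r = ((dyadicMantissa r - 1 : ℝ) : UnitAddCircle) := by
  rw [AddCircle.coe_sub, UnitAddCircle.coe_one, sub_zero, winding]

theorem isResolving_winding : IsResolving winding where
  mul_two r hr := by rw [winding, winding, dyadicMantissa_two_mul hr]
  surj a := by
    obtain ⟨x, rfl⟩ := QuotientAddGroup.mk_surjective a
    have h0 := Int.fract_nonneg x
    have h1 := Int.fract_lt_one x
    refine ⟨1 + Int.fract x, by linarith, ?_⟩
    have h := dyadicMantissa_zpow_mul 0 (m := 1 + Int.fract x) (by linarith) (by linarith)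
    rw [zpow_zero, one_mul] at h
    rw [coe_dyadicMantissa_sub_one, h, add_sub_cancel_left]
    exact AddCircle.coe_fract x
  similar r hr := by
    refine exists_dist_eq_zpow_mul (φ := fun m : ℝ => (m : UnitAddCircle)) ?_ 0 (fun m₀ => ?_) hr
    · rw [← one_add_one_eq_two, AddCircle.coe_add, UnitAddCircle.coe_one, add_zero]
    · filter_upwards [Metric.closedBall_mem_nhds m₀ one_half_pos] with m hm _ _ _ _
      rw [dist_eq_norm, ← AddCircle.coe_sub, UnitAddCircle.norm_coe hm, zpow_zero, one_mul]
  geodesic x y r hr hxy := by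
    obtain ⟨d, hd, rfl, h⟩ := UnitAddCircle.exists_eq_add_coe x y
    rw [dist_comm, h] at hxy ⊢
    rcases abs_cases d with ⟨h, h'⟩ | ⟨h, h'⟩ <;> rw [h] at hxy hd ⊢
    · refine ⟨x + (r : ℝ), ?_, ?_⟩
      · rw [dist_eq_norm, add_sub_cancel_left, UnitAddCircle.norm_coe, abs_of_nonneg hr]
        rw [abs_of_nonneg hr]; linarith
      · rw [dist_eq_norm, add_sub_add_left_eq_sub, ← AddCircle.coe_sub, UnitAddCircle.norm_coe,
          abs_of_nonpos (by linarith)]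
        · ring
        · rw [abs_of_nonpos (by linarith)]; linarith
    · refine ⟨x + ((-r : ℝ) : UnitAddCircle), ?_, ?_⟩
      · rw [dist_eq_norm, add_sub_cancel_left, UnitAddCircle.norm_coe, abs_neg, abs_of_nonneg hr]
        rw [abs_neg, abs_of_nonneg hr]; linarith
      · rw [dist_eq_norm, add_sub_add_left_eq_sub, ← AddCircle.coe_sub, UnitAddCircle.norm_coe,
          abs_of_nonneg (by linarith)]
        · ring
        · rw [abs_of_nonneg (by linarith)]; linarith
  fold x s hs := by
    obtain ⟨d, hd, rfl, h⟩ := UnitAddCircle.exists_eq_add_coe x s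
    have hd0 : 0 < |d| := h ▸ dist_pos.2 hs
    rcases hd.eq_or_lt with hd | hd
    · refine Eventually.of_forall fun t => ?_
      obtain ⟨e, he, rfl, h'⟩ := UnitAddCircle.exists_eq_add_coe (x + (d : ℝ)) t
      rw [h', h, dist_eq_norm, add_assoc, add_sub_cancel_left, ← AddCircle.coe_add,
        UnitAddCircle.norm_coe_add_of_abs_eq hd he, hd, sub_sub_cancel_left, abs_neg, abs_abs]
    · filter_upwards [Metric.ball_mem_nhds (x + (d : ℝ)) (lt_min hd0 (sub_pos.2 hd))] with t ht
      obtain ⟨e, he, rfl, h'⟩ := UnitAddCircle.exists_eq_add_coe (x + (d : ℝ)) t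
      rw [Metric.mem_ball, h', lt_min_iff] at ht
      rw [h', h, dist_eq_norm, add_assoc, add_sub_cancel_left, ← AddCircle.coe_add,
        UnitAddCircle.norm_coe ((abs_add_le _ _).trans (by linarith)), abs_sub_eq_of_abs_lt] <;>
        rw [add_sub_cancel_left]
      exact ht.1
  finiteSpheres := UnitAddCircle.hasFiniteSpheres

/-! ### Homeomorphisms described by portraits -/

/-- A portrait `A` assigns to every finite sequence `l` a permutation `A l` of `M`, which acts on
the coordinate that follows the coordinates `l`. Coherence expresses the compatibility with the
neighbourhoods in the towers. -/
structure IsCoherent {M : Type u} [MetricSpace M] (g : ℝ → M) (A : List M → Equiv.Perm M) :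
    Prop where
  continuous : ∀ l, Continuous (A l)
  near : ∀ l t, ∀ᶠ s in 𝓝 t, s ≠ t →
    g (dist (A l s) (A l t)) = A (l ++ [t]) (g (dist s t)) ∧
      ∀ l', A (l ++ s :: l') = A (l ++ t :: g (dist s t) :: l')

theorem IsCoherent.cons {M : Type u} [MetricSpace M] {g : ℝ → M} {A : List M → Equiv.Perm M}
    (hA : IsCoherent g A) (x : M) : IsCoherent g fun l => A (x :: l) :=
  ⟨fun l => hA.continuous (x :: l), fun l t => hA.near (x :: l) t⟩

namespace ResolutionTower

variable {M : Type u} {g : ℝ → M} {n : ℕ}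

/-- The action of a portrait on the towers:
`(p₀, p₁, p₂, …) ↦ (A [] p₀, A [p₀] p₁, A [p₀, p₁] p₂, …)`. -/
def act : {n : ℕ} → (List M → Equiv.Perm M) → ResolutionTower g n → ResolutionTower g n
  | 0, _, p => p
  | _ + 1, A, p => cons (A [] p.head) (act (fun l => A (p.head :: l)) p.tail)

theorem head_act (A : List M → Equiv.Perm M) (p : ResolutionTower g (n + 1)) :
    (act A p).head = A [] p.head := rfl

theorem tail_act (A : List M → Equiv.Perm M) (p : ResolutionTower g (n + 1)) :
    (act A p).tail = act (fun l => A (p.head :: l)) p.tail := rfl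

theorem act_injective (A : List M → Equiv.Perm M) :
    Function.Injective (act A : ResolutionTower g n → ResolutionTower g n) := by
  induction n generalizing A with
  | zero => exact fun _ _ h => h
  | succ n ih =>
    intro p q h
    have hh : p.head = q.head := (A []).injective (congr_arg head h)
    have ht : (act A p).tail = (act A q).tail := congr_arg tail h
    rw [tail_act, tail_act, hh] at ht
    exact ext_head_tail hh (ih _ ht)

theorem act_surjective (A : List M → Equiv.Perm M) :
    Function.Surjective (act A : ResolutionTower g n → ResolutionTower g n) := by
  induction n generalizing A with
  | zero => exact fun p => ⟨p, rfl⟩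
  | succ n ih =>
    intro q
    obtain ⟨x, hx⟩ := (A []).surjective q.head
    obtain ⟨w, hw⟩ := ih (fun l => A (x :: l)) q.tail
    exact ⟨cons x w, ext_head_tail hx hw⟩

theorem bonding_act (A : List M → Equiv.Perm M) (p : ResolutionTower g (n + 1)) :
    bonding g n (act A p) = act A (bonding g n p) := by
  induction n generalizing A with
  | zero => exact Subsingleton.elim _ _
  | succ n ih => exact ext_head_tail rfl (ih (fun l => A (p.head :: l)) p.tail)

/-- If the first `k` coordinates are equal to `z`, and are fixed by the portrait, then the next one
is acted upon by the permutation at the sequence `z, …, z`. -/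
theorem act_apply_of_eq {z : M} (A : List M → Equiv.Perm M) (p : ResolutionTower g n) {k : ℕ}
    (hp : ∀ i : Fin n, (i : ℕ) < k → p i = z) (i : Fin n) (hi : (i : ℕ) ≤ k) :
    act A p i = A (List.replicate i z) (p i) := by
  induction n generalizing A k with
  | zero => exact i.elim0
  | succ n ih =>
    rcases Fin.eq_zero_or_eq_succ i with rfl | ⟨j, rfl⟩
    · rfl
    · rw [Fin.val_succ] at hi
      have hz : p.head = z := hp 0 (by simp; omega)
      have := ih (fun l => A (z :: l)) p.tail (k := k - 1)
        (fun i hi => hp i.succ (by rw [Fin.val_succ]; omega)) j (by omega)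
      rw [Fin.val_succ, List.replicate_succ, ← hz] at *
      exact this

variable [MetricSpace M]

theorem continuous_act (hg : IsResolving g) {A : List M → Equiv.Perm M} (hA : IsCoherent g A) :
    Continuous (act A : ResolutionTower g n → ResolutionTower g n) := by
  induction n generalizing A with
  | zero => exact continuous_id
  | succ n ih =>
    rw [continuous_iff_continuousAt]
    intro q
    rw [ContinuousAt, tendsto_nhds_iff hg]
    refine ⟨((hA.continuous []).comp continuous_head).tendsto q, ?_⟩
    have h1 := ((ih (hA.cons q.head)).comp (continuous_retr hg q.head)).tendsto q
    rw [Function.comp_apply, retr_of_head_eq rfl, ← tail_act] at h1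
    refine h1.congr' ?_
    filter_upwards [continuous_head.tendsto q |>.eventually (hA.near [] q.head)] with p hp
    rw [head_act, Function.comp_apply]
    by_cases hpq : p.head = q.head
    · rw [retr_of_head_eq hpq, retr_of_head_eq (by rw [head_act, hpq]), tail_act, hpq]
    · obtain ⟨h2, h3⟩ := hp hpq
      rw [retr_of_head_ne hpq,
        retr_of_head_ne (by rw [head_act]; exact fun h => hpq ((A []).injective h))]
      rcases n with _ | n
      · exact Subsingleton.elim _ _
      · refine ext_head_tail ?_ ?_
        · rw [head_act, head_push, head_push, head_act, h2]
          rfl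
        · rw [tail_act, tail_push, tail_push, head_push, tail_act, bonding_act]
          congr 1
          funext l
          exact (h3 l).symm

/-- A coherent portrait acts by homeomorphisms. -/
theorem exists_homeomorph_act [CompactSpace M] (hg : IsResolving g) {A : List M → Equiv.Perm M}
    (hA : IsCoherent g A) (n : ℕ) :
    ∃ h : ResolutionTower g n ≃ₜ ResolutionTower g n, ∀ p, h p = act A p := by
  have := compactSpace hg n
  have := t2Space hg n
  exact ⟨Continuous.homeoOfEquivCompactToT2 (f := Equiv.ofBijective (act A)
    ⟨act_injective A, act_surjective A⟩) (continuous_act hg hA), fun p => rfl⟩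

/-- The towers are homogeneous if for every `k` there are coherent portraits that fix the sequence
`z, …, z` of length `k` and move the next coordinate to `z`. -/
theorem isHomogeneousSpace [CompactSpace M] (hg : IsResolving g) (z : M)
    (h : ∀ (k : ℕ) (a : M), ∃ A, IsCoherent g A ∧ (∀ j < k, A (List.replicate j z) z = z) ∧
      A (List.replicate k z) a = z) (n : ℕ) : IsHomogeneousSpace (ResolutionTower g n) := by
  have key : ∀ (k : ℕ) (p : ResolutionTower g n), ∃ e : ResolutionTower g n ≃ₜ ResolutionTower g n,
      ∀ i : Fin n, (i : ℕ) < k → e p i = z := by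
    intro k p
    induction k with
    | zero => exact ⟨.refl _, fun i hi => by omega⟩
    | succ k ih =>
      obtain ⟨e, he⟩ := ih
      by_cases hk : k < n
      · obtain ⟨A, hA, hAz, hAk⟩ := h k (e p ⟨k, hk⟩)
        obtain ⟨e', he'⟩ := exists_homeomorph_act hg hA n
        refine ⟨e.trans e', fun i hi => ?_⟩
        rw [Homeomorph.trans_apply, he', act_apply_of_eq A (e p) he i (by omega)]
        rcases (show (i : ℕ) < k ∨ (i : ℕ) = k by omega) with hi | hi
        · rw [he i hi, hAz _ hi]
        · obtain rfl : i = ⟨k, hk⟩ := Fin.ext hi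
          exact hAk
      · exact ⟨e, fun i hi => he i (by omega)⟩
  intro p q
  obtain ⟨e, he⟩ := key n p
  obtain ⟨e', he'⟩ := key n q
  refine ⟨e.trans e'.symm, ?_⟩
  rw [Homeomorph.trans_apply, Homeomorph.symm_apply_eq]
  exact funext fun i => (he i i.2).trans (he' i i.2).symm

end ResolutionTower

/-- If `η` fixes `z`, and `A` describes how `η` acts on the distances to `z`, then there is a
portrait that acts by `η` on the first coordinate and by `A` over `z`. -/
theorem IsCoherent.exists_lift {M : Type u} [MetricSpace M] {g : ℝ → M} (hg : IsResolving g)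
    {A : List M → Equiv.Perm M} (hA : IsCoherent g A) {z : M} {η : Equiv.Perm M}
    (hη : Continuous η) (hz : η z = z)
    (h : ∀ s, s ≠ z → g (dist (η s) z) = A [] (g (dist s z))) :
    ∃ B, IsCoherent g B ∧ B [] = η ∧ ∀ l, B (z :: l) = A l := by
  classical
  let B : List M → Equiv.Perm M := fun l => match l with
    | [] => η
    | s :: l => if s = z then A l else A (g (dist s z) :: l)
  have hBz : ∀ l, B (z :: l) = A l := fun l => if_pos rfl
  have hBs : ∀ s l, s ≠ z → B (s :: l) = A (g (dist s z) :: l) := fun s l hs => if_neg hs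
  refine ⟨B, ⟨?_, ?_⟩, rfl, hBz⟩
  · rintro (_ | ⟨s, l⟩)
    · exact hη
    · by_cases hs : s = z
      · rw [hs, hBz]; exact hA.continuous _
      · rw [hBs _ _ hs]; exact hA.continuous _
  · rintro (_ | ⟨x, l⟩) t
    · by_cases ht : t = z
      · subst ht
        refine Eventually.of_forall fun s hs => ⟨?_, fun l' => ?_⟩
        · rw [List.nil_append, hBz, ← h s hs]
          change g (dist (η s) (η t)) = _
          rw [hz]
        · rw [List.nil_append, List.nil_append, hBz, hBs _ _ hs]
      · have hηt : η t ≠ z := fun h => ht (η.injective (h.trans hz.symm))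
        have hne : ∀ᶠ s in 𝓝 t, s ≠ z := isOpen_ne.mem_nhds ht
        filter_upwards [hne, hg.eventually_dist ht, (hη.tendsto t).eventually
          (hg.eventually_dist hηt), (hg.tendsto_dist ht).eventually (hA.near [] _)]
          with s hs h1 h2 h3 hst
        obtain ⟨h1, h1'⟩ := h1 hst
        obtain ⟨-, h2⟩ := h2 (fun h => hst (η.injective h))
        obtain ⟨h3, h3'⟩ := h3 h1
        refine ⟨?_, fun l' => ?_⟩
        · rw [List.nil_append, hBs _ _ ht]
          change g (dist (η s) (η t)) = _
          rw [← h2, h s hs, h t ht, h3, h1']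
          rfl
        · rw [List.nil_append, List.nil_append, hBs _ _ hs, hBs _ _ ht]
          exact (h3' l').trans (by rw [h1']; rfl)
    · by_cases hx : x = z
      · subst hx
        simpa only [List.cons_append, hBz] using hA.near l t
      · simpa only [List.cons_append, hBs _ _ hx] using hA.near (g (dist x z) :: l) t

/-- A portrait that acts by `η` on the first coordinate, by the isometry `ρ` on the second one over
`z`, and trivially elsewhere. -/
theorem IsCoherent.exists_of_isometry {M : Type u} [MetricSpace M] {g : ℝ → M} {z : M}
    {η ρ : Equiv.Perm M} (hη : Continuous η) (hz : η z = z) (hρ : Isometry ρ)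
    (h : ∀ᶠ s in 𝓝 z, s ≠ z → g (dist (η s) z) = ρ (g (dist s z)))
    (h' : ∀ t, t ≠ z → ∀ᶠ s in 𝓝 t, s ≠ t → g (dist (η s) (η t)) = g (dist s t)) :
    ∃ B, IsCoherent g B ∧ B [] = η ∧ B [z] = ρ := by
  classical
  let B : List M → Equiv.Perm M := fun l => match l with
    | [] => η
    | [s] => if s = z then ρ else 1
    | _ => 1
  have hBz : B [z] = ρ := if_pos rfl
  have hBs : ∀ s l, s ≠ z → B (s :: l) = 1 := fun s l hs => by
    rcases l with _ | ⟨y, l⟩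
    · exact if_neg hs
    · rfl
  have hiso : ∀ x l, Isometry (B (x :: l)) := fun x l => by
    by_cases hx : x = z
    · rcases l with _ | ⟨y, l⟩
      · rw [hx, hBz]; exact hρ
      · exact isometry_id
    · rw [hBs x l hx]; exact isometry_id
  refine ⟨B, ⟨?_, ?_⟩, rfl, hBz⟩
  · rintro (_ | ⟨x, l⟩)
    · exact hη
    · exact (hiso x l).continuous
  · rintro (_ | ⟨x, l⟩) t
    · by_cases ht : t = z
      · subst ht
        filter_upwards [h] with s h hs
        refine ⟨?_, fun l' => ?_⟩
        · rw [List.nil_append, hBz, ← h hs]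
          change g (dist (η s) (η t)) = _
          rw [hz]
        · exact hBs s l' hs
      · have hne : ∀ᶠ s in 𝓝 t, s ≠ z := isOpen_ne.mem_nhds ht
        filter_upwards [hne, h' t ht] with s hs h' hst
        refine ⟨?_, fun l' => ?_⟩
        · exact (h' hst).trans (by rw [show B ([] ++ [t]) = 1 from hBs t [] ht]; rfl)
        · exact hBs s l' hs
    · refine Eventually.of_forall fun s hs => ⟨?_, fun l' => ?_⟩
      · rw [(hiso x l).dist_eq]
        rcases l with _ | ⟨y, l⟩ <;> rfl
      · rcases l with _ | ⟨y, l⟩ <;> rfl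

theorem IsCoherent.of_isometry {M : Type u} [MetricSpace M] {g : ℝ → M} {ρ : Equiv.Perm M}
    (hρ : Isometry ρ) : ∃ B, IsCoherent g B ∧ B [] = ρ := by
  let B : List M → Equiv.Perm M := fun l => match l with
    | [] => ρ
    | _ => 1
  have hiso : ∀ l, Isometry (B l) := fun l => by
    rcases l with _ | ⟨x, l⟩
    · exact hρ
    · exact isometry_id
  refine ⟨B, ⟨fun l => (hiso l).continuous, fun l t => Eventually.of_forall fun s _ => ⟨?_, fun l' =>
    ?_⟩⟩, rfl⟩
  · rw [(hiso l).dist_eq]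
    rcases l with _ | ⟨x, l⟩ <;> rfl
  · rcases l with _ | ⟨x, l⟩ <;> rfl

/-! ### Homogeneity of the circle towers -/

/-- The piecewise affine function `y ↦ 2 ^ ⌊y⌋ * (1 + Int.fract y)`. -/
noncomputable def dyadicExpFun (y : ℝ) : ℝ := 2 ^ ⌊y⌋ * (1 + Int.fract y)

theorem dyadicExpFun_pos (y : ℝ) : 0 < dyadicExpFun y := by
  have := Int.fract_nonneg y
  exact mul_pos (by positivity) (by linarith)

theorem strictMono_dyadicExpFun : StrictMono dyadicExpFun := by
  intro y z hyz
  have hy := Int.fract_lt_one y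
  have hz := Int.fract_nonneg z
  rcases (Int.floor_mono hyz.le).eq_or_lt with h | h
  · rw [dyadicExpFun, dyadicExpFun, h]
    have : Int.fract y < Int.fract z := by
      rw [Int.fract, Int.fract, h]; linarith
    gcongr
  · calc dyadicExpFun y < 2 ^ ⌊y⌋ * 2 := by
          rw [dyadicExpFun]; gcongr; linarith
      _ = 2 ^ (⌊y⌋ + 1) := (zpow_add_one₀ two_ne_zero _).symm
      _ ≤ 2 ^ ⌊z⌋ := zpow_le_zpow_right₀ one_le_two (by omega)
      _ ≤ dyadicExpFun z := by
          rw [dyadicExpFun]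
          exact le_mul_of_one_le_right (by positivity) (by linarith)

theorem exists_dyadicExpFun_eq {r : ℝ} (hr : 0 < r) : ∃ y, dyadicExpFun y = r := by
  obtain ⟨k, m, h1, h2, rfl⟩ := exists_eq_zpow_mul hr
  have h : ⌊(k : ℝ) + (m - 1)⌋ = k := by
    rw [Int.floor_eq_iff]; constructor <;> linarith
  refine ⟨k + (m - 1), ?_⟩
  rw [dyadicExpFun, Int.fract, h]
  congr 1
  ring

theorem dyadicExpFun_add_one (y : ℝ) : dyadicExpFun (y + 1) = 2 * dyadicExpFun y := by
  rw [dyadicExpFun, dyadicExpFun, Int.floor_add_one, Int.fract_add_one, zpow_add_one₀ two_ne_zero]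
  ring

theorem dyadicExpFun_neg_one : dyadicExpFun (-1) = 1 / 2 := by
  have h : ⌊(-1 : ℝ)⌋ = -1 := by exact_mod_cast Int.floor_intCast (R := ℝ) (-1)
  rw [dyadicExpFun, Int.fract, h]
  norm_num

theorem winding_dyadicExpFun (y : ℝ) : winding (dyadicExpFun y) = (y : UnitAddCircle) := by
  have h0 := Int.fract_nonneg y
  have h1 := Int.fract_lt_one y
  rw [coe_dyadicMantissa_sub_one, dyadicExpFun,
    dyadicMantissa_zpow_mul _ (by linarith) (by linarith), add_sub_cancel_left]
  exact AddCircle.coe_fract y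

/-- The function on `ℝ` that is conjugate, on `(0, ∞)`, to `φ` under `dyadicExpFun`, and is the
identity on `(-∞, 0]`. -/
theorem exists_conj_dyadicExpFun (φ : ℝ ≃o ℝ) :
    ∃ F : ℝ ≃o ℝ, (∀ y, F (dyadicExpFun y) = dyadicExpFun (φ y)) ∧ ∀ r ≤ 0, F r = r := by
  choose! L hL using fun (r : ℝ) (hr : 0 < r) => exists_dyadicExpFun_eq hr
  have hLe : ∀ y, L (dyadicExpFun y) = y := fun y =>
    strictMono_dyadicExpFun.injective (hL _ (dyadicExpFun_pos y))
  let f : (ℝ ≃o ℝ) → ℝ → ℝ := fun φ r => if 0 < r then dyadicExpFun (φ (L r)) else r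
  -- `L` is the inverse of `dyadicExpFun`
  have hf1 : ∀ φ y, f φ (dyadicExpFun y) = dyadicExpFun (φ y) := fun φ y => by
    simp only [f]
    rw [if_pos (dyadicExpFun_pos y), hLe]
  have hf0 : ∀ φ, ∀ r ≤ 0, f φ r = r := fun φ r hr => if_neg hr.not_gt
  have hmono : StrictMono (f φ) := by
    intro r s hrs
    rcases le_or_gt s 0 with hs | hs
    · rwa [hf0 φ r (hrs.le.trans hs), hf0 φ s hs]
    · obtain ⟨z, rfl⟩ := exists_dyadicExpFun_eq hs
      rw [hf1]
      rcases le_or_gt r 0 with hr | hr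
      · rw [hf0 φ r hr]
        exact hr.trans_lt (dyadicExpFun_pos _)
      · obtain ⟨y, rfl⟩ := exists_dyadicExpFun_eq hr
        rw [hf1]
        exact strictMono_dyadicExpFun (φ.strictMono (strictMono_dyadicExpFun.lt_iff_lt.1 hrs))
  have hinv : Function.RightInverse (f φ.symm) (f φ) := by
    intro r
    rcases le_or_gt r 0 with hr | hr
    · rw [hf0 _ r hr, hf0 _ r hr]
    · obtain ⟨y, rfl⟩ := exists_dyadicExpFun_eq hr
      rw [hf1, hf1, φ.apply_symm_apply]
  exact ⟨hmono.orderIsoOfRightInverse _ _ hinv, hf1 φ, hf0 φ⟩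

/-- `η` is the transformation of the circle that changes the distance to `0` by the increasing
function `F` and commutes with the reflection. -/
structure IsRadial (η : Equiv.Perm UnitAddCircle) (F : ℝ ≃o ℝ) : Prop where
  continuous : Continuous η
  apply_coe : ∀ u : ℝ, 0 ≤ u → u ≤ 1 / 2 → η (u : UnitAddCircle) = (F u : ℝ)
  apply_coe_neg : ∀ u : ℝ, 0 ≤ u → u ≤ 1 / 2 →
    η ((-u : ℝ) : UnitAddCircle) = ((-F u : ℝ) : UnitAddCircle)
  map_zero : F 0 = 0
  map_half : F (1 / 2) = 1 / 2

/-- The odd extension of `F` on `[-1/2, 1/2]` descends to the circle. -/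
theorem exists_isRadial {F : ℝ ≃o ℝ} (h0 : F 0 = 0) (h1 : F (1 / 2) = 1 / 2) :
    ∃ η, IsRadial η F := by
  let G : (ℝ ≃o ℝ) → ℝ → ℝ := fun F u => max (F u) 0 - max (F (-u)) 0
  have hGp : ∀ F : ℝ ≃o ℝ, F 0 = 0 → ∀ u, 0 ≤ u → G F u = F u := fun F h0 u hu => by
    have h1 : 0 ≤ F u := h0 ▸ F.monotone hu
    have h2 : F (-u) ≤ 0 := h0 ▸ F.monotone (neg_nonpos.2 hu)
    simp only [G]
    rw [max_eq_left h1, max_eq_right h2, sub_zero]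
  have hGn : ∀ F : ℝ ≃o ℝ, ∀ u, G F (-u) = -G F u := fun F u => by
    simp only [G]
    rw [neg_neg]
    ring
  have hGc : ∀ F : ℝ ≃o ℝ, Continuous (G F) := fun F =>
    (F.continuous.max continuous_const).sub ((F.continuous.comp continuous_neg).max continuous_const)
  have hGle : ∀ F : ℝ ≃o ℝ, F 0 = 0 → F (1 / 2) = 1 / 2 → ∀ u, |u| ≤ 1 / 2 → |G F u| ≤ 1 / 2 := by
    intro F h0 h1 u hu
    rcases abs_cases u with ⟨h, h'⟩ | ⟨h, h'⟩ <;> rw [h] at hu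
    · rw [hGp F h0 u h', abs_of_nonneg (h0 ▸ F.monotone h')]
      exact h1 ▸ F.monotone hu
    · rw [← abs_neg, ← hGn, hGp F h0 _ (by linarith),
        abs_of_nonneg (h0 ▸ F.monotone (by linarith : 0 ≤ -u))]
      exact h1 ▸ F.monotone hu
  have hGinv : ∀ F : ℝ ≃o ℝ, F 0 = 0 → ∀ u, G F.symm (G F u) = u := by
    intro F h0 u
    have h0' : F.symm 0 = 0 := by rw [OrderIso.symm_apply_eq, h0]
    rcases le_total 0 u with hu | hu
    · rw [hGp F h0 u hu, hGp F.symm h0' _ (h0 ▸ F.monotone hu), F.symm_apply_apply]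
    · have hu' : 0 ≤ -u := by linarith
      rw [← neg_neg u, hGn F, hGn F.symm, hGp F h0 _ hu', hGp F.symm h0' _ (h0 ▸ F.monotone hu'),
        F.symm_apply_apply]
  let η : (ℝ ≃o ℝ) → UnitAddCircle → UnitAddCircle := fun F =>
    AddCircle.liftIco 1 (-(1 / 2)) fun u => ((G F u : ℝ) : UnitAddCircle)
  have hη : ∀ F : ℝ ≃o ℝ, F 0 = 0 → F (1 / 2) = 1 / 2 → ∀ u : ℝ, |u| ≤ 1 / 2 →
      η F (u : UnitAddCircle) = (G F u : ℝ) := by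
    intro F h0 h1 u hu
    rw [abs_le] at hu
    have hper : ((1 / 2 : ℝ) : UnitAddCircle) = ((-(1 / 2) : ℝ) : UnitAddCircle) := by
      have : ((-(1 / 2) + 1 : ℝ) : UnitAddCircle) = ((-(1 / 2) : ℝ) : UnitAddCircle) := by
        rw [AddCircle.coe_add, UnitAddCircle.coe_one, add_zero]
      rw [← this]; norm_num
    have hin : ∀ u : ℝ, -(1 / 2) ≤ u → u < 1 / 2 → η F (u : UnitAddCircle) = (G F u : ℝ) :=
      fun u h h' => AddCircle.liftIco_coe_apply ⟨h, by linarith⟩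
    rcases hu.2.eq_or_lt with rfl | hu2
    · rw [hper, hin _ le_rfl (by norm_num), hGn, hGp F h0 _ (by norm_num), h1, hper]
    · exact hin u hu.1 hu2
  have h0' : F.symm 0 = 0 := by rw [OrderIso.symm_apply_eq, h0]
  have h1' : F.symm (1 / 2) = 1 / 2 := by rw [OrderIso.symm_apply_eq, h1]
  refine ⟨⟨η F, η F.symm, fun s => ?_, fun s => ?_⟩, ?_, fun u hu hu' => ?_, fun u hu hu' => ?_,
    h0, h1⟩
  · obtain ⟨u, hu, rfl⟩ := UnitAddCircle.exists_coe_eq s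
    rw [hη F h0 h1 u hu, hη _ h0' h1' _ (hGle F h0 h1 u hu), hGinv F h0]
  · obtain ⟨u, hu, rfl⟩ := UnitAddCircle.exists_coe_eq s
    have := hGinv F.symm h0' u
    rw [OrderIso.symm_symm] at this
    rw [hη _ h0' h1' u hu, hη F h0 h1 _ (hGle _ h0' h1' u hu), this]
  · refine AddCircle.liftIco_continuous ?_
      ((AddCircle.continuous_mk' _).comp (hGc F)).continuousOn
    have : (-(1 / 2) + 1 : ℝ) = 1 / 2 := by norm_num
    rw [this]
    change ((G F (-(1 / 2)) : ℝ) : UnitAddCircle) = ((G F (1 / 2) : ℝ) : UnitAddCircle)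
    rw [hGn, hGp F h0 _ (by norm_num), h1]
    have : ((-(1 / 2) + 1 : ℝ) : UnitAddCircle) = ((-(1 / 2) : ℝ) : UnitAddCircle) := by
      rw [AddCircle.coe_add, UnitAddCircle.coe_one, add_zero]
    rw [← this]; norm_num
  · exact (hη F h0 h1 u (abs_le.2 ⟨by linarith, hu'⟩)).trans (by rw [hGp F h0 u hu])
  · refine (hη F h0 h1 (-u) (abs_le.2 ⟨by linarith, by linarith⟩)).trans ?_
    rw [hGn, hGp F h0 u hu]

namespace IsRadial

variable {η : Equiv.Perm UnitAddCircle} {F : ℝ ≃o ℝ}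

theorem apply_zero (h : IsRadial η F) : η 0 = 0 := by
  have := h.apply_coe 0 le_rfl (by norm_num)
  rwa [h.map_zero, AddCircle.coe_zero] at this

theorem dist_apply (h : IsRadial η F) (s : UnitAddCircle) : dist (η s) 0 = F (dist s 0) := by
  obtain ⟨u, hu, rfl⟩ := UnitAddCircle.exists_coe_eq s
  have key : ∀ u : ℝ, 0 ≤ u → u ≤ 1 / 2 → |F u| ≤ 1 / 2 ∧ |F u| = F u := fun u hu hu' => by
    have h0 : 0 ≤ F u := h.map_zero ▸ F.monotone hu
    rw [abs_of_nonneg h0]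
    exact ⟨h.map_half ▸ F.monotone hu', rfl⟩
  rw [dist_zero_right, dist_zero_right, UnitAddCircle.norm_coe hu]
  rcases abs_cases u with ⟨h', hu'⟩ | ⟨h', hu'⟩ <;> rw [h'] at hu ⊢
  · rw [h.apply_coe u hu' hu, UnitAddCircle.norm_coe (key u hu' hu).1, (key u hu' hu).2]
  · obtain ⟨h1, h2⟩ := key (-u) (by linarith) hu
    have := h.apply_coe_neg (-u) (by linarith) hu
    rw [neg_neg] at this
    rw [this, UnitAddCircle.norm_coe (by rwa [abs_neg]), abs_neg, h2]

/-- Every radial transformation `η` is induced by another one through the winding map. -/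
theorem exists_lift (h : IsRadial η F) : ∃ (η' : Equiv.Perm UnitAddCircle) (F' : ℝ ≃o ℝ),
    IsRadial η' F' ∧ ∀ s, s ≠ 0 → winding (dist (η' s) 0) = η (winding (dist s 0)) := by
  -- the lift of `η` to the unit interval
  have hhalf : ∀ F : ℝ ≃o ℝ, F (1 / 2) = 1 / 2 → StrictMono
      fun x => if x ≤ 1 / 2 then F x else 1 - F (1 - x) := fun F h1 x y hxy => by
    have key : ∀ x, 1 / 2 < x → F (1 - x) < 1 / 2 := fun x hx => by
      have := F.strictMono (show 1 - x < 1 / 2 by linarith)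
      rwa [h1] at this
    simp only
    split_ifs with hx hy hy
    · exact F.strictMono hxy
    · have := key y (not_le.1 hy)
      have := F.monotone hx
      rw [h1] at this
      linarith
    · linarith
    · have := F.strictMono (show 1 - y < 1 - x by linarith)
      linarith
  obtain ⟨f, hf⟩ : ∃ f : ℝ ≃o ℝ, ∀ x, f x = if x ≤ 1 / 2 then F x else 1 - F (1 - x) := by
    refine ⟨(hhalf F h.map_half).orderIsoOfRightInverse _
      (fun x => if x ≤ 1 / 2 then F.symm x else 1 - F.symm (1 - x)) fun x => ?_, fun x => rfl⟩
    have h1' : F.symm (1 / 2) = 1 / 2 := by rw [OrderIso.symm_apply_eq, h.map_half]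
    simp only
    by_cases hx : x ≤ 1 / 2
    · have : F.symm x ≤ 1 / 2 := h1' ▸ F.symm.monotone hx
      rw [if_pos hx, if_pos this, F.apply_symm_apply]
    · have : F.symm (1 - x) < F.symm (1 / 2) := F.symm.strictMono (by linarith)
      rw [h1'] at this
      rw [if_neg hx, if_neg (by linarith), sub_sub_cancel, F.apply_symm_apply, sub_sub_cancel]
  have hf0 : f 0 = 0 := by rw [hf, if_pos (by norm_num), h.map_zero]
  have hf1 : f 1 = 1 := by rw [hf, if_neg (by norm_num), sub_self, h.map_zero, sub_zero]
  have hfη : ∀ x : ℝ, 0 ≤ x → x ≤ 1 → η (x : UnitAddCircle) = (f x : ℝ) := by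
    intro x hx hx'
    rw [hf]
    split_ifs with hx2
    · exact h.apply_coe x hx hx2
    · have hcoe : ∀ x : ℝ, ((1 - x : ℝ) : UnitAddCircle) = ((-x : ℝ) : UnitAddCircle) := fun x => by
        rw [sub_eq_add_neg, AddCircle.coe_add, UnitAddCircle.coe_one, zero_add]
      have := h.apply_coe_neg (1 - x) (by linarith) (by linarith)
      rwa [← hcoe, ← hcoe, sub_sub_cancel] at this
  -- the lift of `η` to the real line
  have hmem : ∀ f : ℝ ≃o ℝ, f 0 = 0 → f 1 = 1 → ∀ y,
      0 ≤ f (Int.fract y) ∧ f (Int.fract y) < 1 := fun f hf0 hf1 y => by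
    have h1 := f.monotone (Int.fract_nonneg y)
    have h2 := f.strictMono (Int.fract_lt_one y)
    rw [hf0] at h1
    rw [hf1] at h2
    exact ⟨h1, h2⟩
  have hper : ∀ f : ℝ ≃o ℝ, f 0 = 0 → f 1 = 1 → ∀ y,
      ⌊(⌊y⌋ : ℝ) + f (Int.fract y)⌋ = ⌊y⌋ ∧ Int.fract ((⌊y⌋ : ℝ) + f (Int.fract y)) =
        f (Int.fract y) := fun f hf0 hf1 y => by
    obtain ⟨h1, h2⟩ := hmem f hf0 hf1 y
    rw [Int.floor_intCast_add, Int.fract_intCast_add, Int.fract_eq_self.2 ⟨h1, h2⟩,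
      Int.floor_eq_zero_iff.2 ⟨h1, h2⟩, add_zero]
    exact ⟨rfl, rfl⟩
  obtain ⟨φ, hφ⟩ : ∃ φ : ℝ ≃o ℝ, ∀ y, φ y = ⌊y⌋ + f (Int.fract y) := by
    refine ⟨StrictMono.orderIsoOfRightInverse (fun y : ℝ => (⌊y⌋ : ℝ) + f (Int.fract y)) ?_
      (fun y => ⌊y⌋ + f.symm (Int.fract y)) fun y => ?_, fun y => rfl⟩
    · intro y z hyz
      simp only
      obtain ⟨-, h1⟩ := hmem f hf0 hf1 y
      obtain ⟨h2, -⟩ := hmem f hf0 hf1 z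
      rcases (Int.floor_mono hyz.le).eq_or_lt with hyz' | hyz'
      · rw [hyz']
        gcongr
        rw [Int.fract, Int.fract, hyz']
        linarith
      · have : (⌊y⌋ : ℝ) + 1 ≤ ⌊z⌋ := by exact_mod_cast hyz'
        linarith
    · obtain ⟨h1, h2⟩ := hper f.symm (by rw [OrderIso.symm_apply_eq, hf0])
        (by rw [OrderIso.symm_apply_eq, hf1]) y
      simp only
      rw [h1, h2, f.apply_symm_apply, Int.floor_add_fract]
  obtain ⟨F', hF', hF'0⟩ := exists_conj_dyadicExpFun φ
  have hh : F' (1 / 2) = 1 / 2 := by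
    have h : ⌊(-1 : ℝ)⌋ = -1 := by exact_mod_cast Int.floor_intCast (R := ℝ) (-1)
    rw [← dyadicExpFun_neg_one, hF', hφ, Int.fract, h]
    norm_num [hf0]
  obtain ⟨η', hη'⟩ := exists_isRadial (hF'0 0 le_rfl) hh
  refine ⟨η', F', hη', fun s hs => ?_⟩
  rw [hη'.dist_apply]
  obtain ⟨y, hy⟩ := exists_dyadicExpFun_eq (dist_pos.2 hs)
  rw [← hy, hF', winding_dyadicExpFun, winding_dyadicExpFun, ← AddCircle.coe_fract y,
    hfη _ (Int.fract_nonneg y) (Int.fract_lt_one y).le, ← (hper f hf0 hf1 y).2, ← hφ]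
  exact (AddCircle.coe_fract _).symm

end IsRadial

theorem exists_orderIso_min (a b : ℝ ≃o ℝ) : ∃ F : ℝ ≃o ℝ, ∀ r, F r = min (a r) (b r) := by
  refine ⟨StrictMono.orderIsoOfRightInverse (fun r => min (a r) (b r))
    (fun r s h => min_lt_min (a.strictMono h) (b.strictMono h))
    (fun r => max (a.symm r) (b.symm r)) fun r => ?_, fun r => rfl⟩
  simp only
  rcases le_total (a.symm r) (b.symm r) with h | h
  · have := a.monotone h
    rw [a.apply_symm_apply] at this
    rw [max_eq_right h, b.apply_symm_apply, min_eq_right this]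
  · have := b.monotone h
    rw [b.apply_symm_apply] at this
    rw [max_eq_left h, a.apply_symm_apply, min_eq_left this]

/-- For every `θ` there is a radial transformation that near `0` changes the winding map by a
rotation, and that elsewhere multiplies small distances by powers of two. The function `F` is the
minimum of the conjugate of a translation under `dyadicExpFun`, and of `r ↦ 1 / 4 + r / 2`, which
gives the required value at `1 / 2`. -/
theorem exists_isRadial_rotation (θ : UnitAddCircle) : ∃ (η : Equiv.Perm UnitAddCircle) (F : ℝ ≃o ℝ),
    IsRadial η F ∧
    (∀ᶠ s in 𝓝 0, s ≠ 0 → winding (dist (η s) 0) = winding (dist s 0) + θ) ∧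
    ∀ t, t ≠ 0 → ∀ᶠ s in 𝓝 t, s ≠ t → winding (dist (η s) (η t)) = winding (dist s t) := by
  obtain ⟨x, rfl⟩ := QuotientAddGroup.mk_surjective θ
  set a : ℝ := Int.fract x with ha
  have ha0 : 0 ≤ a := Int.fract_nonneg x
  have ha1 : a < 1 := Int.fract_lt_one x
  obtain ⟨R, hR, hR0⟩ := exists_conj_dyadicExpFun (OrderIso.addRight a)
  have hRw : ∀ r, 0 < r → winding (R r) = winding r + (x : UnitAddCircle) := fun r hr => by
    obtain ⟨y, rfl⟩ := exists_dyadicExpFun_eq hr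
    rw [hR, winding_dyadicExpFun, winding_dyadicExpFun, OrderIso.addRight_apply,
      AddCircle.coe_add, ← AddCircle.coe_fract x]
  have hRpos : ∀ r, 0 < r → 0 < R r := fun r hr => by
    have := R.strictMono hr
    rwa [hR0 0 le_rfl] at this
  have hRle : ∀ r, 0 < r → r ≤ R r ∧ R r ≤ 2 * r := fun r hr => by
    obtain ⟨y, rfl⟩ := exists_dyadicExpFun_eq hr
    rw [hR, ← dyadicExpFun_add_one, OrderIso.addRight_apply]
    exact ⟨strictMono_dyadicExpFun.monotone (by linarith),
      strictMono_dyadicExpFun.monotone (by linarith)⟩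
  have hRsim : ∀ r, 0 < r → ∀ᶠ s in 𝓝 r, s ≠ r → ∃ k : ℤ, |R s - R r| = 2 ^ k * |s - r| := by
    intro r hr
    obtain ⟨_, h1⟩ := isResolving_winding.similar r hr
    obtain ⟨_, h2⟩ := isResolving_winding.similar (R r) (hRpos r hr)
    filter_upwards [h1, (R.continuous.tendsto r).eventually h2, lt_mem_nhds hr] with s h1 h2 hs hsr
    obtain ⟨k, -, hk⟩ := h1 hsr
    obtain ⟨j, -, hj⟩ := h2 (fun h => hsr (R.injective h))
    rw [hRw s hs, hRw r hr, dist_add_right, hk] at hj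
    refine ⟨k - j, ?_⟩
    rw [zpow_sub₀ two_ne_zero]
    field_simp
    linarith
  obtain ⟨K, hK⟩ : ∃ K : ℝ ≃o ℝ, ∀ r, K r = 1 / 4 + r / 2 :=
    ⟨StrictMono.orderIsoOfRightInverse (fun r => 1 / 4 + r / 2) (fun r s h => by
      simp only; linarith) (fun r => 2 * (r - 1 / 4)) fun r => by simp only; ring, fun r => rfl⟩
  obtain ⟨F, hF⟩ := exists_orderIso_min R K
  have hFR : ∀ r, 0 < r → r < 1 / 8 → F r = R r := fun r hr hr' => by
    rw [hF, min_eq_left]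
    have := (hRle r hr).2
    rw [hK]
    linarith
  have hFsim : ∀ r, 0 < r → ∀ᶠ s in 𝓝 r, s ≠ r → ∃ k : ℤ, |F s - F r| = 2 ^ k * |s - r| := by
    intro r hr
    have hKsim : ∀ s, |K s - K r| = 2 ^ (-1 : ℤ) * |s - r| := fun s => by
      rw [hK, hK, show 1 / 4 + s / 2 - (1 / 4 + r / 2) = 2 ^ (-1 : ℤ) * (s - r) by norm_num; ring,
        abs_mul, abs_of_pos (by positivity : (0 : ℝ) < 2 ^ (-1 : ℤ))]
    rcases lt_trichotomy (R r) (K r) with h | h | h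
    · filter_upwards [hRsim r hr, (isOpen_lt R.continuous K.continuous).mem_nhds h] with s h1 h2 hs
      rw [hF, hF, min_eq_left h.le, min_eq_left (le_of_lt h2)]
      exact h1 hs
    · filter_upwards [hRsim r hr] with s h1 hs
      rw [hF, hF, h, min_self]
      rcases min_choice (R s) (K s) with h2 | h2 <;> rw [h2]
      · rw [← h]; exact h1 hs
      · exact ⟨-1, hKsim s⟩
    · filter_upwards [(isOpen_lt K.continuous R.continuous).mem_nhds h] with s h2 hs
      rw [hF, hF, min_eq_right h.le, min_eq_right (le_of_lt h2)]
      exact ⟨-1, hKsim s⟩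
  obtain ⟨η, hη⟩ := exists_isRadial (F := F)
    (by rw [hF, hR0 0 le_rfl, hK]; norm_num)
    (by
      have := (hRle (1 / 2) (by norm_num)).1
      rw [hF, hK, min_eq_right (by linarith)]; norm_num)
  refine ⟨η, F, hη, ?_, fun t ht => ?_⟩
  · filter_upwards [Metric.ball_mem_nhds (0 : UnitAddCircle) (by norm_num : (0 : ℝ) < 1 / 8)]
      with s hs hs0
    have hd := dist_pos.2 hs0
    rw [hη.dist_apply, hFR _ hd hs]
    exact hRw _ hd
  · have hηt : η t ≠ 0 := fun h => ht (η.injective (h.trans hη.apply_zero.symm))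
    have hdc : Tendsto (fun s => dist s 0) (𝓝 t) (𝓝 (dist t 0)) :=
      (continuous_id.dist continuous_const).tendsto t
    filter_upwards [isResolving_winding.fold 0 t ht, hdc.eventually (hFsim _ (dist_pos.2 ht)),
      (hη.continuous.tendsto t).eventually (isResolving_winding.fold 0 _ hηt)] with s h1 h2 h3 hst
    have hd : 0 < dist s t := dist_pos.2 hst
    obtain ⟨k, hk⟩ := h2 (fun h => by
      rw [h, sub_self, abs_zero] at h1
      exact hd.ne h1)
    rw [hη.dist_apply, hη.dist_apply, hk, h1] at h3
    rw [← h3, isResolving_winding.zpow_mul k hd]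

/-- A rotation of the coordinate of index `k + 1`, when all preceding ones are `0`, is realized by a
radial transformation of the coordinate of index `k`, which is in turn realized by one of index
`k - 1`, and so on. -/
theorem isHomogeneousSpace_chatyrkoCircle (n : ℕ) : IsHomogeneousSpace (ChatyrkoCircle n) := by
  have hrot : ∀ θ : UnitAddCircle, Isometry (Equiv.addRight θ) := fun θ => isometry_add_right θ
  have key : ∀ (k : ℕ) (θ : UnitAddCircle), ∃ A, IsCoherent winding A ∧
      (∀ j < k + 1, A (List.replicate j 0) 0 = 0) ∧
      (∀ a, A (List.replicate (k + 1) 0) a = a + θ) ∧ ∃ F, IsRadial (A []) F := by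
    intro k θ
    induction k with
    | zero =>
      obtain ⟨η, F, hη, h1, h2⟩ := exists_isRadial_rotation θ
      obtain ⟨B, hB, h3, h4⟩ := IsCoherent.exists_of_isometry hη.continuous hη.apply_zero (hrot θ)
        h1 h2
      refine ⟨B, hB, fun j hj => ?_, fun a => ?_, F, h3 ▸ hη⟩
      · obtain rfl : j = 0 := by omega
        rw [List.replicate_zero, h3, hη.apply_zero]
      · rw [zero_add, List.replicate_one, h4]
        rfl
    | succ k ih =>
      obtain ⟨A, hA, h1, h2, F, hF⟩ := ih
      obtain ⟨η, F', hη, h3⟩ := hF.exists_lift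
      obtain ⟨B, hB, h4, h5⟩ := hA.exists_lift isResolving_winding hη.continuous hη.apply_zero h3
      refine ⟨B, hB, fun j hj => ?_, fun a => ?_, F', h4 ▸ hη⟩
      · rcases j with _ | j
        · rw [List.replicate_zero, h4, hη.apply_zero]
        · rw [List.replicate_succ, h5]
          exact h1 j (by omega)
      · rw [List.replicate_succ, h5]
        exact h2 a
  refine ResolutionTower.isHomogeneousSpace isResolving_winding 0 (fun k a => ?_) n
  rcases k with _ | k
  · obtain ⟨B, hB, h⟩ := IsCoherent.of_isometry (g := winding) (hrot (-a))
    refine ⟨B, hB, fun j hj => by omega, ?_⟩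
    rw [List.replicate_zero, h]
    exact add_neg_cancel a
  · obtain ⟨A, hA, h1, h2, -⟩ := key k (-a)
    exact ⟨A, hA, h1, by rw [h2, add_neg_cancel]⟩

/-! ### Weak chains -/

/-- The closed sets `F 0, …, F k` cover `S`, refine `𝒰`, and only consecutive ones may meet. -/
structure IsWeakChain {X : Type u} [TopologicalSpace X] (𝒰 : Set (Set X)) (S : Set X) (k : ℕ)
    (F : ℕ → Set X) : Prop where
  isClosed : ∀ i ≤ k, IsClosed (F i)
  subset : ∀ i ≤ k, F i ⊆ S
  refines : ∀ i ≤ k, ∃ U ∈ 𝒰, F i ⊆ U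
  cover : ∀ x ∈ S, ∃ i ≤ k, x ∈ F i
  le_succ : ∀ i j x, i ≤ j → j ≤ k → x ∈ F i → x ∈ F j → j ≤ i + 1

namespace IsWeakChain

variable {X : Type u} [TopologicalSpace X] {𝒰 : Set (Set X)} {S : Set X} {k : ℕ} {F : ℕ → Set X}

theorem single {U : Set X} (hS : IsClosed S) (hU : U ∈ 𝒰) (hSU : S ⊆ U) :
    IsWeakChain 𝒰 S 0 fun _ => S where
  isClosed _ _ := hS
  subset _ _ := Subset.rfl
  refines _ _ := ⟨U, hU, hSU⟩
  cover _ hx := ⟨0, le_rfl, hx⟩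
  le_succ _ _ _ _ _ _ _ := by omega

theorem tail (h : IsWeakChain 𝒰 S (k + 1) F) (hc : ∀ x ∈ F 0, ∃ i ≤ k, x ∈ F (i + 1)) :
    IsWeakChain 𝒰 S k fun i => F (i + 1) where
  isClosed i hi := h.isClosed _ (by omega)
  subset i hi := h.subset _ (by omega)
  refines i hi := h.refines _ (by omega)
  cover x hx := by
    obtain ⟨_ | i, hi, hxi⟩ := h.cover x hx
    · exact hc x hxi
    · exact ⟨i, by omega, hxi⟩
  le_succ i j x hij hj hi hj' := by
    have := h.le_succ (i + 1) (j + 1) x (by omega) (by omega) hi hj'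
    omega

theorem init (h : IsWeakChain 𝒰 S (k + 1) F) (hc : ∀ x ∈ F (k + 1), ∃ i ≤ k, x ∈ F i) :
    IsWeakChain 𝒰 S k F where
  isClosed i hi := h.isClosed _ (by omega)
  subset i hi := h.subset _ (by omega)
  refines i hi := h.refines _ (by omega)
  cover x hx := by
    obtain ⟨i, hi, hxi⟩ := h.cover x hx
    rcases (show i ≤ k ∨ i = k + 1 by omega) with hi' | rfl
    · exact ⟨i, hi', hxi⟩
    · exact hc x hxi
  le_succ i j x hij hj hi hj' := h.le_succ i j x hij (by omega) hi hj'

/-- A weak chain of minimal length: its first and its last member are not superfluous. -/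
theorem exists_minimal (h : IsWeakChain 𝒰 S k F) : ∃ k F, IsWeakChain 𝒰 S k F ∧
    (∀ k' F', IsWeakChain 𝒰 S k' F' → k ≤ k') ∧
    (0 < k → ∃ x ∈ F 0, ∀ i ≤ k, x ∈ F i → i = 0) ∧
    (0 < k → ∃ x ∈ F k, ∀ i ≤ k, x ∈ F i → i = k) := by
  classical
  have hex : ∃ k F, IsWeakChain 𝒰 S k F := ⟨k, F, h⟩
  obtain ⟨F, hF⟩ := Nat.find_spec hex
  have hmin : ∀ k' F', IsWeakChain 𝒰 S k' F' → Nat.find hex ≤ k' := fun k' F' h' =>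
    Nat.find_min' hex ⟨F', h'⟩
  generalize Nat.find hex = k at hF hmin
  refine ⟨k, F, hF, hmin, fun hk => ?_, fun hk => ?_⟩
  · obtain ⟨k, rfl⟩ := Nat.exists_eq_add_of_le' hk
    by_contra! hcon
    have := hmin k _ (hF.tail fun x hx => by
      obtain ⟨_ | i, hi, hxi, hi0⟩ := hcon x hx
      · exact (hi0 rfl).elim
      · exact ⟨i, by omega, hxi⟩)
    omega
  · obtain ⟨k, rfl⟩ := Nat.exists_eq_add_of_le' hk
    by_contra! hcon
    have := hmin k _ (hF.init fun x hx => by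
      obtain ⟨i, hi, hxi, hi0⟩ := hcon x hx
      exact ⟨i, by omega, hxi⟩)
    omega

end IsWeakChain

/-- In a connected space, weak chains of minimal length are chains. -/
theorem isChainable_of_isWeakChain {X : Type u} [TopologicalSpace X] [ConnectedSpace X]
    (h : ∀ 𝒰 : Set (Set X), (∀ U ∈ 𝒰, IsOpen U) → ⋃₀ 𝒰 = univ →
      ∃ k F, IsWeakChain 𝒰 univ k F) : IsChainable X := by
  intro 𝒰 ho hc
  obtain ⟨k, F, hF⟩ := h 𝒰 ho hc
  obtain ⟨k, F, hF, hmin, -, -⟩ := hF.exists_minimal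
  have hmeet : ∀ i < k, (F i ∩ F (i + 1)).Nonempty := by
    intro i hi
    by_contra hne
    rw [not_nonempty_iff_eq_empty] at hne
    have hP : IsClosed (⋃ j ∈ Iic i, F j) :=
      (finite_Iic i).isClosed_biUnion fun j hj => hF.isClosed j (le_trans hj hi.le)
    have hQ : IsClosed (⋃ j ∈ Icc (i + 1) k, F j) :=
      (finite_Icc _ _).isClosed_biUnion fun j hj => hF.isClosed j hj.2
    have hdis : ∀ x, x ∈ ⋃ j ∈ Iic i, F j → x ∈ ⋃ j ∈ Icc (i + 1) k, F j → False := by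
      intro x hx hx'
      obtain ⟨j, hj, hxj⟩ := mem_iUnion₂.1 hx
      obtain ⟨j', hj', hxj'⟩ := mem_iUnion₂.1 hx'
      have hj : j ≤ i := hj
      have h1 := hF.le_succ j j' x (by have := hj'.1; omega) hj'.2 hxj hxj'
      obtain rfl : j = i := by have := hj'.1; omega
      obtain rfl : j' = j + 1 := by have := hj'.1; omega
      exact eq_empty_iff_forall_notMem.1 hne x ⟨hxj, hxj'⟩
    have hcov : ∀ x, x ∈ (⋃ j ∈ Iic i, F j) ∪ ⋃ j ∈ Icc (i + 1) k, F j := by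
      intro x
      obtain ⟨j, hj, hxj⟩ := hF.cover x (mem_univ x)
      rcases (show j ≤ i ∨ i + 1 ≤ j by omega) with h | h
      · exact Or.inl (mem_iUnion₂.2 ⟨j, h, hxj⟩)
      · exact Or.inr (mem_iUnion₂.2 ⟨j, ⟨h, hj⟩, hxj⟩)
    obtain ⟨k, rfl⟩ := Nat.exists_eq_add_of_le' (show 1 ≤ k by omega)
    have hempty : (⋃ j ∈ Iic i, F j) = ∅ ∨ (⋃ j ∈ Icc (i + 1) (k + 1), F j) = ∅ := by
      by_contra! hne
      obtain ⟨⟨x, hx⟩, y, hy⟩ := hne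
      obtain ⟨z, -, h1, h2⟩ := isPreconnected_closed_iff.1 isPreconnected_univ _ _ hP hQ
        (fun x _ => hcov x) ⟨x, mem_univ x, hx⟩ ⟨y, mem_univ y, hy⟩
      exact hdis z h1 h2
    rcases hempty with h | h
    · have := hmin k _ (hF.tail fun x hx => absurd (mem_iUnion₂.2 ⟨0, Nat.zero_le i, hx⟩)
        (eq_empty_iff_forall_notMem.1 h x))
      omega
    · have := hmin k _ (hF.init fun x hx => absurd (mem_iUnion₂.2 ⟨k + 1, ⟨by omega, le_rfl⟩, hx⟩)
        (eq_empty_iff_forall_notMem.1 h x))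
      omega
  have hne : ∀ i ≤ k, (F i).Nonempty := by
    intro i hi
    rcases Nat.lt_or_ge i k with h | h
    · exact (hmeet i h).left
    · obtain rfl : i = k := le_antisymm hi h
      rcases i with _ | i
      · obtain ⟨x⟩ := ‹ConnectedSpace X›.toNonempty
        obtain ⟨j, hj, hx⟩ := hF.cover x (mem_univ x)
        obtain rfl : j = 0 := by omega
        exact ⟨x, hx⟩
      · exact (hmeet i (by omega)).right
  refine ⟨k + 1, fun i => F i, fun i => hF.isClosed i (by omega), ?_,
    fun i => hF.refines i (by omega), fun i j => ⟨?_, fun hij => ?_⟩⟩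
  · refine iUnion_eq_univ_iff.2 fun x => ?_
    obtain ⟨i, hi, hx⟩ := hF.cover x (mem_univ x)
    exact ⟨⟨i, by omega⟩, hx⟩
  · rintro ⟨x, hi, hj⟩
    rcases le_total (i : ℕ) (j : ℕ) with hij | hij
    · have := hF.le_succ i j x hij (by omega) hi hj
      rw [abs_le]; omega
    · have := hF.le_succ j i x hij (by omega) hj hi
      rw [abs_le]; omega
  · rw [abs_le] at hij
    rcases (show (i : ℕ) = j ∨ (j : ℕ) = i + 1 ∨ (i : ℕ) = j + 1 by omega) with h | h | h
    · change (F i ∩ F j).Nonempty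
      rw [h, inter_self]
      exact hne j (by omega)
    · change (F i ∩ F j).Nonempty
      rw [h]
      exact hmeet i (by omega)
    · change (F i ∩ F j).Nonempty
      rw [h, inter_comm]
      exact hmeet j (by omega)

/-- There is a weak chain that covers the part of `X` over `[u, v]`; the fibre over `u` meets only
its first member, and the fibre over `v` meets only its last one. -/
def HasChain {X : Type u} [TopologicalSpace X] (𝒰 : Set (Set X)) (h : X → ℝ) (u v : ℝ) : Prop :=
  ∃ k F, IsWeakChain 𝒰 (h ⁻¹' Icc u v) k F ∧ (∀ i ≤ k, ∀ p ∈ F i, h p = u → i = 0) ∧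
    ∀ i ≤ k, ∀ p ∈ F i, h p = v → i = k

theorem HasChain.trans {X : Type u} [TopologicalSpace X] {𝒰 : Set (Set X)} {h : X → ℝ} {u v w : ℝ}
    (huv : u < v) (hvw : v < w) (h₁ : HasChain 𝒰 h u v) (h₂ : HasChain 𝒰 h v w) :
    HasChain 𝒰 h u w := by
  obtain ⟨k, F, hF, hFu, hFv⟩ := h₁
  obtain ⟨l, G, hG, hGv, hGw⟩ := h₂
  -- only the last member of the first chain and the first one of the second chain meet the fibre
  -- over `v`
  let H : ℕ → Set X := fun i => if i ≤ k then F i else G (i - (k + 1))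
  have hH1 : ∀ i ≤ k, H i = F i := fun i hi => if_pos hi
  have hH2 : ∀ i, H (i + (k + 1)) = G i := fun i => by
    simp only [H]
    rw [if_neg (by omega), Nat.add_sub_cancel]
  have hsplit : ∀ {P : ℕ → Prop}, (∀ i ≤ k, P i) → (∀ i ≤ l, P (i + (k + 1))) →
      ∀ i ≤ l + (k + 1), P i := by
    intro P h1 h2 i hi
    rcases Nat.lt_or_ge k i with hk | hk
    · have := h2 (i - (k + 1)) (by omega)
      rwa [Nat.sub_add_cancel hk] at this
    · exact h1 i hk
  refine ⟨l + (k + 1), H, ⟨?_, ?_, ?_, ?_, ?_⟩, ?_, ?_⟩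
  · exact hsplit (fun i hi => by rw [hH1 i hi]; exact hF.isClosed i hi)
      fun i hi => by rw [hH2]; exact hG.isClosed i hi
  · exact hsplit (fun i hi => by
      rw [hH1 i hi]
      exact (hF.subset i hi).trans (preimage_mono (Icc_subset_Icc_right hvw.le)))
      fun i hi => by
        rw [hH2]
        exact (hG.subset i hi).trans (preimage_mono (Icc_subset_Icc_left huv.le))
  · exact hsplit (fun i hi => by rw [hH1 i hi]; exact hF.refines i hi)
      fun i hi => by rw [hH2]; exact hG.refines i hi
  · intro p hp
    rcases le_total (h p) v with hv | hv
    · obtain ⟨i, hi, hpi⟩ := hF.cover p ⟨hp.1, hv⟩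
      exact ⟨i, by omega, by rwa [hH1 i hi]⟩
    · obtain ⟨i, hi, hpi⟩ := hG.cover p ⟨hv, hp.2⟩
      exact ⟨i + (k + 1), by omega, by rwa [hH2]⟩
  · intro i j p hij hj hpi hpj
    rcases Nat.lt_or_ge k i with hi | hi
    · rw [← Nat.sub_add_cancel hi, hH2] at hpi
      rw [← Nat.sub_add_cancel (hi.trans_le hij), hH2] at hpj
      have := hG.le_succ _ _ p (by omega) (by omega) hpi hpj
      omega
    · rw [hH1 i hi] at hpi
      rcases Nat.lt_or_ge k j with hj' | hj'
      · rw [← Nat.sub_add_cancel hj', hH2] at hpj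
        have hp : h p = v := le_antisymm (hF.subset i hi hpi).2
          (hG.subset (j - (k + 1)) (by omega) hpj).1
        have h1 := hFv i hi p hpi hp
        have h2 := hGv _ (by omega) p hpj hp
        omega
      · rw [hH1 j hj'] at hpj
        exact hF.le_succ i j p hij hj' hpi hpj
  · refine hsplit (fun i hi p hp => ?_) fun i hi p hp hpu => ?_
    · rw [hH1 i hi] at hp
      exact hFu i hi p hp
    · rw [hH2] at hp
      have := (hG.subset i hi hp).1
      linarith
  · refine hsplit (fun i hi p hp hpw => ?_) fun i hi p hp hpw => ?_
    · rw [hH1 i hi] at hp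
      have := (hF.subset i hi hp).2
      linarith
    · rw [hH2] at hp
      rw [hGw i hi p hp hpw]

/-- By Baire's theorem, a non-empty countable closed set of reals has an isolated point. -/
theorem exists_isolated_of_countable {K : Set ℝ} (hK : IsClosed K) (hc : K.Countable)
    (hne : K.Nonempty) : ∃ x ∈ K, ∃ δ > 0, ∀ y ∈ K, |y - x| < δ → y = x := by
  have := hK.completeSpace_coe
  have : Countable K := hc
  have : Nonempty K := hne.to_subtype
  obtain ⟨x, y, hy⟩ := nonempty_interior_of_iUnion_of_closed (f := fun x : K => {x})
    (fun x => isClosed_singleton) (iUnion_of_singleton _)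
  obtain ⟨δ, hδ, h⟩ := Metric.mem_nhds_iff.1 (mem_interior_iff_mem_nhds.1 hy)
  have hyx : y = x := mem_singleton_iff.1 (interior_subset hy)
  subst hyx
  exact ⟨y, y.2, δ, hδ, fun z hz hzy => congr_arg Subtype.val (h (a := ⟨z, hz⟩) hzy)⟩

/-- Call `t` free if the fibre of `h` over `t` lies in a member of `𝒰`. If only countably many
points are not free, and there are chains across arbitrarily short intervals around each of these
points, then there are chains between any two free points: the set of points that are bad locally is
compact and countable, and hence it would have an isolated point. -/
theorem hasChain_of_countable {X : Type u} [TopologicalSpace X] [CompactSpace X]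
    {𝒰 : Set (Set X)} (ho : ∀ U ∈ 𝒰, IsOpen U) {h : X → ℝ} (hh : Continuous h)
    (hN : {t | ¬ ∃ U ∈ 𝒰, h ⁻¹' {t} ⊆ U}.Countable)
    (htube : ∀ x, ∀ ε > 0, ∃ u v, x - ε < u ∧ u < x ∧ x < v ∧ v < x + ε ∧
      (∃ U ∈ 𝒰, h ⁻¹' {u} ⊆ U) ∧ (∃ U ∈ 𝒰, h ⁻¹' {v} ⊆ U) ∧ HasChain 𝒰 h u v)
    {u v : ℝ} (huv : u < v) (hu : ∃ U ∈ 𝒰, h ⁻¹' {u} ⊆ U) (hv : ∃ U ∈ 𝒰, h ⁻¹' {v} ⊆ U) :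
    HasChain 𝒰 h u v := by
  set Free : ℝ → Prop := fun t => ∃ U ∈ 𝒰, h ⁻¹' {t} ⊆ U with hFree
  set L : Set ℝ := {t | ∃ δ > 0, ∀ u v, Free u → Free v → u < v → |u - t| < δ → |v - t| < δ →
    HasChain 𝒰 h u v} with hL
  have hdense : ∀ {a b : ℝ}, a < b → ∃ w, a < w ∧ w < b ∧ Free w := by
    intro a b hab
    obtain ⟨w, hw, hwf⟩ := (hN.dense_compl ℝ).exists_between hab
    exact ⟨w, hwf.1, hwf.2, not_not.1 hw⟩
  have hLo : IsOpen L := by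
    rw [Metric.isOpen_iff]
    rintro t ⟨δ, hδ, H⟩
    refine ⟨δ / 2, half_pos hδ, fun s hs => ⟨δ / 2, half_pos hδ, fun u v hu hv huv h1 h2 => ?_⟩⟩
    rw [Metric.mem_ball, Real.dist_eq] at hs
    refine H u v hu hv huv ?_ ?_
    · have := abs_sub_le u s t; linarith
    · have := abs_sub_le v s t; linarith
  have hfreeL : ∀ t, Free t → t ∈ L := by
    rintro t ⟨U, hU, htU⟩
    have hcl : IsClosed (h '' Uᶜ) := hh.isClosedMap _ (ho U hU).isClosed_compl
    obtain ⟨δ, hδ, H⟩ := Metric.isOpen_iff.1 hcl.isOpen_compl t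
      (by rintro ⟨p, hp, hpt⟩; exact hp (htU hpt))
    refine ⟨δ, hδ, fun u v _ _ huv h1 h2 => ⟨0, _,
      .single (isClosed_Icc.preimage hh) hU fun p hp => ?_, fun i hi _ _ _ => by omega,
      fun i hi _ _ _ => by omega⟩⟩
    by_contra hpU
    refine H (a := h p) ?_ ⟨p, hpU, rfl⟩
    rw [Metric.mem_ball, Real.dist_eq]
    rw [abs_lt] at *
    have := hp.1
    have := hp.2
    constructor <;> linarith
  -- chains over intervals contained in `L`
  have hseg : ∀ a b, Free a → Free b → a < b → Icc a b ⊆ L → HasChain 𝒰 h a b := by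
    intro a b ha hb hab hsub
    choose! δ hδ H using fun t (ht : t ∈ L) => ht
    obtain ⟨ε, hε, hε'⟩ := lebesgue_number_lemma_of_metric (c := fun t : Icc a b =>
      Metric.ball (t : ℝ) (δ t)) isCompact_Icc (fun t => Metric.isOpen_ball)
      fun t ht => mem_iUnion.2 ⟨⟨t, ht⟩, Metric.mem_ball_self (hδ t (hsub ht))⟩
    have hshort : ∀ u v, Free u → Free v → a ≤ u → u < v → v ≤ b → v < u + ε →
        HasChain 𝒰 h u v := by
      intro u v hu hv hau huv hvb huvε
      obtain ⟨t, ht⟩ := hε' u ⟨hau, huv.le.trans hvb⟩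
      refine H t (hsub t.2) u v hu hv huv (ht (Metric.mem_ball_self hε)) (ht ?_)
      rw [Metric.mem_ball, Real.dist_eq, abs_of_pos (by linarith)]
      linarith
    have hind : ∀ m : ℕ, ∀ v, Free v → a < v → v ≤ b → v < a + (m + 1) * (ε / 2) →
        HasChain 𝒰 h a v := by
      intro m
      induction m with
      | zero =>
        intro v hv hav hvb hm
        exact hshort a v ha hv le_rfl hav hvb (by norm_num at hm; linarith)
      | succ m ih =>
        intro v hv hav hvb hm
        rcases lt_or_ge v (a + ε) with h1 | h1
        · exact hshort a v ha hv le_rfl hav hvb h1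
        · obtain ⟨w, hw1, hw2, hw⟩ := hdense (show v - ε < v - ε / 2 by linarith)
          push_cast at hm
          refine (ih w hw (by linarith) (by linarith) (by linarith)).trans (by linarith)
            (by linarith) (hshort w v hw hv (by linarith) (by linarith) hvb (by linarith))
    obtain ⟨m, hm⟩ := exists_nat_gt ((b - a) / (ε / 2))
    rw [div_lt_iff₀ (half_pos hε)] at hm
    exact hind m b hb hab le_rfl (by linarith)
  by_cases hLu : L = univ
  · exact hseg u v hu hv huv (hLu ▸ subset_univ _)
  · exfalso
    obtain ⟨x, hx, δ, hδ, hiso⟩ := exists_isolated_of_countable hLo.isClosed_compl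
      (hN.mono fun t ht hf => ht (hfreeL t hf)) (nonempty_compl.2 hLu)
    have hside : ∀ a b, x - δ < a → b < x + δ → (b < x ∨ x < a) → Icc a b ⊆ L := by
      intro a b h1 h2 h3 t ht
      by_contra htL
      have := hiso t htL (abs_lt.2 ⟨by have := ht.1; linarith, by have := ht.2; linarith⟩)
      subst this
      rcases h3 with h3 | h3
      · exact absurd ht.2 (not_le.2 h3)
      · exact absurd ht.1 (not_le.2 h3)
    refine hx ⟨δ, hδ, fun a b ha hb hab h1 h2 => ?_⟩
    rw [abs_lt] at h1 h2
    have hxf : ¬ Free x := fun hf => hx (hfreeL x hf)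
    rcases lt_trichotomy b x with hbx | rfl | hbx
    · exact hseg a b ha hb hab (hside a b (by linarith) (by linarith) (Or.inl hbx))
    · exact (hxf hb).elim
    rcases lt_trichotomy x a with hax | rfl | hax
    · exact hseg a b ha hb hab (hside a b (by linarith) (by linarith) (Or.inr hax))
    · exact (hxf ha).elim
    obtain ⟨u, v, h3, h4, h5, h6, hu, hv, huv⟩ := htube x (min (x - a) (b - x))
      (lt_min (by linarith) (by linarith))
    have h7 := min_le_left (x - a) (b - x)
    have h8 := min_le_right (x - a) (b - x)
    refine (HasChain.trans (by linarith) (h4.trans h5) (hseg a u ha hu (by linarith)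
      (hside a u (by linarith) (by linarith) (Or.inl h4))) huv).trans (by linarith) (by linarith)
      (hseg v b hv hb (by linarith) (hside v b (by linarith) (by linarith) (Or.inr h5)))

/-! ### Chainability of the interval towers -/

namespace ResolutionTower

/-- If the fibres of `g` are countable, then only countably many fibres of the first coordinate are
not contained in a member of a given open cover. -/
theorem countable_nonfree {M : Type u} [MetricSpace M] [CompactSpace M] {g : ℝ → M} {n : ℕ}
    (hg : IsResolving g) (hc : ∀ a, {r | 0 < r ∧ g r = a}.Countable)
    (𝒰 : Set (Set (ResolutionTower g (n + 1)))) (ho : ∀ U ∈ 𝒰, IsOpen U) (hcov : ⋃₀ 𝒰 = univ) :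
    {x : M | ¬ ∃ U ∈ 𝒰, head ⁻¹' {x} ⊆ U}.Countable := by
  induction n with
  | zero =>
    convert countable_empty
    refine eq_empty_of_forall_notMem fun x hx => hx ?_
    obtain ⟨w⟩ : Nonempty (ResolutionTower g 0) := ⟨fun i => i.elim0⟩
    obtain ⟨U, hU, hw⟩ : cons x w ∈ ⋃₀ 𝒰 := hcov ▸ mem_univ _
    refine ⟨U, hU, fun p hp => ?_⟩
    rwa [ext_head_tail (q := cons x w) hp (Subsingleton.elim _ _)]
  | succ n ih =>
    choose ε hε 𝒲 h𝒲f h𝒲o h𝒲c h𝒲U using fun x => exists_tube hg x 𝒰 ho hcov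
    obtain ⟨t, ht⟩ := isCompact_univ.elim_finite_subcover (fun x => Metric.ball x (ε x))
      (fun x => Metric.isOpen_ball) fun x _ => mem_iUnion.2 ⟨x, Metric.mem_ball_self (hε x)⟩
    refine Countable.mono ?_ (t.countable_toSet.biUnion fun x _ =>
      (countable_singleton x).union ((ih (𝒲 x) (h𝒲o x) (h𝒲c x)).biUnion fun a _ =>
        (hc a).biUnion fun r hr => (hg.finiteSpheres x r hr.1).countable))
    intro y hy
    obtain ⟨x, hx, hyx⟩ := mem_iUnion₂.1 (ht (mem_univ y))
    refine mem_iUnion₂.2 ⟨x, hx, ?_⟩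
    by_cases hne : y = x
    · exact Or.inl hne
    · refine Or.inr (mem_iUnion₂.2 ⟨g (dist y x), ?_, mem_iUnion₂.2
        ⟨dist y x, ⟨dist_pos.2 hne, rfl⟩, rfl⟩⟩)
      rintro ⟨W, hW, hsub⟩
      obtain ⟨U, hU, h⟩ := h𝒲U x W hW
      refine hy ⟨U, hU, fun p hp => ?_⟩
      obtain rfl : p.head = y := hp
      refine h p hyx ?_
      rw [retr_of_head_ne hne]
      exact hsub rfl

/-- The first coordinate of a point of `I_{n+1}`, as a real number. -/
def realHead {g : ℝ → unitInterval} {n : ℕ} (p : ResolutionTower g (n + 1)) : ℝ := p.head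

variable {g : ℝ → unitInterval} {n : ℕ}

theorem continuous_realHead : Continuous (realHead : ResolutionTower g (n + 1) → ℝ) :=
  continuous_subtype_val.comp continuous_head

/-- A chain of the fibre over `x` is pulled back by the retraction onto this fibre. The fibres over
certain points, on both sides of `x`, meet the first and the last member only. -/
theorem exists_hasChain_around (hg : IsResolving g) {𝒰 : Set (Set (ResolutionTower g (n + 1)))}
    (ho : ∀ U ∈ 𝒰, IsOpen U) (hcov : ⋃₀ 𝒰 = univ)
    (hchain : ∀ 𝒲 : Set (Set (ResolutionTower g n)), (∀ W ∈ 𝒲, IsOpen W) → ⋃₀ 𝒲 = univ →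
      ∃ k F, IsWeakChain 𝒲 univ k F) (x : unitInterval) :
    ∃ ε > 0, ∃ V₁ V₂ : Set unitInterval, IsOpen V₁ ∧ V₁.Nonempty ∧ IsOpen V₂ ∧ V₂.Nonempty ∧
      ∀ u v : ℝ, u < x → (x : ℝ) < v → x - ε < u → v < x + ε → g (x - u) ∈ V₁ → g (v - x) ∈ V₂ →
        HasChain 𝒰 realHead u v := by
  obtain ⟨ε, hε, 𝒲, -, h𝒲o, h𝒲c, h𝒲U⟩ := exists_tube hg x 𝒰 ho hcov
  obtain ⟨k, F, hF⟩ := hchain 𝒲 h𝒲o h𝒲c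
  obtain ⟨k, F, hF, -, hF0, hFk⟩ := hF.exists_minimal
  have hend : ∀ m ≤ k, (0 < k → ∃ w ∈ F m, ∀ i ≤ k, w ∈ F i → i = m) →
      ∃ δ > 0, ∃ V : Set unitInterval, IsOpen V ∧ V.Nonempty ∧
        ∀ p : ResolutionTower g (n + 1), p.head ≠ x → dist p.head x < δ → g (dist p.head x) ∈ V →
          ∀ i ≤ k, p.retr x ∈ F i → i = m := by
    intro m hm h
    rcases Nat.eq_zero_or_pos k with rfl | hk
    · exact ⟨1, one_pos, univ, isOpen_univ, univ_nonempty, fun p _ _ _ i hi _ => by omega⟩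
    obtain ⟨w, -, hw⟩ := h hk
    have hcl : IsClosed (⋃ i ∈ Iic k \ {m}, F i) :=
      ((finite_Iic k).sdiff).isClosed_biUnion fun i hi => hF.isClosed i hi.1
    obtain ⟨δ, hδ, V, hV, hVne, hVU⟩ := exists_fibers_subset hg
      (hcl.isOpen_compl.preimage (continuous_retr hg x)) (q := cons x w) (by
        rw [mem_preimage, retr_cons]
        intro hmem
        obtain ⟨i, hi, hwi⟩ := mem_iUnion₂.1 hmem
        exact hi.2 (hw i hi.1 hwi))
    refine ⟨δ, hδ, V, hV, hVne, fun p h1 h2 h3 i hi hpi => ?_⟩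
    by_contra hne
    exact hVU p h1 h2 h3 (mem_iUnion₂.2 ⟨i, ⟨hi, hne⟩, hpi⟩)
  obtain ⟨δ₁, hδ₁, V₁, hV₁, hV₁ne, h₁⟩ := hend 0 (Nat.zero_le k) hF0
  obtain ⟨δ₂, hδ₂, V₂, hV₂, hV₂ne, h₂⟩ := hend k le_rfl hFk
  refine ⟨min ε (min δ₁ δ₂), lt_min hε (lt_min hδ₁ hδ₂), V₁, V₂, hV₁, hV₁ne, hV₂, hV₂ne,
    fun u v hux hxv hu hv hgu hgv => ?_⟩
  have m1 := min_le_left ε (min δ₁ δ₂)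
  have m2 := (min_le_right ε (min δ₁ δ₂)).trans (min_le_left δ₁ δ₂)
  have m3 := (min_le_right ε (min δ₁ δ₂)).trans (min_le_right δ₁ δ₂)
  have hd : ∀ p : ResolutionTower g (n + 1), dist p.head x = |realHead p - x| := fun p => rfl
  refine ⟨k, fun i => realHead ⁻¹' Icc u v ∩ retr x ⁻¹' F i, ⟨fun i hi => ?_,
    fun i hi => inter_subset_left, fun i hi => ?_, fun p hp => ?_, fun i j p hij hj hpi hpj => ?_⟩,
    fun i hi p hp hpu => ?_, fun i hi p hp hpv => ?_⟩
  · exact (isClosed_Icc.preimage continuous_realHead).inter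
      ((hF.isClosed i hi).preimage (continuous_retr hg x))
  · obtain ⟨W, hW, hFW⟩ := hF.refines i hi
    obtain ⟨U, hU, h⟩ := h𝒲U W hW
    refine ⟨U, hU, fun p hp => h p ?_ (hFW hp.2)⟩
    have h1 := hp.1.1
    have h2 := hp.1.2
    rw [hd, abs_lt]
    constructor <;> linarith
  · obtain ⟨i, hi, hpi⟩ := hF.cover (p.retr x) (mem_univ _)
    exact ⟨i, hi, hp, hpi⟩
  · exact hF.le_succ i j _ hij hj hpi.2 hpj.2
  · have hdu : dist p.head x = x - u := by rw [hd, hpu, abs_of_neg (by linarith)]; ring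
    exact h₁ p (dist_pos.1 (by rw [hdu]; linarith)) (by rw [hdu]; linarith) (hdu ▸ hgu) i hi hp.2
  · have hdv : dist p.head x = v - x := by rw [hd, hpv, abs_of_pos (by linarith)]
    exact h₂ p (dist_pos.1 (by rw [hdv]; linarith)) (by rw [hdv]; linarith) (hdv ▸ hgv) i hi hp.2

theorem exists_isWeakChain (hg : IsResolving g) (hc : ∀ a, {r | 0 < r ∧ g r = a}.Countable) (n : ℕ)
    (𝒰 : Set (Set (ResolutionTower g n))) (ho : ∀ U ∈ 𝒰, IsOpen U) (hcov : ⋃₀ 𝒰 = univ) :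
    ∃ k F, IsWeakChain 𝒰 univ k F := by
  induction n with
  | zero =>
    obtain ⟨w⟩ : Nonempty (ResolutionTower g 0) := ⟨fun i => i.elim0⟩
    obtain ⟨U, hU, hw⟩ : w ∈ ⋃₀ 𝒰 := hcov ▸ mem_univ _
    exact ⟨0, _, .single isClosed_univ hU fun p _ => Subsingleton.elim w p ▸ hw⟩
  | succ n ih =>
    have := compactSpace hg (n + 1)
    obtain ⟨q⟩ : Nonempty (ResolutionTower g (n + 1)) := nonempty _
    obtain ⟨U₀, hU₀, -⟩ : q ∈ ⋃₀ 𝒰 := hcov ▸ mem_univ _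
    have hmem : ∀ p : ResolutionTower g (n + 1), realHead p ∈ Icc (0 : ℝ) 1 := fun p => p.head.2
    have hout : ∀ t : ℝ, t ∉ Icc (0 : ℝ) 1 → ∃ U ∈ 𝒰, realHead ⁻¹' {t} ⊆ U := fun t ht =>
      ⟨U₀, hU₀, fun p hp => (ht (by rw [← show realHead p = t from hp]; exact hmem p)).elim⟩
    have hN : {t | ¬ ∃ U ∈ 𝒰, realHead ⁻¹' {t} ⊆ U}.Countable := by
      refine ((countable_nonfree hg hc 𝒰 ho hcov).image Subtype.val).mono fun t ht => ?_
      have ht' : t ∈ Icc (0 : ℝ) 1 := by_contra fun h => ht (hout t h)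
      refine ⟨⟨t, ht'⟩, fun h => ht ?_, rfl⟩
      obtain ⟨U, hU, h⟩ := h
      exact ⟨U, hU, fun p hp => h (Subtype.ext hp)⟩
    suffices htube : _ by
      obtain ⟨k, F, hF, -⟩ := hasChain_of_countable ho continuous_realHead hN htube
        (show (-1 : ℝ) < 2 by norm_num) (hout _ (by simp)) (hout _ (by simp))
      have hpre : (realHead ⁻¹' Icc (-1) 2 : Set (ResolutionTower g (n + 1))) = univ :=
        eq_univ_of_forall fun p => ⟨by linarith [(hmem p).1], by linarith [(hmem p).2]⟩
      exact ⟨k, F, hpre ▸ hF⟩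
    intro x ε hε
    -- points at suitable distances with fibres contained in a member of the cover
    have hpick : ∀ σ : ℝ, σ ≠ 0 → ∀ δ > 0, ∀ V : Set unitInterval, IsOpen V → V.Nonempty →
        ∃ r, 0 < r ∧ r < δ ∧ g r ∈ V ∧ ∃ U ∈ 𝒰, realHead ⁻¹' {x + σ * r} ⊆ U := by
      rintro σ hσ δ hδ V hV ⟨a, ha⟩
      obtain ⟨r, hr, hrδ, rfl⟩ := hg.exists_small_radius a hδ
      have hinj : InjOn (fun r : ℝ => x + σ * r)
          ((fun r : ℝ => x + σ * r) ⁻¹' {t | ¬ ∃ U ∈ 𝒰, realHead ⁻¹' {t} ⊆ U}) :=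
        fun s _ t _ h => mul_left_cancel₀ hσ (add_left_cancel h)
      have hd := (hN.preimage_of_injOn hinj).dense_compl ℝ
      have hev : ∀ᶠ s in 𝓝 r, 0 < s ∧ s < δ ∧ g s ∈ V := by
        filter_upwards [lt_mem_nhds hr, gt_mem_nhds hrδ, (hg.tendsto hr).eventually
          (hV.mem_nhds ha)] with s h1 h2 h3 using ⟨h1, h2, h3⟩
      obtain ⟨s, hs, hsf⟩ := mem_closure_iff_nhds.1 (hd r) _ hev
      exact ⟨s, hs.1, hs.2.1, hs.2.2, not_not.1 hsf⟩
    by_cases hx : x ∈ Icc (0 : ℝ) 1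
    · obtain ⟨δ, hδ, V₁, V₂, hV₁, hV₁ne, hV₂, hV₂ne, h⟩ :=
        exists_hasChain_around hg ho hcov ih ⟨x, hx⟩
      obtain ⟨r, hr, hrδ, hrV, hrf⟩ := hpick (-1) (by norm_num) (min ε δ) (lt_min hε hδ) V₁ hV₁ hV₁ne
      obtain ⟨s, hs, hsδ, hsV, hsf⟩ := hpick 1 one_ne_zero (min ε δ) (lt_min hε hδ) V₂ hV₂ hV₂ne
      have m1 := min_le_left ε δ
      have m2 := min_le_right ε δ
      refine ⟨x + -1 * r, x + 1 * s, by linarith, by linarith, by linarith, by linarith, hrf, hsf,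
        h _ _ ?_ ?_ ?_ ?_ ?_ ?_⟩ <;> simp only
      · linarith
      · linarith
      · linarith
      · linarith
      · convert hrV using 2; ring
      · convert hsV using 2; ring
    · -- away from the unit interval there is nothing to cover
      obtain ⟨δ, hδ, hδx⟩ := Metric.isOpen_iff.1 isClosed_Icc.isOpen_compl x hx
      have hball : ∀ t, |t - x| < δ → t ∉ Icc (0 : ℝ) 1 := fun t ht => hδx (a := t) ht
      have hm := lt_min hε hδ
      have m1 := min_le_left ε δ
      have m2 := min_le_right ε δ
      refine ⟨x - min ε δ / 2, x + min ε δ / 2, by linarith, by linarith, by linarith, by linarith,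
        hout _ (hball _ (abs_lt.2 ⟨by linarith, by linarith⟩)),
        hout _ (hball _ (abs_lt.2 ⟨by linarith, by linarith⟩)), 0, _,
        .single (isClosed_Icc.preimage continuous_realHead) hU₀ fun p hp => ?_,
        fun i hi _ _ _ => by omega, fun i hi _ _ _ => by omega⟩
      have h1 := hp.1
      have h2 := hp.2
      exact (hball _ (abs_lt.2 ⟨by linarith, by linarith⟩) (hmem p)).elim

end ResolutionTower

theorem countable_zigzag_eq (a : unitInterval) : {r | 0 < r ∧ zigzag r = a}.Countable := by
  refine (countable_iUnion fun k : ℤ => (({2 ^ k * ((3 + (a : ℝ)) / 2),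
    2 ^ k * ((3 - (a : ℝ)) / 2)} : Set ℝ).toFinite.countable)).mono ?_
  rintro r ⟨hr, h⟩
  have h' := congr_arg Subtype.val h
  rw [coe_zigzag hr] at h'
  obtain ⟨k, m, h1, h2, rfl⟩ := exists_eq_zpow_mul hr
  rw [dyadicMantissa_zpow_mul k h1 h2] at h'
  refine mem_iUnion.2 ⟨k, ?_⟩
  rcases abs_cases (2 * m - 3) with ⟨h3, -⟩ | ⟨h3, -⟩ <;> rw [h3] at h'
  · left; rw [← h']; ring
  · right; rw [mem_singleton_iff, ← h']; ring

theorem isChainable_chatyrkoInterval (n : ℕ) : IsChainable (ChatyrkoInterval n) := by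
  have := ResolutionTower.connectedSpace isResolving_zigzag n
  exact isChainable_of_isWeakChain
    (ResolutionTower.exists_isWeakChain isResolving_zigzag countable_zigzag_eq n)

theorem mainTheorem11 :
    -- the chainable continua `I_n`
    IsFullyClosedSequence unitInterval ChatyrkoInterval (ResolutionTower.bonding zigzag) ∧
    (∀ n : ℕ, 1 ≤ n →
      IsContinuum (ChatyrkoInterval n) ∧ SeparableSpace (ChatyrkoInterval n) ∧
      FirstCountableTopology (ChatyrkoInterval n) ∧ IsChainable (ChatyrkoInterval n) ∧
      coveringDim (ChatyrkoInterval n) = 1 ∧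
      smallInductiveDimension (ChatyrkoInterval n) = n ∧
      largeInd (ChatyrkoInterval n) = n ∧ indZero (ChatyrkoInterval n) = n) ∧
    -- the homogeneous continua `(S_1)_n`
    IsFullyClosedSequence UnitAddCircle ChatyrkoCircle (ResolutionTower.bonding winding) ∧
    (∀ n : ℕ, 1 ≤ n →
      IsContinuum (ChatyrkoCircle n) ∧ SeparableSpace (ChatyrkoCircle n) ∧
      FirstCountableTopology (ChatyrkoCircle n) ∧ IsHomogeneousSpace (ChatyrkoCircle n) ∧
      coveringDim (ChatyrkoCircle n) = 1 ∧
      smallInductiveDimension (ChatyrkoCircle n) = n ∧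
      largeInd (ChatyrkoCircle n) = n ∧ indZero (ChatyrkoCircle n) = n) ∧
    -- every other sequence of spaces obtained by such fully closed maps
    (∀ (X : ℕ → Type u) [∀ n, TopologicalSpace (X n)] (f : ∀ n, X (n + 1) → X n),
      (IsFullyClosedSequence unitInterval X f ∨ IsFullyClosedSequence UnitAddCircle X f) →
      ∀ n : ℕ, 1 ≤ n → indZero (X n) ≤ n ∧
        (smallInductiveDimension (X n) = n → largeInd (X n) = n ∧ indZero (X n) = n)) := by
  have hz := isResolving_zigzag
  have hw := isResolving_winding
  refine ⟨ResolutionTower.isFullyClosedSequence hz, fun n hn => ?_,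
    ResolutionTower.isFullyClosedSequence hw, fun n hn => ?_, fun X _ f h n hn => ?_⟩
  · exact ⟨ResolutionTower.isContinuum hz n, ResolutionTower.separableSpace hz n,
      ResolutionTower.firstCountableTopology hz n, isChainable_chatyrkoInterval n,
      ResolutionTower.coveringDim_eq_one hz hn,
      (ResolutionTower.isFullyClosedSequence hz).dimensions_eq hz.finiteSpheres hn
        (ResolutionTower.not_hasSmallInductiveDimensionLT hz n)⟩
  · exact ⟨ResolutionTower.isContinuum hw n, ResolutionTower.separableSpace hw n,
      ResolutionTower.firstCountableTopology hw n, isHomogeneousSpace_chatyrkoCircle n,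
      ResolutionTower.coveringDim_eq_one hw hn,
      (ResolutionTower.isFullyClosedSequence hw).dimensions_eq hw.finiteSpheres hn
        (ResolutionTower.not_hasSmallInductiveDimensionLT hw n)⟩
  · exact h.elim (fun h => h.dimensions unitInterval.hasFiniteSpheres hn)
      fun h => h.dimensions UnitAddCircle.hasFiniteSpheres hn
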